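/- Let $M$ be a smooth $n$-manifold, let $0\le k<n$, and let $H$ be a smooth $(n-k)$-multivector density on $M$, that is, a smooth section of $L^{-n}\otimes\Lambda^{n-k}TM$, where $L^{-n}_x$ is the line of densities on $T_xM$, i.e. of maps $\mu:\Lambda^nT_xM\setminus\{0\}\to\mathbb{R}$ with $\mu(\lambda\omega)=|\lambda|\,\mu(\omega)$ for $\lambda\neq 0$. Suppose that $H$ is divergence-free: in each chart, with $H=|dx^1\cdots dx^n|\otimes\frac{1}{(n-k)!}\sum H^{i_1\dots i_{n-k}}\,\partial_{i_1}\wedge\dots\wedge\partial_{i_{n-k}}$ and $H^{i_1\dots i_{n-k}}$ antisymmetric, $\sum_j\partial_jH^{j i_2\dots i_{n-k}}=0$ for all $i_2,\dots,i_{n-k}$. A coorientation $o$ of an immersed manifold $S\looparrowright M$ is an orientation of its normal bundle $TM/TS$. If $S$ is compact, of dimension $k$, without boundary and cooriented by $o$, then $\int_{S,o}H$ is the integral over $S$ of the density $v\mapsto\langle\nu^*,H(\nu\wedge v)\rangle$ on $S$, where $v\in\Lambda^kT_qS$, $\nu\in\Lambda^{n-k}(T_qM/T_qS)$ is positive and $\nu^*$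 is its dual, $\langle\nu^*,\nu\rangle=1$. For an immersed cooriented sphere $S^k$ this number is the electric charge $Q_e(S^k,o)$. The boundary of a cooriented immersed manifold $\Sigma$ carries the induced coorientation: $(w,\nu_1,\dots,\nu_p)$, with $w$ tangent to $\Sigma$ and outward pointing, is positive for $\partial\Sigma$ if and only if $(\nu_1,\dots,\nu_p)$ is positive for $\Sigma$ (a coorientation of an immersion of codimension $p=0$ is a locally constant sign; for negative sign the induced coorientation is the one for which $w$ is negative). 1. If an immersed cooriented sphere $(S^k,o)$ is the boundary, with the induced coorientation, of an immersed compact cooriented smooth $(k+1)$-manifold $\Sigma$ with boundary, then $Q_e(S^k,o)=0$. 2. If $(S^k,o)$ and $({S'}^k,o')$ are immersed cooriented $k$-spheres and there is an immersed compact cooriented smooth $(k+1)$-manifold $\Sigma$ with boundary whose boundary, with the induced coorientation, is the disjoint union of $(S^k,o)$ and $({S'}^k,-o')$, then $Q_e(S^k,o)=Q_e({S'}^k,o')$. -/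

import Mathlib

open Set Topology MeasureTheory
open scoped Manifold ContDiff

noncomputable section

namespace ElectricCharge

/-! ### Linear algebra: multivector densities and induced orientations -/

/-- For a real vector space `V` of dimension `n`, this is `L⁻ⁿ(V) ⊗ Λᵐ V`: densities on `V` with
values in the `m`-vectors of `V`. An `m`-vector is regarded as an alternating `m`-linear form on the
dual space, `X₁ ∧ ⋯ ∧ Xₘ` being the form `(θ₁, …, θₘ) ↦ det (θᵢ (Xⱼ))`. The homogeneity
`h (λ ω) = |λ| h (ω)` of a density `h` on `Λⁿ V` is expressed on `ω = v₁ ∧ ⋯ ∧ vₙ`, where a linear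
map `A` acts through `A v₁ ∧ ⋯ ∧ A vₙ = det A • v₁ ∧ ⋯ ∧ vₙ`. -/
@[ext]
structure MultivectorDensity (n m : ℕ) (V : Type*) [AddCommGroup V] [Module ℝ V] where
  /-- the `m`-vector assigned to the `n`-vector `v₁ ∧ ⋯ ∧ vₙ` -/
  toFun : (Fin n → V) → Module.Dual ℝ V [⋀^Fin m]→ₗ[ℝ] ℝ
  map_linear : ∀ (A : V →ₗ[ℝ] V) (v : Fin n → V),
    toFun (fun i => A (v i)) = |LinearMap.det A| • toFun v

/-- Let `B ⊆ V` (the tangent space of a manifold with boundary), `A ⊆ B` a hyperplane of `B` (the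
tangent space of its boundary) and `w ∈ B` an outward vector. The orientation `oA` of `V ⧸ A` is
induced by the orientation `oB` of `V ⧸ B` when
`(w, ν₁, …, νₚ)` is positive in `V ⧸ A` if and only if `(ν₁, …, νₚ)` is positive in `V ⧸ B`. -/
def InducedOrientation {V : Type*} [AddCommGroup V] [Module ℝ V] {p : ℕ} (A B : Submodule ℝ V)
    (w : V) (oA : Orientation ℝ (V ⧸ A) (Fin (p + 1))) (oB : Orientation ℝ (V ⧸ B) (Fin p)) :
    Prop :=
  ∀ (ν : Fin p → V) (bA : Module.Basis (Fin (p + 1)) ℝ (V ⧸ A)) (bB : Module.Basis (Fin p) ℝ (V ⧸ B)),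
    bA 0 = A.mkQ w → (∀ i, bA i.succ = A.mkQ (ν i)) → (∀ i, bB i = B.mkQ (ν i)) →
      (bA.orientation = oA ↔ bB.orientation = oB)

/-! ### Smooth multivector densities on a manifold and their divergence -/

section Field

variable {n m : ℕ} {M : Type*} [TopologicalSpace M] [ChartedSpace (EuclideanSpace ℝ (Fin n)) M]

/-- The coordinate vector field `∂ᵢ` of the chart `e`, at the point with coordinates `y`. -/
def coordVector (e : OpenPartialHomeomorph M (EuclideanSpace ℝ (Fin n)))
    (y : EuclideanSpace ℝ (Fin n)) (i : Fin n) : TangentSpace (𝓡 n) (e.symm y) :=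
  mfderiv (𝓡 n) (𝓡 n) e.symm y (EuclideanSpace.single i (1 : ℝ) : EuclideanSpace ℝ (Fin n))

/-- The coordinate covector field `dxⁱ` of the chart `e`, at the point with coordinates `y`. -/
def coordCovector (e : OpenPartialHomeomorph M (EuclideanSpace ℝ (Fin n)))
    (y : EuclideanSpace ℝ (Fin n)) (i : Fin n) :
    Module.Dual ℝ (TangentSpace (𝓡 n) (e.symm y)) :=
  (EuclideanSpace.proj i : EuclideanSpace ℝ (Fin n) →L[ℝ] ℝ).toLinearMap ∘ₗ
    (mfderiv (𝓡 n) (𝓡 n) e (e.symm y)).toLinearMap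

/-- The component `H^{I 0 … I (m-1)}` of a field of multivector densities in the chart `e`, as a
function of the coordinates: `H = |dx¹ ⋯ dxⁿ| ⊗ (1 / m!) ∑ H^{i₁ … iₘ} ∂_{i₁} ∧ ⋯ ∧ ∂_{iₘ}`. -/
def component (H : ∀ x : M, MultivectorDensity n m (TangentSpace (𝓡 n) x))
    (e : OpenPartialHomeomorph M (EuclideanSpace ℝ (Fin n))) (I : Fin m → Fin n)
    (y : EuclideanSpace ℝ (Fin n)) : ℝ :=
  (H (e.symm y)).toFun (coordVector e y) (fun a => coordCovector e y (I a))

variable (n m M) in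
/-- A smooth section of `L⁻ⁿ ⊗ Λᵐ TM`: a smooth `m`-multivector density on the `n`-manifold `M`. -/
structure MultivectorDensityField where
  /-- the value at each point -/
  toFun : ∀ x : M, MultivectorDensity n m (TangentSpace (𝓡 n) x)
  smooth : ∀ e ∈ atlas (EuclideanSpace ℝ (Fin n)) M, ∀ I : Fin m → Fin n,
    ContDiffOn ℝ ∞ (component toFun e I) e.target

/-- The component `(div H)^I = ∑ⱼ ∂ⱼ H^{j I}` of the exterior divergence in the chart `e`. -/
def divComponent (H : MultivectorDensityField n (m + 1) M)
    (e : OpenPartialHomeomorph M (EuclideanSpace ℝ (Fin n))) (I : Fin m → Fin n)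
    (y : EuclideanSpace ℝ (Fin n)) : ℝ :=
  ∑ j : Fin n, fderiv ℝ (component H.toFun e (Fin.cons j I)) y (EuclideanSpace.single j (1 : ℝ))

/-- `div H = 0`. -/
def IsDivergenceFree (H : MultivectorDensityField n (m + 1) M) : Prop :=
  ∀ e ∈ atlas (EuclideanSpace ℝ (Fin n)) M, ∀ I : Fin m → Fin n, ∀ y ∈ e.target,
    divComponent H e I y = 0

end Field

/-! ### Integration of densities -/

section Integral

variable {k : ℕ} {S : Type*} [TopologicalSpace S] [ChartedSpace (EuclideanSpace ℝ (Fin k)) S]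
  [IsManifold (𝓡 k) ∞ S] [CompactSpace S] [T2Space S]

variable (k S) in
/-- A smooth partition of unity subordinate to the charts of `S`. -/
def chartPartition : SmoothPartitionOfUnity (univ : Set S) (𝓡 k) S univ :=
  (SmoothPartitionOfUnity.exists_isSubordinate_chartAt_source_of_isClosed
    (𝓡 k) (isClosed_univ : IsClosed (univ : Set S))).choose

/-- The integral over the compact `k`-manifold `S` of a density, given as a function of
`v₁ ∧ ⋯ ∧ vₖ`. -/
def integralDensity (δ : ∀ q : S, (Fin k → TangentSpace (𝓡 k) q) → ℝ) : ℝ :=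
  ∑ᶠ c : (univ : Set S),
    ∫ y in (chartAt (EuclideanSpace ℝ (Fin k)) (c : S)).target,
      chartPartition k S c ((chartAt (EuclideanSpace ℝ (Fin k)) (c : S)).symm y) *
        δ ((chartAt (EuclideanSpace ℝ (Fin k)) (c : S)).symm y)
          (coordVector (chartAt (EuclideanSpace ℝ (Fin k)) (c : S)) y)

end Integral

/-! ### Cooriented immersed submanifolds -/

section Immersion

variable {E H : Type*} [NormedAddCommGroup E] [NormedSpace ℝ E] [TopologicalSpace H]
  (I : ModelWithCorners ℝ E H) {S : Type*} [TopologicalSpace S] [ChartedSpace H S]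
  {n : ℕ} {M : Type*} [TopologicalSpace M] [ChartedSpace (EuclideanSpace ℝ (Fin n)) M]
  [IsManifold (𝓡 n) ∞ M]

/-- The image `TS` of the tangent space of `S` at `q` under the differential of `f : S → M`. -/
def tangentImage (f : S → M) (q : S) : Submodule ℝ (TangentSpace (𝓡 n) (f q)) :=
  LinearMap.range (mfderiv I (𝓡 n) f q).toLinearMap

/-- The normal space `TM / TS` at `q` of `f : S → M`. -/
abbrev NormalSpace (f : S → M) (q : S) : Type :=
  TangentSpace (𝓡 n) (f q) ⧸ tangentImage I f q

variable (S n M) in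
/-- A smooth immersion of `S` into the `n`-manifold `M`, of codimension `m`, with a coorientation:
an orientation of the normal bundle. Orientations of the normal spaces are continuous if, compared
with those of continuous local frames of the normal bundle, they agree everywhere locally or
disagree everywhere locally. -/
structure CoorientedImmersion (m : ℕ) where
  /-- the immersion -/
  toFun : S → M
  smooth : ContMDiff I (𝓡 n) ∞ toFun
  immersive : ∀ q, Function.Injective (mfderiv I (𝓡 n) toFun q)
  /-- the orientations of the normal spaces -/
  coor : ∀ q, Orientation ℝ (NormalSpace (n := n) I toFun q) (Fin m)
  continuous_coor : ∀ q₀, ∃ U ∈ 𝓝 q₀, ∃ ν : Fin m → ∀ q, TangentSpace (𝓡 n) (toFun q),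
    ∃ b : ∀ q, q ∈ U → Module.Basis (Fin m) ℝ (NormalSpace (n := n) I toFun q),
      (∀ i, ContinuousOn (fun q => (⟨toFun q, ν i q⟩ : TangentBundle (𝓡 n) M)) U) ∧
      (∀ q hq i, b q hq i = (tangentImage (n := n) I toFun q).mkQ (ν i q)) ∧
      ((∀ q hq, (b q hq).orientation = coor q) ∨ (∀ q hq, (b q hq).orientation = -coor q))

variable {I}

/-- The same immersion with the opposite coorientation. -/
def CoorientedImmersion.neg {m : ℕ} (X : CoorientedImmersion I S n M m) :
    CoorientedImmersion I S n M m where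
  toFun := X.toFun
  smooth := X.smooth
  immersive := X.immersive
  coor q := -X.coor q
  continuous_coor q₀ := by
    obtain ⟨U, hU, ν, b, h1, h2, h3⟩ := X.continuous_coor q₀
    refine ⟨U, hU, ν, b, h1, h2, ?_⟩
    exact h3.symm.imp_right fun h q hq => by
      rw [h q hq]; exact (neg_neg (G := Module.Ray ℝ _) (X.coor q)).symm

end Immersion

/-! ### The integral of a multivector density over a cooriented submanifold -/

section Charge

variable {k n m : ℕ} {S : Type*} [TopologicalSpace S] [ChartedSpace (EuclideanSpace ℝ (Fin k)) S]
  {M : Type*} [TopologicalSpace M] [ChartedSpace (EuclideanSpace ℝ (Fin n)) M]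
  [IsManifold (𝓡 n) ∞ M]

open Classical in
/-- The density `⟨H, o⟩` on the cooriented `k`-manifold `S`, as a function of
`v = v₁ ∧ ⋯ ∧ vₖ`: it is the pairing of `H (ν₁ ∧ ⋯ ∧ νₘ ∧ v)` with `θ₁ ∧ ⋯ ∧ θₘ`, where
`ν₁, …, νₘ` represent any positive basis of the normal space and `θ₁, …, θₘ` is the dual basis; for
a negative basis, the sign is reversed. A basis exists at each point as `n = m + k`, and the value
does not depend on its choice. -/
def pairing (hn : n = m + k) (H : MultivectorDensityField n m M)
    (X : CoorientedImmersion (𝓡 k) S n M m) (q : S) (v : Fin k → TangentSpace (𝓡 k) q) : ℝ :=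
  if h : Nonempty (Module.Basis (Fin m) ℝ (NormalSpace (𝓡 k) X.toFun q)) then
    let b := h.some
    let ν : Fin m → TangentSpace (𝓡 n) (X.toFun q) := fun i =>
      Function.surjInv (tangentImage (𝓡 k) X.toFun q).mkQ_surjective (b i)
    let dv : Fin k → TangentSpace (𝓡 n) (X.toFun q) := fun i =>
      mfderiv (𝓡 k) (𝓡 n) X.toFun q (v i)
    (if b.orientation = X.coor q then 1 else -1) *
      (H.toFun (X.toFun q)).toFun (fun i => Fin.append ν dv (Fin.cast hn i))
        (fun i => b.coord i ∘ₗ (tangentImage (𝓡 k) X.toFun q).mkQ)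
  else 0

/-- The standard sphere `Sᵏ`. -/
abbrev StdSphere (k : ℕ) : Type := Metric.sphere (0 : EuclideanSpace ℝ (Fin (k + 1))) 1

/-- The electric charge `∫ ⟨H, o⟩` over an immersed cooriented `k`-sphere. -/
def charge (hn : n = m + k) (H : MultivectorDensityField n m M)
    (X : CoorientedImmersion (𝓡 k) (StdSphere k) n M m) : ℝ :=
  integralDensity (pairing hn H X)

end Charge

/-! ### Boundaries of cooriented immersed manifolds with boundary -/

section Boundary

variable {k n p : ℕ} {S : Type*} [TopologicalSpace S] [ChartedSpace (EuclideanSpace ℝ (Fin k)) S]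
  {W : Type*} [TopologicalSpace W] [ChartedSpace (EuclideanHalfSpace (k + 1)) W]
  {M : Type*} [TopologicalSpace M] [ChartedSpace (EuclideanSpace ℝ (Fin n)) M]
  [IsManifold (𝓡 n) ∞ M]

/-- A tangent vector at a boundary point `x` of `W` points outward: in a chart into the half-space
`{y | 0 ≤ y 0}`, its component number `0` is negative. -/
def IsOutward (x : W) (w : TangentSpace (𝓡∂ (k + 1)) x) : Prop :=
  (EuclideanSpace.proj 0 : EuclideanSpace ℝ (Fin (k + 1)) →L[ℝ] ℝ)
    (mfderiv (𝓡∂ (k + 1)) 𝓘(ℝ, EuclideanSpace ℝ (Fin (k + 1))) (extChartAt (𝓡∂ (k + 1)) x) x w) < 0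

/-- The cooriented immersed manifold `X` is, via the smooth embedding `j : S → W` into the boundary,
a part of the boundary of the cooriented immersed manifold `Y` and has the coorientation induced
by that of `Y` (outward vector first). -/
structure IsBoundaryPart (Y : CoorientedImmersion (𝓡∂ (k + 1)) W n M p)
    (X : CoorientedImmersion (𝓡 k) S n M (p + 1)) (j : S → W) : Prop where
  smooth : ContMDiff (𝓡 k) (𝓡∂ (k + 1)) ∞ j
  immersive : ∀ q, Function.Injective (mfderiv (𝓡 k) (𝓡∂ (k + 1)) j q)
  injective : Function.Injective j
  mem_boundary : ∀ q, j q ∈ (𝓡∂ (k + 1)).boundary W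
  induced : ∃ h : X.toFun = Y.toFun ∘ j, ∀ q (w : TangentSpace (𝓡∂ (k + 1)) (j q)),
    IsOutward (j q) w →
      InducedOrientation (tangentImage (𝓡 k) (Y.toFun ∘ j) q)
        (tangentImage (𝓡∂ (k + 1)) Y.toFun (j q))
        (mfderiv (𝓡∂ (k + 1)) (𝓡 n) Y.toFun (j q) w)
        ((h ▸ X.coor : ∀ q, Orientation ℝ (NormalSpace (𝓡 k) (Y.toFun ∘ j) q) (Fin (p + 1))) q)
        (Y.coor (j q))

/-- The boundary of `Y` is `X`, with coorientations. -/
def IsBoundary (Y : CoorientedImmersion (𝓡∂ (k + 1)) W n M p)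
    (X : CoorientedImmersion (𝓡 k) S n M (p + 1)) : Prop :=
  ∃ j : S → W, IsBoundaryPart Y X j ∧ range j = (𝓡∂ (k + 1)).boundary W

/-- The boundary of `Y` is the disjoint union of `X₁` and `X₂`, with coorientations. -/
def IsBoundaryPair (Y : CoorientedImmersion (𝓡∂ (k + 1)) W n M p)
    (X₁ X₂ : CoorientedImmersion (𝓡 k) S n M (p + 1)) : Prop :=
  ∃ j₁ j₂ : S → W, IsBoundaryPart Y X₁ j₁ ∧ IsBoundaryPart Y X₂ j₂ ∧
    Disjoint (range j₁) (range j₂) ∧ range j₁ ∪ range j₂ = (𝓡∂ (k + 1)).boundary W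

end Boundary

end ElectricCharge

end

noncomputable section

namespace ElectricCharge

/-! ### Linear algebra: values of multivector densities and choice of normal basis. -/

section LinearAlgebra

variable {n m r : ℕ} {V : Type*} [AddCommGroup V] [Module ℝ V]

/-! The charge is the outward flux of a divergence-free vector density on Σ, so the divergence
theorem on Σ makes it vanish.

Let Σ have codimension p. Contracting the (p+1)-multivector density H with a covector leaves a
p-multivector density, which the coorientation of Σ turns into a density on Σ. A covector
annihilating TΣ contributes nothing: it is a combination of the conormal covectors that already
occupy the other p slots of the alternating form. Hence the contraction depends only on the
restriction of the covector to TΣ (`fluxForm_congr`), and H induces a vector density G on Σ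
(`flux`).

G is divergence-free because H is (`sum_fderiv_frameComponent_eq_zero`). Complete the coordinate
vectors of the immersion by normal vectors that are constant in a chart of M. The components of G
are, up to a locally constant sign, components of H in this moving frame. In their divergence the
derivatives of the frame cancel, by the symmetry of second derivatives and the antisymmetry of H.
The derivatives of H add up to div H: the normal directions missing from the sum would only
contribute components with a repeated index.

On ∂Σ take w outward and a covector α with α(w) = 1 that vanishes on T∂Σ. For the induced
coorientation, the pairing of H with u is then G(α) on (w, u) (`orientedPairing_eq_fluxForm`). So
the integral of H over ∂Σ is the flux of G out of Σ. For a partition of unity ψ on Σ, the divergence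
theorem in a half-space chart equates the integral of G(dψ_a) with the outward flux of ψ_a G through
the face of the chart (`integral_flux_eq_neg_integral_faceDensity`). The sum over a vanishes since ∑
dψ_a = 0 (`exists_partition_sum_integral_faceDensity_eq_zero`). The charge is defined with charts of
the sphere, and `integral_faceTransition` carries it to the faces of the charts of Σ. With two
boundary spheres the two charges add up to zero, and reversing a coorientation changes the sign. -/

/-- The endomorphism carrying `ε` to `v` has determinant `ε.det v`. It may be singular, so `v` need
not be independent. -/
theorem MultivectorDensity.toFun_eq_abs_det (h : MultivectorDensity n m V)
    (ε : Module.Basis (Fin n) ℝ V) (v : Fin n → V) :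
    h.toFun v = |ε.det v| • h.toFun ε := by
  have h1 := h.map_linear (ε.constr ℝ v) ε
  have h2 : (fun i => (ε.constr ℝ v) (ε i)) = v := by
    ext i; simp
  have h3 := ε.det_comp (ε.constr ℝ v) ε
  rw [h2] at h1
  have h4 : (⇑(ε.constr ℝ v) ∘ ⇑ε) = v := h2
  rw [h4, ε.det_self, mul_one] at h3
  rw [h1, h3]

/-- The absolute value of the determinant forgets the sign of a permutation. This lets the outward
vector move from the normal to the tangential block of a frame at no cost. -/
theorem MultivectorDensity.toFun_perm (h : MultivectorDensity n m V)
    (ε : Module.Basis (Fin n) ℝ V) (v : Fin n → V) (σ : Equiv.Perm (Fin n)) :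
    h.toFun (v ∘ σ) = h.toFun v := by
  rw [h.toFun_eq_abs_det ε, h.toFun_eq_abs_det ε v, AlternatingMap.map_perm]
  rcases Int.units_eq_one_or (Equiv.Perm.sign σ) with h | h <;> simp [h]

/-- A multivector density evaluated through its components in a basis. -/
theorem MultivectorDensity.toFun_eq_sum (h : MultivectorDensity n m V)
    (ε : Module.Basis (Fin n) ℝ V) (v : Fin n → V) (φ : Fin m → Module.Dual ℝ V) :
    h.toFun v φ = |ε.det v| *
      ∑ I : Fin m → Fin n, (∏ s, φ s (ε (I s))) * h.toFun ε (fun s => ε.coord (I s)) := by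
  rw [h.toFun_eq_abs_det ε, AlternatingMap.smul_apply, smul_eq_mul]
  congr 1
  have h1 : φ = fun s => ∑ j, φ s (ε j) • ε.coord j := by
    ext s : 1
    refine ε.ext fun l => ?_
    simp
  conv_lhs => rw [h1]
  have h2 := (h.toFun ε).toMultilinearMap.map_sum (fun s j => φ s (ε j) • ε.coord j)
  refine h2.trans (Finset.sum_congr rfl fun I _ => ?_)
  have h3 := (h.toFun ε).toMultilinearMap.map_smul_univ (fun s => φ s (ε (I s)))
    (fun s => ε.coord (I s))
  exact h3

/-- The contraction of a multivector density with a covector. -/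
def MultivectorDensity.contract (h : MultivectorDensity n (m + 1) V) (α : Module.Dual ℝ V) :
    MultivectorDensity n m V where
  toFun v := (h.toFun v).curryLeft α
  map_linear A v := by
    ext φ
    simp [h.map_linear A v]

theorem MultivectorDensity.contract_apply (h : MultivectorDensity n (m + 1) V)
    (α : Module.Dual ℝ V) (v : Fin n → V) (φ : Fin m → Module.Dual ℝ V) :
    (h.contract α).toFun v φ = h.toFun v (Fin.cons α φ) := rfl

open Classical in
/-- The pairing of a multivector density with a coorientation, computed with a basis of the normal
space `V ⧸ B` and lifts of its elements. -/
def basisPairing (hn : n = m + r) (h : MultivectorDensity n m V) (B : Submodule ℝ V)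
    (o : Orientation ℝ (V ⧸ B) (Fin m)) (b : Module.Basis (Fin m) ℝ (V ⧸ B)) (ν : Fin m → V)
    (u : Fin r → V) : ℝ :=
  (if b.orientation = o then 1 else -1) *
    h.toFun (fun i => Fin.append ν u (Fin.cast hn i)) (fun i => b.coord i ∘ₗ B.mkQ)

/-- The change of dual bases is the transpose of the change of bases in the opposite direction;
hence the two bases trade places. -/
theorem basis_det_dualBasis {ι Q : Type*} [Fintype ι] [DecidableEq ι] [AddCommGroup Q] [Module ℝ Q]
    (b b' : Module.Basis ι ℝ Q) : b.dualBasis.det b'.dualBasis = b'.det b := by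
  rw [Module.Basis.det_apply, Module.Basis.det_apply, ← Matrix.det_transpose]
  congr 1
  ext i j
  simp [Module.Basis.toMatrix_apply, Matrix.transpose_apply]

/-- Changing the lifts of a basis of `V ⧸ B` by a linear map which is the identity on `B`. -/
theorem exists_linearMap_lift [FiniteDimensional ℝ V] (B : Submodule ℝ V)
    (b : Module.Basis (Fin m) ℝ (V ⧸ B)) (ν ν' : Fin m → V) (hν : ∀ i, b i = B.mkQ (ν i)) :
    ∃ A : V →ₗ[ℝ] V, LinearMap.det A = b.det (fun i => B.mkQ (ν' i)) ∧ (∀ x ∈ B, A x = x) ∧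
      ∀ j, A (ν j) = ν' j := by
  -- The correction `ν' i - ν i` is weighted by the `i`-th normal coordinate, which vanishes on `B`
  -- and is dual to `ν`.
  set A : V →ₗ[ℝ] V := LinearMap.id + ∑ i, (b.coord i ∘ₗ B.mkQ).smulRight (ν' i - ν i) with hA
  have hAB : ∀ x ∈ B, A x = x := by
    intro x hx
    have : B.mkQ x = 0 := by simpa using hx
    simp [hA, this, LinearMap.sum_apply, -Submodule.mkQ_apply]
  have hAν : ∀ j, A (ν j) = ν' j := by
    intro j
    have : ∀ i, (b.coord i ∘ₗ B.mkQ) (ν j) = if j = i then 1 else 0 := by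
      intro i
      simp only [LinearMap.comp_apply, ← hν j]
      simp [Finsupp.single_apply]
    simp only [hA, LinearMap.add_apply, LinearMap.id_apply, LinearMap.sum_apply,
      LinearMap.smulRight_apply, this]
    simp
  refine ⟨A, ?_, hAB, hAν⟩
  have hle : B ≤ B.comap A := fun x hx => by simpa [hAB x hx] using hx
  -- `A` is block triangular with respect to `B`: the block on `B` is the identity, and only the
  -- determinant on the quotient remains.
  rw [LinearMap.det_eq_det_mul_det B A hle]
  have h1 : A.restrict hle = LinearMap.id := by
    ext x; simp [LinearMap.restrict_apply, hAB x x.2]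
  have h2 := b.det_comp (B.mapQ B A hle) b
  have h3 : (⇑(B.mapQ B A hle) ∘ ⇑b) = fun i => B.mkQ (ν' i) := by
    funext j
    simp only [Function.comp_apply, hν, Submodule.mkQ_apply, Submodule.mapQ_apply, hAν]
  rw [h3, b.det_self, mul_one] at h2
  rw [h1, LinearMap.det_id, one_mul, h2]

theorem append_lift (hn : n = m + r) (B : Submodule ℝ V) (ν ν' : Fin m → V)
    (u : Fin r → V) (hu : ∀ i, u i ∈ B) (A : V →ₗ[ℝ] V) (hAB : ∀ x ∈ B, A x = x)
    (hAν : ∀ j, A (ν j) = ν' j) : (fun i => Fin.append ν' u (Fin.cast hn i)) =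
      fun i => A (Fin.append ν u (Fin.cast hn i)) := by
  funext i
  generalize Fin.cast hn i = j
  refine Fin.addCases (fun j => ?_) (fun j => ?_) j
  · simp [hAν]
  · simp [hAB _ (hu j)]

/-- Let d be the determinant of the change of normal basis. The frame contributes |d|, the dual
covectors contribute 1/d, and the orientation sign contributes the sign of d. The product is 1. -/
theorem basisPairing_eq [FiniteDimensional ℝ V] (hn : n = m + r) (h : MultivectorDensity n m V)
    (B : Submodule ℝ V) (o : Orientation ℝ (V ⧸ B) (Fin m)) (b b' : Module.Basis (Fin m) ℝ (V ⧸ B))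
    (ν ν' : Fin m → V) (hν : ∀ i, b i = B.mkQ (ν i)) (hν' : ∀ i, b' i = B.mkQ (ν' i))
    (u : Fin r → V) (hu : ∀ i, u i ∈ B) :
    basisPairing hn h B o b ν u = basisPairing hn h B o b' ν' u := by
  obtain ⟨A, hdet', hAB, hAν⟩ := exists_linearMap_lift B b ν ν' hν
  have hdet : LinearMap.det A = b.det b' := by
    rw [hdet', ← funext hν']
  have hframe := append_lift hn B ν ν' u hu A hAB hAν
  set ψ := (h.toFun (fun i => Fin.append ν u (Fin.cast hn i))).compLinearMap B.mkQ.dualMap with hψ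
  have hcov : ∀ c : Module.Basis (Fin m) ℝ (V ⧸ B), h.toFun (fun i =>
      Fin.append ν u (Fin.cast hn i)) (fun i => c.coord i ∘ₗ B.mkQ) = ψ c.dualBasis := by
    intro c
    rw [hψ, AlternatingMap.compLinearMap_apply]
    congr 1
    funext i
    ext x
    simp
  have hψb : ψ b'.dualBasis = ψ b.dualBasis * b'.det b := by
    conv_lhs => rw [ψ.eq_smul_basis_det b.dualBasis]
    rw [AlternatingMap.smul_apply, smul_eq_mul, basis_det_dualBasis]
  have hinv : b.det b' * b'.det b = 1 := by
    have := Module.Basis.det_mul_det b b' b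
    rwa [b.det_self] at this
  unfold basisPairing
  rw [hframe, h.map_linear, AlternatingMap.smul_apply, hcov, hcov, hψb, hdet, smul_eq_mul]
  have hne : b.det b' ≠ 0 := left_ne_zero_of_mul_eq_one hinv
  have key := Module.Basis.orientation_eq_iff_det_pos b b'
  rcases lt_or_gt_of_ne hne with hneg | hpos
  · have h1 : b.orientation ≠ b'.orientation := fun h => by linarith [key.1 h]
    have h2 : b'.orientation = -b.orientation := by
      rcases b.orientation_eq_or_eq_neg b'.orientation with h | h
      · exact absurd h.symm h1
      · exact h
    rw [abs_of_neg hneg]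
    rcases b.orientation_eq_or_eq_neg o with h | h
    · rw [if_pos h.symm, if_neg (by rw [h]; exact h1.symm)]
      linear_combination (ψ b.dualBasis) * (-hinv)
    · rw [if_neg (by rw [h]; exact fun h' => h1 (by rw [h2, ← h'])), if_pos (by rw [h, h2])]
      linear_combination (ψ b.dualBasis) * (hinv)
  · have h1 := key.2 hpos
    rw [abs_of_pos hpos, h1]
    split_ifs
    · linear_combination (ψ b.dualBasis) * (-hinv)
    · linear_combination (ψ b.dualBasis) * hinv

end LinearAlgebra

/-! ### Linear algebra: flux through a submanifold and induced coorientation. -/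

section LinearAlgebra

variable {n m r : ℕ} {V : Type*} [AddCommGroup V] [Module ℝ V]

/-- The splitting of the indices of an adapted frame into normal and tangential ones. -/
def frameEquiv (hn : n = m + r) : Fin m ⊕ Fin r ≃ Fin n :=
  finSumFinEquiv.trans (finCongr hn.symm)

theorem append_frameEquiv_inl {X : Type*} (hn : n = m + r) (ν : Fin m → X) (u : Fin r → X)
    (a : Fin m) : Fin.append ν u (Fin.cast hn (frameEquiv hn (Sum.inl a))) = ν a := by
  simp [frameEquiv]

theorem append_frameEquiv_inr {X : Type*} (hn : n = m + r) (ν : Fin m → X) (u : Fin r → X)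
    (a : Fin r) : Fin.append ν u (Fin.cast hn (frameEquiv hn (Sum.inr a))) = u a := by
  simp [frameEquiv]

theorem det_append_mul (hn : n = m + r) (ε : Module.Basis (Fin n) ℝ V) (ν : Fin m → V)
    (u : Fin r → V) (C : Matrix (Fin r) (Fin r) ℝ) :
    ε.det (fun i => Fin.append ν (fun j => ∑ l, C l j • u l) (Fin.cast hn i)) =
      C.det * ε.det (fun i => Fin.append ν u (Fin.cast hn i)) := by
  have h1 : ε.toMatrix (fun i => Fin.append ν (fun j => ∑ l, C l j • u l) (Fin.cast hn i)) =
      ε.toMatrix (fun i => Fin.append ν u (Fin.cast hn i)) *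
        (Matrix.fromBlocks 1 0 0 C).submatrix (frameEquiv hn).symm (frameEquiv hn).symm := by
    ext i j
    obtain ⟨j, rfl⟩ := (frameEquiv hn).surjective j
    rw [Matrix.mul_apply, ← (frameEquiv hn).sum_comp, Fintype.sum_sum_type]
    rcases j with a | a
    · simp [Module.Basis.toMatrix_apply, append_frameEquiv_inl, append_frameEquiv_inr,
        Matrix.one_apply]
    · simp [Module.Basis.toMatrix_apply, append_frameEquiv_inl, append_frameEquiv_inr, mul_comm]
  rw [Module.Basis.det_apply, h1, Matrix.det_mul, Matrix.det_submatrix_equiv_self,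
    Matrix.det_fromBlocks_zero₂₁, Matrix.det_one, one_mul, mul_comm, ← Module.Basis.det_apply]

open Classical in
/-- The pairing of a multivector density with a coorientation. -/
def orientedPairing (hn : n = m + r) (h : MultivectorDensity n m V) (B : Submodule ℝ V)
    (o : Orientation ℝ (V ⧸ B) (Fin m)) (u : Fin r → V) : ℝ :=
  if hb : Nonempty (Module.Basis (Fin m) ℝ (V ⧸ B)) then
    basisPairing hn h B o hb.some (fun i => Function.surjInv B.mkQ_surjective (hb.some i)) u
  else 0

theorem orientedPairing_eq [FiniteDimensional ℝ V] (hn : n = m + r) (h : MultivectorDensity n m V)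
    (B : Submodule ℝ V) (o : Orientation ℝ (V ⧸ B) (Fin m)) (b : Module.Basis (Fin m) ℝ (V ⧸ B))
    (ν : Fin m → V) (hν : ∀ i, b i = B.mkQ (ν i)) (u : Fin r → V) (hu : ∀ i, u i ∈ B) :
    orientedPairing hn h B o u = basisPairing hn h B o b ν u := by
  have hb : Nonempty (Module.Basis (Fin m) ℝ (V ⧸ B)) := ⟨b⟩
  rw [orientedPairing, dif_pos hb]
  exact basisPairing_eq hn h B o _ b _ ν
    (fun i => (Function.surjInv_eq B.mkQ_surjective _).symm) hν u hu

/-- The tangential vectors enter only through the frame, whose determinant is multiplied by `C.det`;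
the normal covectors are unaffected. Hence the pairing is a density in `u`, and its integral does
not depend on charts. -/
theorem orientedPairing_mul (hn : n = m + r) (h : MultivectorDensity n m V)
    (ε : Module.Basis (Fin n) ℝ V) (B : Submodule ℝ V) (o : Orientation ℝ (V ⧸ B) (Fin m))
    (u : Fin r → V) (C : Matrix (Fin r) (Fin r) ℝ) :
    orientedPairing hn h B o (fun j => ∑ l, C l j • u l) = |C.det| * orientedPairing hn h B o u := by
  unfold orientedPairing basisPairing
  split_ifs with hb
  · rw [h.toFun_eq_abs_det ε, det_append_mul, h.toFun_eq_abs_det ε (fun i => Fin.append _ u _),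
      abs_mul]
    simp only [AlternatingMap.smul_apply, smul_eq_mul]
    ring
  · rw [h.toFun_eq_abs_det ε, det_append_mul, h.toFun_eq_abs_det ε (fun i => Fin.append _ u _),
      abs_mul]
    simp only [AlternatingMap.smul_apply, smul_eq_mul]
    ring
  · simp

/-- The pairing with a coorientation of the contraction of a multivector density with a covector,
as a linear form in the covector. -/
def fluxForm (hn : n = m + r) (h : MultivectorDensity n (m + 1) V) (B : Submodule ℝ V)
    (o : Orientation ℝ (V ⧸ B) (Fin m)) (u : Fin r → V) : Module.Dual ℝ V →ₗ[ℝ] ℝ where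
  toFun α := orientedPairing hn (h.contract α) B o u
  map_add' α β := by
    unfold orientedPairing basisPairing
    split_ifs <;> simp [MultivectorDensity.contract, mul_add]
  map_smul' c α := by
    unfold orientedPairing basisPairing
    split_ifs <;> simp [MultivectorDensity.contract]

theorem fluxForm_apply (hn : n = m + r) (h : MultivectorDensity n (m + 1) V) (B : Submodule ℝ V)
    (o : Orientation ℝ (V ⧸ B) (Fin m)) (u : Fin r → V) (α : Module.Dual ℝ V) :
    fluxForm hn h B o u α = orientedPairing hn (h.contract α) B o u := rfl

theorem mkQ_apply_eq_zero (B : Submodule ℝ V) {x : V} : B.mkQ x = 0 ↔ x ∈ B := by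
  simp

theorem dual_eq_sum_coord (B : Submodule ℝ V) (b : Module.Basis (Fin m) ℝ (V ⧸ B))
    (ν : Fin m → V) (hν : ∀ i, b i = B.mkQ (ν i)) (α : Module.Dual ℝ V) (hα : ∀ x ∈ B, α x = 0) :
    α = ∑ i, α (ν i) • (b.coord i ∘ₗ B.mkQ) := by
  have hle : B ≤ LinearMap.ker α := hα
  have h1 : B.liftQ α hle = ∑ i, α (ν i) • b.coord i := by
    refine b.ext fun j => ?_
    conv_lhs => rw [hν, Submodule.mkQ_apply, Submodule.liftQ_apply]
    simp [Finsupp.single_apply]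
  ext x
  have h2 := congrArg (fun f => f (B.mkQ x)) h1
  simpa using h2

/-- A covector killing `B` is a combination of the covectors `b.coord i ∘ₗ B.mkQ`. These already
fill the remaining slots, so an alternating form vanishes on each term. This is what makes the flux
a form on covectors of the submanifold. -/
theorem fluxForm_eq_zero [FiniteDimensional ℝ V] (hn : n = m + r)
    (h : MultivectorDensity n (m + 1) V) (B : Submodule ℝ V) (o : Orientation ℝ (V ⧸ B) (Fin m))
    (u : Fin r → V) (α : Module.Dual ℝ V) (hα : ∀ x ∈ B, α x = 0) :
    fluxForm hn h B o u α = 0 := by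
  rw [fluxForm_apply]
  unfold orientedPairing
  split_ifs with hb
  · unfold basisPairing
    rw [MultivectorDensity.contract]
    simp only
    rw [dual_eq_sum_coord B hb.some _ (fun i => (Function.surjInv_eq B.mkQ_surjective _).symm) α hα,
      map_sum]
    have : ∀ i, ((h.toFun fun i => Fin.append (fun i => Function.surjInv B.mkQ_surjective
        (hb.some i)) u (Fin.cast hn i)).curryLeft (α (Function.surjInv B.mkQ_surjective
        (hb.some i)) • hb.some.coord i ∘ₗ B.mkQ)) (fun i => hb.some.coord i ∘ₗ B.mkQ) = 0 := by
      intro i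
      rw [map_smul, AlternatingMap.smul_apply, AlternatingMap.curryLeft_apply_apply,
        AlternatingMap.map_eq_zero_of_eq _ _ (i := 0) (j := i.succ) (by simp) (Fin.succ_ne_zero i).symm, smul_zero]
    have hsum : ∀ f : Fin m → (Module.Dual ℝ V [⋀^Fin m]→ₗ[ℝ] ℝ), (∀ i,
        f i (fun i => hb.some.coord i ∘ₗ B.mkQ) = 0) →
        (∑ i, f i) (fun i => hb.some.coord i ∘ₗ B.mkQ) = 0 := fun f hf =>
      Finset.sum_induction f (fun g => g (fun i => hb.some.coord i ∘ₗ B.mkQ) = 0)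
        (fun a b ha hb => by rw [AlternatingMap.add_apply, ha, hb, add_zero])
        (AlternatingMap.zero_apply _) (fun i _ => hf i)
    rw [hsum _ this, mul_zero]
  · rfl

theorem fluxForm_congr [FiniteDimensional ℝ V] (hn : n = m + r)
    (h : MultivectorDensity n (m + 1) V) (B : Submodule ℝ V) (o : Orientation ℝ (V ⧸ B) (Fin m))
    (u : Fin r → V) (α β : Module.Dual ℝ V) (hα : ∀ x ∈ B, α x = β x) :
    fluxForm hn h B o u α = fluxForm hn h B o u β := by
  rw [← sub_eq_zero, ← map_sub]
  exact fluxForm_eq_zero hn h B o u _ fun x hx => by simp [hα x hx]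

/-- At a boundary point, the pairing with the induced coorientation is a flux. -/
theorem orientedPairing_eq_fluxForm [FiniteDimensional ℝ V] {p k : ℕ} (hA : n = (p + 1) + k)
    (hB : n = p + (k + 1)) (h : MultivectorDensity n (p + 1) V) (ε : Module.Basis (Fin n) ℝ V)
    (A B : Submodule ℝ V) (hAB : A ≤ B) (w : V) (hw : w ∈ B)
    (oA : Orientation ℝ (V ⧸ A) (Fin (p + 1))) (oB : Orientation ℝ (V ⧸ B) (Fin p))
    (hind : InducedOrientation A B w oA oB) (bB : Module.Basis (Fin p) ℝ (V ⧸ B))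
    (α : Module.Dual ℝ V) (hαw : α w = 1) (hαA : ∀ x ∈ A, α x = 0)
    (hspan : ∀ x ∈ B, ∃ t : ℝ, x - t • w ∈ A) (u : Fin k → V) (hu : ∀ i, u i ∈ A) :
    orientedPairing hA h A oA u = fluxForm hB h B oB (Fin.cons w u) α := by
  set ν : Fin p → V := fun i => Function.surjInv B.mkQ_surjective (bB i) with hν
  have hbν : ∀ i, bB i = B.mkQ (ν i) := fun i => (Function.surjInv_eq B.mkQ_surjective _).symm
  have hBq : ∀ x ∈ B, B.mkQ x = 0 := fun x hx => by simpa using hx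
  -- `(w, ν)` projects to a basis of `V ⧸ A`: passing to `V ⧸ B` isolates the coefficients of `ν`,
  -- and `α` isolates that of `w`.
  have hli : LinearIndependent ℝ
      (Fin.cons (A.mkQ w) (fun i => A.mkQ (ν i)) : Fin (p + 1) → V ⧸ A) := by
    rw [Fintype.linearIndependent_iff]
    intro g hg
    rw [Fin.sum_univ_succ] at hg
    simp only [Fin.cons_zero, Fin.cons_succ, ← map_smul, ← map_sum, ← map_add] at hg
    have hmem : g 0 • w + ∑ i, g (Fin.succ i) • ν i ∈ A := (mkQ_apply_eq_zero A).1 hg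
    have h2 := hBq _ (hAB hmem)
    rw [map_add, map_smul, hBq w hw, smul_zero, zero_add, map_sum] at h2
    simp only [map_smul, ← hbν] at h2
    have h3 := Fintype.linearIndependent_iff.1 bB.linearIndependent (fun i => g i.succ) h2
    have h4 : g 0 = 0 := by
      have h5 := hαA _ hmem
      simpa [h3, hαw] using h5
    intro i
    refine Fin.cases h4 h3 i
  have hsp : ⊤ ≤ Submodule.span ℝ
      (Set.range (Fin.cons (A.mkQ w) (fun i => A.mkQ (ν i)) : Fin (p + 1) → V ⧸ A)) := by
    intro y _
    obtain ⟨x, rfl⟩ := A.mkQ_surjective y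
    have h1 : x - ∑ i, bB.repr (B.mkQ x) i • ν i ∈ B := by
      rw [← Submodule.Quotient.mk_eq_zero, ← Submodule.mkQ_apply, map_sub, map_sum]
      simp only [map_smul, ← hbν]
      rw [bB.sum_repr, sub_self]
    obtain ⟨t, ht⟩ := hspan _ h1
    have h2 : A.mkQ x = t • A.mkQ w + ∑ i, bB.repr (B.mkQ x) i • A.mkQ (ν i) := by
      have h3 : A.mkQ (x - ∑ i, bB.repr (B.mkQ x) i • ν i - t • w) = 0 := (mkQ_apply_eq_zero A).2 ht
      simp only [map_sub, map_sum, map_smul] at h3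
      rw [sub_sub, sub_eq_zero] at h3
      rw [h3, add_comm]
    rw [h2]
    refine Submodule.add_mem _ (Submodule.smul_mem _ _ (Submodule.subset_span ⟨0, by simp⟩))
      (Submodule.sum_mem _ fun i _ =>
        Submodule.smul_mem _ _ (Submodule.subset_span ⟨i.succ, by simp⟩))
  set bA : Module.Basis (Fin (p + 1)) ℝ (V ⧸ A) := Module.Basis.mk hli hsp with hbA
  have hbA0 : bA 0 = A.mkQ w := by simp [hbA]
  have hbAs : ∀ i : Fin p, bA i.succ = A.mkQ (ν i) := fun i => by simp [hbA]
  -- On `B` the covector `α` agrees with the coordinate along `w` in the basis `bA`, and the flux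
  -- sees nothing else.
  have hcongr : fluxForm hB h B oB (Fin.cons w u) α =
      fluxForm hB h B oB (Fin.cons w u) (bA.coord 0 ∘ₗ A.mkQ) := by
    refine fluxForm_congr _ _ _ _ _ _ _ fun x hx => ?_
    obtain ⟨t, ht⟩ := hspan x hx
    have h1 : α x = t := by
      have := hαA _ ht
      simp only [map_sub, map_smul, hαw, smul_eq_mul, mul_one] at this
      linarith
    have h2 : A.mkQ x = t • bA 0 := by
      have h3 : A.mkQ (x - t • w) = 0 := (mkQ_apply_eq_zero A).2 ht
      rw [map_sub, map_smul, sub_eq_zero] at h3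
      rw [h3, hbA0]
    rw [h1, LinearMap.comp_apply, h2]
    simp
  have hwu : ∀ i, (Fin.cons w u : Fin (k + 1) → V) i ∈ B := fun i =>
    Fin.cases (by simpa using hw) (fun i => by simpa using hAB (hu i)) i
  have hcoord : ∀ i : Fin p, bB.coord i ∘ₗ B.mkQ = bA.coord i.succ ∘ₗ A.mkQ := by
    intro i
    have h1 := dual_eq_sum_coord A bA (Fin.cons w ν : Fin (p + 1) → V)
      (fun j => Fin.cases (by simpa using hbA0) (fun j => by simpa using hbAs j) j)
      (bB.coord i ∘ₗ B.mkQ) (fun x hx => by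
        rw [LinearMap.comp_apply, hBq x (hAB hx), map_zero])
    rw [h1, Fin.sum_univ_succ, Finset.sum_eq_single i]
    · simp only [Fin.cons_zero, Fin.cons_succ, LinearMap.comp_apply, hBq w hw, ← hbν]
      simp
    · intro j _ hj
      simp only [Fin.cons_succ, LinearMap.comp_apply, ← hbν]
      simp [hj]
    · simp
  -- The frames `(w, ν, u)` and `(ν, w, u)` differ only in the position of `w`, which a density
  -- ignores.
  have hframe : ∃ σ : Equiv.Perm (Fin n),
      (fun i => Fin.append (Fin.cons w ν : Fin (p + 1) → V) u (Fin.cast hA i)) =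
      (fun i => Fin.append ν (Fin.cons w u : Fin (k + 1) → V) (Fin.cast hB i)) ∘ σ := by
    let τ : Fin (p + 1) ⊕ Fin k ≃ Fin p ⊕ Fin (k + 1) :=
      { toFun := Sum.elim (Fin.cases (Sum.inr 0) Sum.inl) (fun i => Sum.inr i.succ)
        invFun := Sum.elim (fun i => Sum.inl i.succ) (Fin.cases (Sum.inl 0) Sum.inr)
        left_inv := by
          rintro (i | i)
          · refine Fin.cases ?_ (fun i => ?_) i <;> simp
          · simp
        right_inv := by
          rintro (i | i)
          · simp
          · refine Fin.cases ?_ (fun i => ?_) i <;> simp }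
    refine ⟨(frameEquiv hA).symm.trans (τ.trans (frameEquiv hB)), ?_⟩
    funext i
    obtain ⟨i, rfl⟩ := (frameEquiv hA).surjective i
    simp only [Function.comp_apply, Equiv.trans_apply, Equiv.symm_apply_apply]
    rcases i with i | i
    · rw [append_frameEquiv_inl]
      refine Fin.cases ?_ (fun i => ?_) i
      · simp [τ, append_frameEquiv_inr]
      · simp [τ, append_frameEquiv_inl]
    · simp [τ, append_frameEquiv_inr]
  obtain ⟨σ, hσ⟩ := hframe
  rw [hcongr, fluxForm_apply, orientedPairing_eq hB _ B oB bB ν hbν _ hwu,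
    orientedPairing_eq hA h A oA bA (Fin.cons w ν : Fin (p + 1) → V)
      (fun j => Fin.cases (by simpa using hbA0) (fun j => by simpa using hbAs j) j) u hu]
  unfold basisPairing
  have hor := hind ν bA bB hbA0 hbAs hbν
  rw [hσ, h.toFun_perm ε, MultivectorDensity.contract_apply]
  congr 1
  · by_cases h1 : bA.orientation = oA
    · rw [if_pos h1, if_pos (hor.1 h1)]
    · rw [if_neg h1, if_neg (mt hor.2 h1)]
  congr 1
  funext i
  refine Fin.cases (by simp) (fun i => ?_) i
  simp [hcoord]

end LinearAlgebra

/-! ### Derivatives of the components of a multivector in a moving frame. -/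

section Components

variable {n m : ℕ}

/-- The value on the covectors `β` of the `m`-vector with components `c`. -/
def multiSum (c : (Fin m → Fin n) → ℝ) (β : Fin m → Fin n → ℝ) : ℝ :=
  ∑ I : Fin m → Fin n, (∏ s, β s (I s)) * c I

/-- Antisymmetry of the components of an `m`-vector. -/
def IsAntisymm (c : (Fin m → Fin n) → ℝ) : Prop :=
  ∀ (I : Fin m → Fin n) (i j : Fin m), i ≠ j → c (I ∘ Equiv.swap i j) = -c I

theorem multiSum_swap {c : (Fin m → Fin n) → ℝ} (hc : IsAntisymm c) (β : Fin m → Fin n → ℝ)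
    {i j : Fin m} (hij : i ≠ j) : multiSum c (β ∘ Equiv.swap i j) = -multiSum c β := by
  unfold multiSum
  rw [← (Equiv.arrowCongr (Equiv.swap i j) (Equiv.refl (Fin n))).sum_comp, ← Finset.sum_neg_distrib]
  refine Finset.sum_congr rfl fun I _ => ?_
  have h1 : (Equiv.arrowCongr (Equiv.swap i j) (Equiv.refl (Fin n))) I = I ∘ Equiv.swap i j := by
    ext; simp [Equiv.arrowCongr]
  rw [h1, hc I i j hij, mul_neg]
  congr 2
  exact Equiv.prod_comp (Equiv.swap i j) (fun s => β s (I s))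

theorem multiSum_eq_zero {c : (Fin m → Fin n) → ℝ} (hc : IsAntisymm c) (β : Fin m → Fin n → ℝ)
    {i j : Fin m} (hij : i ≠ j) (hβ : β i = β j) : multiSum c β = 0 := by
  have h1 := multiSum_swap hc β hij
  have h2 : β ∘ Equiv.swap i j = β := by
    funext s
    simp only [Function.comp_apply, Equiv.swap_apply_def]
    split_ifs with h h' <;> simp [*]
  rw [h2] at h1
  linarith

theorem multiSum_update (c : (Fin m → Fin n) → ℝ) (β : Fin m → Fin n → ℝ) (s : Fin m)
    (v : Fin n → ℝ) : multiSum c (Function.update β s v) =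
      ∑ I, v (I s) * ((∏ s' ∈ Finset.univ.erase s, β s' (I s')) * c I) := by
  unfold multiSum
  refine Finset.sum_congr rfl fun I _ => ?_
  rw [← Finset.mul_prod_erase Finset.univ _ (Finset.mem_univ s), Function.update_self, mul_assoc]
  congr 2
  refine Finset.prod_congr rfl fun s' hs' => ?_
  rw [Function.update_of_ne (Finset.ne_of_mem_erase hs')]

theorem multiSum_update_sum {ι : Type*} [Fintype ι] (c : (Fin m → Fin n) → ℝ)
    (β : Fin m → Fin n → ℝ) (s : Fin m) (x : ι → ℝ) (γ : ι → Fin n → ℝ) :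
    multiSum c (Function.update β s (fun j => ∑ l, x l * γ l j)) =
      ∑ l, x l * multiSum c (Function.update β s (γ l)) := by
  simp only [multiSum_update, Finset.sum_mul, Finset.mul_sum]
  rw [Finset.sum_comm]
  refine Finset.sum_congr rfl fun l _ => Finset.sum_congr rfl fun I _ => by ring

theorem multiSum_update_neg (c : (Fin m → Fin n) → ℝ)
    (β : Fin m → Fin n → ℝ) (s : Fin m) (v : Fin n → ℝ) :
    multiSum c (Function.update β s (fun j => -v j)) = -multiSum c (Function.update β s v) := by
  simp [multiSum_update]

theorem hasDerivAt_multiSum {c : ℝ → (Fin m → Fin n) → ℝ} {c' : (Fin m → Fin n) → ℝ}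
    {β : ℝ → Fin m → Fin n → ℝ} {β' : Fin m → Fin n → ℝ} {t : ℝ}
    (hc : ∀ I, HasDerivAt (fun t => c t I) (c' I) t)
    (hβ : ∀ s j, HasDerivAt (fun t => β t s j) (β' s j) t) :
    HasDerivAt (fun t => multiSum (c t) (β t))
      (multiSum c' (β t) + ∑ s, multiSum (c t) (Function.update (β t) s (β' s))) t := by
  unfold multiSum
  have h1 : ∀ I : Fin m → Fin n, HasDerivAt (fun t => (∏ s, β t s (I s)) * c t I)
      ((∑ s, (∏ s' ∈ Finset.univ.erase s, β t s' (I s')) • β' s (I s)) * c t I +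
        (∏ s, β t s (I s)) * c' I) t := fun I =>
    (HasDerivAt.fun_finsetProd fun s _ => hβ s (I s)).mul (hc I)
  refine (HasDerivAt.fun_sum fun I _ => h1 I).congr_deriv ?_
  rw [Finset.sum_add_distrib, add_comm]
  congr 1
  have h2 : ∀ s, (∑ I, (∏ s', Function.update (β t) s (β' s) s' (I s')) * c t I) = _ :=
    fun s => multiSum_update (c t) (β t) s (β' s)
  simp only [h2]
  rw [Finset.sum_comm]
  refine Finset.sum_congr rfl fun I _ => ?_
  rw [Finset.sum_mul]
  refine Finset.sum_congr rfl fun s _ => ?_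
  rw [smul_eq_mul]; ring

/-- Jacobi's formula: the Leibniz expansion is differentiated column by column, and a determinant
with one column replaced is, by Cramer's rule, a diagonal entry of the adjugate times `A'`. -/
theorem hasDerivAt_det {A : ℝ → Matrix (Fin n) (Fin n) ℝ} {A' : Matrix (Fin n) (Fin n) ℝ} {t : ℝ}
    (hA : ∀ i j, HasDerivAt (fun t => A t i j) (A' i j) t) :
    HasDerivAt (fun t => (A t).det) ((A t).adjugate * A').trace t := by
  simp only [Matrix.det_apply']
  have h1 : ∀ σ : Equiv.Perm (Fin n), HasDerivAt
      (fun t => ((Equiv.Perm.sign σ : ℤ) : ℝ) * ∏ i, A t (σ i) i)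
      (((Equiv.Perm.sign σ : ℤ) : ℝ) *
        ∑ i, (∏ j ∈ Finset.univ.erase i, A t (σ j) j) • A' (σ i) i) t := fun σ =>
    (HasDerivAt.fun_finsetProd fun i _ => hA (σ i) i).const_mul _
  refine (HasDerivAt.fun_sum fun σ _ => h1 σ).congr_deriv ?_
  have h2 : ((A t).adjugate * A').trace =
      ∑ i, ((A t).updateCol i (fun j => A' j i)).det := by
    rw [Matrix.trace]
    refine Finset.sum_congr rfl fun i _ => ?_
    rw [← Matrix.cramer_apply, Matrix.cramer_eq_adjugate_mulVec, Matrix.diag_apply,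
      Matrix.mul_apply]
    rfl
  simp only [h2, Matrix.det_apply', Finset.mul_sum]
  rw [Finset.sum_comm]
  refine Finset.sum_congr rfl fun i _ => Finset.sum_congr rfl fun σ _ => ?_
  rw [← Finset.mul_prod_erase Finset.univ _ (Finset.mem_univ i), Matrix.updateCol_self,
    smul_eq_mul, mul_comm (A' (σ i) i)]
  congr 2
  refine Finset.prod_congr rfl fun j hj => ?_
  rw [Matrix.updateCol_ne (Finset.ne_of_mem_erase hj)]

/-- Differentiability comes from Cramer's formula for the entries; the value then follows by
differentiating `A⁻¹ * A = 1`. -/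
theorem hasDerivAt_inv {A : ℝ → Matrix (Fin n) (Fin n) ℝ} {A' : Matrix (Fin n) (Fin n) ℝ} {t : ℝ}
    (hA : ∀ i j, HasDerivAt (fun t => A t i j) (A' i j) t) (hdet : (A t).det ≠ 0) (i j : Fin n) :
    HasDerivAt (fun t => (A t)⁻¹ i j) (-((A t)⁻¹ * A' * (A t)⁻¹) i j) t := by
  have hd : ∀ i j, DifferentiableAt ℝ (fun t => (A t)⁻¹ i j) t := by
    intro i j
    have h1 : (fun t => (A t)⁻¹ i j) =
        fun t => ((A t).det)⁻¹ * ((A t).updateRow j (Pi.single i 1)).det := by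
      funext t
      rw [Matrix.inv_def, Matrix.smul_apply, Matrix.adjugate_apply, Ring.inverse_eq_inv',
        smul_eq_mul]
    rw [h1]
    refine ((hasDerivAt_det hA).differentiableAt.inv hdet).mul ?_
    -- Row `j` has been replaced by a constant row, so its derivative is zero.
    refine (hasDerivAt_det (A' := fun a b => if a = j then 0 else A' a b)
      fun a b => ?_).differentiableAt
    by_cases haj : a = j
    · subst haj
      simpa using hasDerivAt_const t _
    · simpa [Matrix.updateRow_ne haj, haj] using hA a b
  set D : Matrix (Fin n) (Fin n) ℝ := fun i j => deriv (fun t => (A t)⁻¹ i j) t with hD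
  have hderiv : ∀ i j, HasDerivAt (fun t => (A t)⁻¹ i j) (D i j) t := fun i j => (hd i j).hasDerivAt
  have hev : ∀ᶠ s in 𝓝 t, (A s).det ≠ 0 :=
    (hasDerivAt_det hA).continuousAt.eventually_ne hdet
  have hprod : D * A t + (A t)⁻¹ * A' = 0 := by
    ext a b
    have h1 : HasDerivAt (fun s => ∑ l, (A s)⁻¹ a l * A s l b)
        (∑ l, (D a l * A t l b + (A t)⁻¹ a l * A' l b)) t :=
      HasDerivAt.fun_sum fun l _ => (hderiv a l).mul (hA l b)
    have h2 : (fun s => ∑ l, (A s)⁻¹ a l * A s l b) =ᶠ[𝓝 t]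
        fun _ => (1 : Matrix (Fin n) (Fin n) ℝ) a b := by
      filter_upwards [hev] with s hs
      rw [← Matrix.nonsing_inv_mul (A s) (Ne.isUnit hs), Matrix.mul_apply]
    have h3 := h1.unique ((hasDerivAt_const t _).congr_of_eventuallyEq h2)
    rw [Finset.sum_add_distrib] at h3
    simpa [Matrix.mul_apply] using h3
  have hDeq : D = -((A t)⁻¹ * A' * (A t)⁻¹) := by
    have h1 : D * A t * (A t)⁻¹ = -((A t)⁻¹ * A') * (A t)⁻¹ := by
      rw [eq_neg_of_add_eq_zero_left hprod]
    rwa [Matrix.mul_assoc, Matrix.mul_nonsing_inv _ (Ne.isUnit hdet), Matrix.mul_one,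
      Matrix.neg_mul] at h1
  have h4 := hderiv i j
  rw [hDeq] at h4
  exact h4

/-- The derivative along a curve of the components of a multivector density in a moving frame. -/
theorem hasDerivAt_frameComponent {A : ℝ → Matrix (Fin n) (Fin n) ℝ}
    {A' : Matrix (Fin n) (Fin n) ℝ} {c : ℝ → (Fin m → Fin n) → ℝ} {c' : (Fin m → Fin n) → ℝ} {t : ℝ}
    (hA : ∀ i j, HasDerivAt (fun t => A t i j) (A' i j) t) (hdet : (A t).det ≠ 0)
    (hc : ∀ I, HasDerivAt (fun t => c t I) (c' I) t) (J : Fin m → Fin n) :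
    HasDerivAt (fun t => (A t).det * multiSum (c t) (fun s => (A t)⁻¹ (J s)))
      ((A t).det * (((A t)⁻¹ * A').trace * multiSum (c t) (fun s => (A t)⁻¹ (J s)) +
        multiSum c' (fun s => (A t)⁻¹ (J s)) -
        ∑ s, ∑ l, ((A t)⁻¹ * A') (J s) l *
          multiSum (c t) (fun s' => (A t)⁻¹ (Function.update J s l s')))) t := by
  refine ((hasDerivAt_det hA).mul (hasDerivAt_multiSum hc
    fun s j => hasDerivAt_inv hA hdet (J s) j)).congr_deriv ?_
  have h1 : (A t).adjugate = (A t).det • (A t)⁻¹ := by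
    rw [Matrix.inv_def, Ring.inverse_eq_inv', smul_smul, mul_inv_cancel₀ hdet, one_smul]
  have h2 : ∀ s, multiSum (c t) (Function.update (fun s => (A t)⁻¹ (J s)) s
      (fun j => -((A t)⁻¹ * A' * (A t)⁻¹) (J s) j)) =
      -∑ l, ((A t)⁻¹ * A') (J s) l *
          multiSum (c t) (fun s' => (A t)⁻¹ (Function.update J s l s')) := by
    intro s
    rw [multiSum_update_neg]
    congr 1
    have : (((A t)⁻¹ * A' * (A t)⁻¹) (J s)) =
        fun j => ∑ l, ((A t)⁻¹ * A') (J s) l * (A t)⁻¹ l j := by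
      funext j; rw [Matrix.mul_apply]
    have h3 := multiSum_update_sum (c t) (fun s => (A t)⁻¹ (J s)) s (((A t)⁻¹ * A') (J s))
      (fun l => ((A t)⁻¹ : Matrix (Fin n) (Fin n) ℝ) l)
    rw [this]
    refine h3.trans (Finset.sum_congr rfl fun l _ => ?_)
    congr 2
    funext s'
    by_cases hs : s' = s
    · subst hs; simp
    · simp [Function.update_of_ne hs]
  simp only [h2]
  rw [h1, Matrix.smul_mul, Matrix.trace_smul, smul_eq_mul, Finset.sum_neg_distrib]
  ring

theorem sum_sum_eq_zero_of_antisymm {ι : Type*} [Fintype ι] (f : ι → ι → ℝ)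
    (hf : ∀ i l, f i l = -f l i) : ∑ i, ∑ l, f i l = 0 := by
  have h1 : ∑ i, ∑ l, f i l = -∑ i, ∑ l, f i l := by
    conv_lhs => rw [Finset.sum_comm]
    simp only [← Finset.sum_neg_distrib]
    exact Finset.sum_congr rfl fun i _ => Finset.sum_congr rfl fun l _ => hf l i
  linarith

/-- The terms with second derivatives in the divergence of a multivector density along a
submanifold cancel. -/
theorem sum_frame_derivatives_eq_zero {p r : ℕ} (e : Fin p ⊕ Fin r ≃ Fin n)
    (B : Matrix (Fin n) (Fin n) ℝ) (X : Fin r → Matrix (Fin n) (Fin n) ℝ)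
    (hσ : ∀ i j a, X i j (e (Sum.inl a)) = 0)
    (hτ : ∀ i l j, X i j (e (Sum.inr l)) = X l j (e (Sum.inr i)))
    {c : (Fin (p + 1) → Fin n) → ℝ} (hc : IsAntisymm c) :
    ∑ i : Fin r, ((B * X i).trace * multiSum c (fun s => B
        ((Fin.cons (e (Sum.inr i)) (fun a => e (Sum.inl a)) : Fin (p + 1) → Fin n) s)) -
      ∑ s, ∑ l, (B * X i) ((Fin.cons (e (Sum.inr i)) (fun a => e (Sum.inl a)) :
          Fin (p + 1) → Fin n) s) l * multiSum c (fun s' => B (Function.update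
          (Fin.cons (e (Sum.inr i)) (fun a => e (Sum.inl a)) : Fin (p + 1) → Fin n) s l s'))) =
      0 := by
  have hBσ : ∀ i j a, (B * X i) j (e (Sum.inl a)) = 0 := fun i j a => by
    simp [Matrix.mul_apply, hσ]
  have hBτ : ∀ i l j, (B * X i) j (e (Sum.inr l)) = (B * X l) j (e (Sum.inr i)) := fun i l j => by
    simp only [Matrix.mul_apply]
    exact Finset.sum_congr rfl fun x _ => by rw [hτ]
  simp only [Matrix.trace, Matrix.diag_apply]
  simp only [← e.sum_comp, Fintype.sum_sum_type, hBσ, zero_mul, Finset.sum_const_zero, zero_add,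
    Fin.sum_univ_succ, Fin.cons_zero, Fin.cons_succ]
  simp only [Finset.sum_sub_distrib, Finset.sum_add_distrib]
  -- Variation of the tangential slot. By `hBτ` the coefficient is a diagonal entry of `B * X l`,
  -- and the sum over `i` rebuilds the trace, because the normal columns contribute nothing to it.
  -- This cancels the derivative of the determinant.
  have h1 : ∑ i, ∑ l, (B * X i) (e (Sum.inr i)) (e (Sum.inr l)) * multiSum c (fun s' => B
      (Function.update (Fin.cons (e (Sum.inr i)) (fun a => e (Sum.inl a)) : Fin (p + 1) → Fin n)
        0 (e (Sum.inr l)) s')) = ∑ i, (∑ l, (B * X i) (e (Sum.inr l)) (e (Sum.inr l))) *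
      multiSum c (fun s => B ((Fin.cons (e (Sum.inr i)) (fun a => e (Sum.inl a)) :
        Fin (p + 1) → Fin n) s)) := by
    rw [Finset.sum_comm]
    refine Finset.sum_congr rfl fun l _ => ?_
    rw [Finset.sum_mul]
    refine Finset.sum_congr rfl fun i _ => ?_
    rw [hBτ, Fin.update_cons_zero]
  -- Variation of a normal slot. The coefficient is symmetric in `i` and `l`, whereas exchanging
  -- these two indices swaps two slots of an antisymmetric form.
  have h2 : ∑ i, ∑ a : Fin p, ∑ l, (B * X i) (e (Sum.inl a)) (e (Sum.inr l)) *
      multiSum c (fun s' => B (Function.update (Fin.cons (e (Sum.inr i)) (fun a => e (Sum.inl a)) :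
        Fin (p + 1) → Fin n) a.succ (e (Sum.inr l)) s')) = 0 := by
    rw [Finset.sum_comm]
    refine Finset.sum_eq_zero fun a _ => ?_
    refine sum_sum_eq_zero_of_antisymm _ fun i l => ?_
    rw [hBτ, ← mul_neg, ← multiSum_swap hc _ (Fin.succ_ne_zero a).symm]
    congr 2
    funext s
    simp only [Function.comp_apply]
    congr 1
    refine Fin.cases ?_ (fun s => ?_) s
    · simp [Function.update_of_ne (Fin.succ_ne_zero a).symm]
    · by_cases hs : s = a
      · subst hs; simp [Function.update_of_ne (Fin.succ_ne_zero s).symm]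
      · rw [Equiv.swap_apply_of_ne_of_ne (Fin.succ_ne_zero s) (fun h => hs (Fin.succ_injective _ h)),
          Function.update_of_ne (fun h => hs (Fin.succ_injective _ h)),
          Function.update_of_ne (fun h => hs (Fin.succ_injective _ h))]
        simp
  rw [h1, h2]
  ring

/-- The terms with first derivatives of the components in the divergence of a multivector density
along a submanifold add up to the divergence of the multivector density. -/
theorem sum_component_derivatives_eq_zero {p r : ℕ} (e : Fin p ⊕ Fin r ≃ Fin n)
    (A B : Matrix (Fin n) (Fin n) ℝ) (hAB : A * B = 1)
    (d : Fin n → (Fin (p + 1) → Fin n) → ℝ) (hd : ∀ j, IsAntisymm (d j))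
    (hdiv : ∀ I : Fin p → Fin n, ∑ j, d j (Fin.cons j I) = 0) :
    ∑ i : Fin r, multiSum (fun I => ∑ j, A j (e (Sum.inr i)) * d j I) (fun s => B
        ((Fin.cons (e (Sum.inr i)) (fun a => e (Sum.inl a)) : Fin (p + 1) → Fin n) s)) = 0 := by
  set T : Fin n → ℝ := fun l => multiSum (fun I => ∑ j, A j l * d j I) (fun s => B
        ((Fin.cons l (fun a => e (Sum.inl a)) : Fin (p + 1) → Fin n) s)) with hT
  -- For a normal direction the same covector occurs twice, so the sum may be extended to all
  -- directions of the frame.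
  have h1 : ∀ a : Fin p, T (e (Sum.inl a)) = 0 := by
    intro a
    refine multiSum_eq_zero ?_ _ (Fin.succ_ne_zero a).symm (by simp)
    intro I i j hij
    rw [← Finset.sum_neg_distrib]
    refine Finset.sum_congr rfl fun l _ => ?_
    rw [hd l I i j hij, mul_neg]
  have h2 : ∑ i : Fin r, T (e (Sum.inr i)) = ∑ l, T l := by
    rw [← e.sum_comp, Fintype.sum_sum_type]
    simp [h1]
  change ∑ i : Fin r, T (e (Sum.inr i)) = 0
  rw [h2]
  have h3 : ∀ l, T l = ∑ i : Fin n, ∑ I : Fin p → Fin n, (B l i * ∏ a, B (e (Sum.inl a)) (I a)) *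
      ∑ j, A j l * d j (Fin.cons i I) := by
    intro l
    rw [hT]
    simp only [multiSum]
    rw [← (Fin.consEquiv fun _ => Fin n).sum_comp, Fintype.sum_prod_type]
    refine Finset.sum_congr rfl fun i _ => Finset.sum_congr rfl fun I _ => ?_
    rw [Fin.prod_univ_succ]
    simp [Fin.consEquiv]
  simp only [h3]
  rw [Finset.sum_comm]
  -- Summing over the full frame contracts `A` with its inverse `B`, which turns frame derivatives
  -- into coordinate derivatives and leaves the divergence.
  have h4 : ∀ i, ∑ l, ∑ I : Fin p → Fin n, (B l i * ∏ a, B (e (Sum.inl a)) (I a)) *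
      ∑ j, A j l * d j (Fin.cons i I) =
      ∑ I : Fin p → Fin n, (∏ a, B (e (Sum.inl a)) (I a)) * d i (Fin.cons i I) := by
    intro i
    rw [Finset.sum_comm]
    refine Finset.sum_congr rfl fun I _ => ?_
    simp only [Finset.mul_sum]
    rw [Finset.sum_comm]
    have h5 : ∀ j, ∑ l, B l i * (∏ a, B (e (Sum.inl a)) (I a)) * (A j l * d j (Fin.cons i I)) =
        (A * B) j i * ((∏ a, B (e (Sum.inl a)) (I a)) * d j (Fin.cons i I)) := by
      intro j
      rw [Matrix.mul_apply, Finset.sum_mul]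
      exact Finset.sum_congr rfl fun l _ => by ring
    simp only [h5, hAB, Matrix.one_apply, ite_mul, one_mul, zero_mul]
    simp
  simp only [h4]
  rw [Finset.sum_comm]
  refine Finset.sum_eq_zero fun I _ => ?_
  rw [← Finset.mul_sum, hdiv, mul_zero]

end Components

/-! ### The divergence of the induced vector density in an adapted frame. -/

section Frames

variable {n m : ℕ}

/-- The components, in the frame given by the columns of `A`, of the multivector density with
components `c` in the standard frame. -/
def frameComponent (A : Matrix (Fin n) (Fin n) ℝ) (c : (Fin m → Fin n) → ℝ) (J : Fin m → Fin n) :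
    ℝ :=
  |A.det| * multiSum c (fun s => A⁻¹ (J s))

section Regularity

variable {E : Type*} [NormedAddCommGroup E] [NormedSpace ℝ E] {N : ℕ∞} {S : Set E} {x : E}

theorem contDiffWithinAt_det {A : E → Matrix (Fin n) (Fin n) ℝ}
    (hA : ∀ i j, ContDiffWithinAt ℝ N (fun y => A y i j) S x) :
    ContDiffWithinAt ℝ N (fun y => (A y).det) S x := by
  simp only [Matrix.det_apply']
  exact ContDiffWithinAt.sum fun σ _ => contDiffWithinAt_const.mul
    (contDiffWithinAt_prod fun i _ => hA _ _)

theorem contDiffWithinAt_inv {A : E → Matrix (Fin n) (Fin n) ℝ}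
    (hA : ∀ i j, ContDiffWithinAt ℝ N (fun y => A y i j) S x) (hdet : (A x).det ≠ 0)
    (i j : Fin n) : ContDiffWithinAt ℝ N (fun y => (A y)⁻¹ i j) S x := by
  have h1 : (fun y => (A y)⁻¹ i j) =
      fun y => ((A y).det)⁻¹ * ((A y).updateRow j (Pi.single i 1)).det := by
    funext t
    rw [Matrix.inv_def, Matrix.smul_apply, Matrix.adjugate_apply, Ring.inverse_eq_inv',
      smul_eq_mul]
  rw [h1]
  refine ((contDiffWithinAt_det hA).inv hdet).mul (contDiffWithinAt_det fun a b => ?_)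
  by_cases haj : a = j
  · subst haj
    simpa using contDiffWithinAt_const
  · simpa [Matrix.updateRow_ne haj] using hA a b

theorem contDiffWithinAt_frameComponent {A : E → Matrix (Fin n) (Fin n) ℝ}
    {c : E → (Fin m → Fin n) → ℝ} (hA : ∀ i j, ContDiffWithinAt ℝ N (fun y => A y i j) S x)
    (hdet : (A x).det ≠ 0) (hc : ∀ I, ContDiffWithinAt ℝ N (fun y => c y I) S x)
    (J : Fin m → Fin n) :
    ContDiffWithinAt ℝ N (fun y => frameComponent (A y) (c y) J) S x := by
  unfold frameComponent multiSum
  refine ContDiffWithinAt.mul ?_ (ContDiffWithinAt.sum fun I _ => ContDiffWithinAt.mul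
    (contDiffWithinAt_prod fun s _ => contDiffWithinAt_inv hA hdet _ _) (hc I))
  exact (contDiffAt_abs hdet).comp_contDiffWithinAt x (contDiffWithinAt_det hA)

end Regularity

variable {E : Type*} [NormedAddCommGroup E] [NormedSpace ℝ E]

/-- The restriction of a divergence-free multivector density to an immersed submanifold, contracted
with conormal covectors, is a divergence-free vector density. -/
theorem sum_fderiv_frameComponent_eq_zero {p r : ℕ} (e : Fin p ⊕ Fin r ≃ Fin n)
    {w : Fin r → E} {y₀ : E} {g : E → EuclideanSpace ℝ (Fin n)} (hg : ContDiffAt ℝ 2 g y₀)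
    {ν : Fin p → EuclideanSpace ℝ (Fin n)} {A : E → Matrix (Fin n) (Fin n) ℝ}
    (hAl : ∀ y j a, A y j (e (Sum.inl a)) = ν a j)
    (hAr : ∀ᶠ y in 𝓝 y₀, ∀ j i, A y j (e (Sum.inr i)) = fderiv ℝ g y (w i) j)
    (hdet : (A y₀).det ≠ 0) {c : EuclideanSpace ℝ (Fin n) → (Fin (p + 1) → Fin n) → ℝ}
    (hc : ∀ I, DifferentiableAt ℝ (fun x => c x I) (g y₀))
    (hanti : ∀ x, IsAntisymm (c x))
    (hdiv : ∀ I : Fin p → Fin n, ∑ j, fderiv ℝ (fun x => c x (Fin.cons j I)) (g y₀)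
      (EuclideanSpace.single j (1 : ℝ)) = 0) {G : Fin r → E → ℝ}
    (hG : ∀ i, G i =ᶠ[𝓝 y₀] fun y => frameComponent (A y) (c (g y))
      (Fin.cons (e (Sum.inr i)) (fun a => e (Sum.inl a))))
    (hGd : ∀ i, DifferentiableAt ℝ (G i) y₀) :
    ∑ i, fderiv ℝ (G i) y₀ (w i) = 0 := by
  set J : Fin r → Fin (p + 1) → Fin n :=
    fun i => Fin.cons (e (Sum.inr i)) (fun a => e (Sum.inl a)) with hJ
  -- `X i` is the derivative of the frame along `w i`: zero in the constant normal columns, second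
  -- derivatives of `g` in the tangential ones.
  set X : Fin r → Matrix (Fin n) (Fin n) ℝ := fun i j l =>
    Sum.elim (fun _ => 0) (fun l => fderiv ℝ (fderiv ℝ g) y₀ (w i) (w l) j) (e.symm l) with hX
  set d : Fin n → (Fin (p + 1) → Fin n) → ℝ := fun j I =>
    fderiv ℝ (fun x => c x I) (g y₀) (EuclideanSpace.single j (1 : ℝ)) with hd
  have hgd : DifferentiableAt ℝ g y₀ := hg.differentiableAt (by norm_num)
  have hg2 : DifferentiableAt ℝ (fderiv ℝ g) y₀ :=
    (hg.fderiv_right (m := 1) (by norm_num)).differentiableAt (by norm_num)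
  -- Each directional derivative is taken along a straight line, which reduces the claim to the
  -- formulas for curves of matrices.
  have hline : ∀ i, HasDerivAt (fun t : ℝ => y₀ + t • w i) (w i) 0 := fun i => by
    simpa using ((hasDerivAt_id (0 : ℝ)).smul_const (w i)).const_add y₀
  have hline0 : ∀ i, y₀ + (0 : ℝ) • w i = y₀ := fun i => by simp
  have hline_t : ∀ i, Filter.Tendsto (fun t : ℝ => y₀ + t • w i) (𝓝 0) (𝓝 y₀) := fun i => by
    have := (hline i).continuousAt.tendsto
    rwa [hline0] at this
  have hsymm : ∀ v v', fderiv ℝ (fderiv ℝ g) y₀ v v' = fderiv ℝ (fderiv ℝ g) y₀ v' v := by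
    intro v v'
    exact (hg.isSymmSndFDerivAt (by simp)) v v'
  have hA' : ∀ i a b, HasDerivAt (fun t : ℝ => A (y₀ + t • w i) a b) (X i a b) 0 := by
    intro i a b
    obtain ⟨b, rfl⟩ := e.surjective b
    rcases b with b | b
    · simp only [hAl, hX, Equiv.symm_apply_apply, Sum.elim_inl]
      exact hasDerivAt_const _ _
    · simp only [hX, Equiv.symm_apply_apply, Sum.elim_inr]
      have h1 : HasDerivAt (fun t : ℝ => fderiv ℝ g (y₀ + t • w i))
          (fderiv ℝ (fderiv ℝ g) y₀ (w i)) 0 := by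
        have h2 : HasFDerivAt (fderiv ℝ g) (fderiv ℝ (fderiv ℝ g) y₀) (y₀ + (0 : ℝ) • w i) := by
          rw [hline0]; exact hg2.hasFDerivAt
        exact h2.comp_hasDerivAt 0 (hline i)
      have h3 : HasDerivAt (fun t : ℝ => (fderiv ℝ g (y₀ + t • w i) (w b)) a)
          ((fderiv ℝ (fderiv ℝ g) y₀ (w i) (w b)) a) 0 := by
        have := (h1.clm_apply (hasDerivAt_const (0 : ℝ) (w b)))
        simp only [map_zero, add_zero] at this
        exact (EuclideanSpace.proj (𝕜 := ℝ) a).hasFDerivAt.comp_hasDerivAt 0 this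
      refine h3.congr_of_eventuallyEq ?_
      filter_upwards [(hline_t i).eventually hAr] with t ht
      exact ht a b
  have hc' : ∀ i I, HasDerivAt (fun t : ℝ => c (g (y₀ + t • w i)) I)
      (∑ j, A y₀ j (e (Sum.inr i)) * d j I) 0 := by
    intro i I
    have h1 : HasDerivAt (fun t : ℝ => g (y₀ + t • w i)) (fderiv ℝ g y₀ (w i)) 0 := by
      have h2 : HasFDerivAt g (fderiv ℝ g y₀) (y₀ + (0 : ℝ) • w i) := by
        rw [hline0]; exact hgd.hasFDerivAt
      exact h2.comp_hasDerivAt 0 (hline i)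
    have h3 : HasFDerivAt (fun x => c x I) (fderiv ℝ (fun x => c x I) (g y₀))
        (g (y₀ + (0 : ℝ) • w i)) := by
      rw [hline0]; exact (hc I).hasFDerivAt
    refine (h3.comp_hasDerivAt 0 h1).congr_deriv ?_
    conv_lhs => rw [← (EuclideanSpace.basisFun (Fin n) ℝ).sum_repr (fderiv ℝ g y₀ (w i))]
    simp only [map_sum, map_smul, smul_eq_mul, EuclideanSpace.basisFun_repr,
      EuclideanSpace.basisFun_apply]
    exact Finset.sum_congr rfl fun j _ => by rw [hAr.self_of_nhds]
  have hcongr : ∀ i, (fun t : ℝ => G i (y₀ + t • w i)) =ᶠ[𝓝 0] fun t =>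
      frameComponent (A (y₀ + t • w i)) (c (g (y₀ + t • w i))) (J i) := fun i =>
    (hline_t i).eventually (hG i)
  -- The determinant keeps its sign near `y₀`, so its absolute value is differentiated as a constant
  -- multiple of it.
  set sg : ℝ := if 0 < (A y₀).det then 1 else -1 with hsg
  have hsign : ∀ i, ∀ᶠ t in 𝓝 (0 : ℝ),
      |(A (y₀ + t • w i)).det| = sg * (A (y₀ + t • w i)).det := by
    intro i
    have hcont := (hasDerivAt_det (hA' i)).continuousAt
    have hcont' : Filter.Tendsto (fun t : ℝ => (A (y₀ + t • w i)).det) (𝓝 0) (𝓝 (A y₀).det) := by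
      have := hcont.tendsto
      rwa [hline0] at this
    rcases lt_or_gt_of_ne hdet with h | h
    · filter_upwards [hcont'.eventually (eventually_lt_nhds h)] with t ht
      rw [abs_of_neg ht, hsg, if_neg h.not_gt, neg_one_mul]
    · filter_upwards [hcont'.eventually (eventually_gt_nhds h)] with t ht
      rw [abs_of_pos ht, hsg, if_pos h, one_mul]
  have hmain : ∀ i, fderiv ℝ (G i) y₀ (w i) = sg * ((A y₀).det *
      ((((A y₀)⁻¹ * X i).trace * multiSum (c (g y₀)) (fun s => (A y₀)⁻¹ (J i s)) -
        ∑ s, ∑ l, ((A y₀)⁻¹ * X i) (J i s) l *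
          multiSum (c (g y₀)) (fun s' => (A y₀)⁻¹ (Function.update (J i) s l s'))) +
      multiSum (fun I => ∑ j, A y₀ j (e (Sum.inr i)) * d j I) (fun s => (A y₀)⁻¹ (J i s)))) := by
    intro i
    have h1 : HasDerivAt (fun t : ℝ => G i (y₀ + t • w i)) (fderiv ℝ (G i) y₀ (w i)) 0 := by
      have h2 : HasFDerivAt (G i) (fderiv ℝ (G i) y₀) (y₀ + (0 : ℝ) • w i) := by
        rw [hline0]; exact (hGd i).hasFDerivAt
      exact h2.comp_hasDerivAt 0 (hline i)
    have h3 := (hasDerivAt_frameComponent (hA' i) (by rwa [hline0]) (hc' i) (J i)).const_mul sg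
    have h4 : (fun t : ℝ => G i (y₀ + t • w i)) =ᶠ[𝓝 0] fun t => sg * ((A (y₀ + t • w i)).det *
        multiSum (c (g (y₀ + t • w i))) (fun s => (A (y₀ + t • w i))⁻¹ (J i s))) := by
      filter_upwards [hcongr i, hsign i] with t ht ht'
      rw [ht, frameComponent, ht', mul_assoc]
    have h5 := h1.unique (h3.congr_of_eventuallyEq h4)
    rw [h5, hline0]
    ring
  simp only [hmain]
  rw [← Finset.mul_sum, ← Finset.mul_sum, Finset.sum_add_distrib]
  have hinv : A y₀ * (A y₀)⁻¹ = 1 := Matrix.mul_nonsing_inv _ (Ne.isUnit hdet)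
  -- The two cancellations: derivatives of the frame, using the symmetry of the second derivative,
  -- then derivatives of the components, using `hdiv`.
  rw [sum_frame_derivatives_eq_zero e (A y₀)⁻¹ X (fun i j a => by simp [hX])
      (fun i l j => by simp [hX, hsymm (w i)]) (hanti (g y₀)),
    sum_component_derivatives_eq_zero e (A y₀) (A y₀)⁻¹ hinv d ?_ hdiv]
  · simp
  · intro j I a b hab
    simp only [hd]
    have : (fun x => c x (I ∘ Equiv.swap a b)) = fun x => -c x I := by
      funext x; exact hanti x I a b hab
    rw [this, fderiv_fun_neg]
    rfl

end Frames

/-! ### The divergence theorem on a half-space. -/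

section HalfSpace

variable {k : ℕ}

/-- The inclusion of the boundary hyperplane `{y | y 0 = 0}`. -/
def faceIncl (k : ℕ) : EuclideanSpace ℝ (Fin k) →L[ℝ] EuclideanSpace ℝ (Fin (k + 1)) :=
  LinearMap.toContinuousLinearMap
    { toFun := fun y => WithLp.toLp 2 (Fin.cons 0 y.ofLp)
      map_add' := fun x y => by
        ext i; refine Fin.cases (by simp) (fun i => by simp) i
      map_smul' := fun c y => by
        ext i; refine Fin.cases (by simp) (fun i => by simp) i }

/-- The projection forgetting the component number `0`. -/
def faceProj (k : ℕ) : EuclideanSpace ℝ (Fin (k + 1)) →L[ℝ] EuclideanSpace ℝ (Fin k) :=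
  LinearMap.toContinuousLinearMap
    { toFun := fun y => WithLp.toLp 2 (fun i => y (Fin.succ i))
      map_add' := fun x y => by ext i; simp
      map_smul' := fun c y => by ext i; simp }

@[simp] theorem faceIncl_zero (y : EuclideanSpace ℝ (Fin k)) : faceIncl k y 0 = 0 := rfl

@[simp] theorem faceIncl_succ (y : EuclideanSpace ℝ (Fin k)) (i : Fin k) :
    faceIncl k y i.succ = y i := rfl

@[simp] theorem faceProj_apply (y : EuclideanSpace ℝ (Fin (k + 1))) (i : Fin k) :
    faceProj k y i = y i.succ := rfl

theorem faceProj_faceIncl (y : EuclideanSpace ℝ (Fin k)) : faceProj k (faceIncl k y) = y := by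
  ext i; simp

theorem faceIncl_faceProj {y : EuclideanSpace ℝ (Fin (k + 1))} (hy : y 0 = 0) :
    faceIncl k (faceProj k y) = y := by
  ext i
  refine Fin.cases (by simp [hy]) (fun i => by simp) i

theorem isClosed_halfSpace (k : ℕ) :
    IsClosed {y : EuclideanSpace ℝ (Fin (k + 1)) | 0 ≤ y 0} :=
  isClosed_le continuous_const (EuclideanSpace.proj (𝕜 := ℝ) (0 : Fin (k + 1))).continuous

/-- The divergence theorem for compactly supported vector fields on a half-space. -/
theorem integral_halfSpace_divergence (F : Fin (k + 1) → EuclideanSpace ℝ (Fin (k + 1)) → ℝ)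
    (D : EuclideanSpace ℝ (Fin (k + 1)) → ℝ) {K : Set (EuclideanSpace ℝ (Fin (k + 1)))}
    (hK : IsCompact K) (hF0 : ∀ i y, y ∉ K → F i y = 0) (hD0 : ∀ y, y ∉ K → D y = 0)
    (hFc : ∀ i, ContinuousOn (F i) {y | 0 ≤ y 0}) (hDc : ContinuousOn D {y | 0 ≤ y 0})
    (hFd : ∀ i y, 0 < y 0 → DifferentiableAt ℝ (F i) y)
    (hD : ∀ y, 0 < y 0 → ∑ i, fderiv ℝ (F i) y (EuclideanSpace.single i (1 : ℝ)) = D y) :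
    ∫ y in {y | 0 ≤ y 0}, D y = -∫ y, F 0 (faceIncl k y) := by
  let L : (Fin (k + 1) → ℝ) ≃L[ℝ] EuclideanSpace ℝ (Fin (k + 1)) :=
    (EuclideanSpace.equiv (Fin (k + 1)) ℝ).symm
  have hLi : ∀ x i, L x i = x i := fun x i => rfl
  have hmp : MeasurePreserving L := PiLp.volume_preserving_toLp (Fin (k + 1))
  have hme : MeasurableEmbedding L := L.toHomeomorph.measurableEmbedding
  obtain ⟨R, hR0, hR⟩ := hK.isBounded.exists_pos_norm_lt
  have hKR : ∀ x i, R ≤ |x i| → L x ∉ K := by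
    intro x i hx hmem
    have h1 := hR _ hmem
    have h2 := EuclideanSpace.norm_eq (L x)
    have h3 : ‖L x i‖ ≤ ‖L x‖ := PiLp.norm_apply_le (L x) i
    rw [hLi, Real.norm_eq_abs] at h3
    linarith
  -- The box is `[0, R] × [-R, R]^k`, where `R` strictly bounds the norm on `K`. All its faces
  -- except the one with `x 0 = 0` miss `K`.
  set a : Fin (k + 1) → ℝ := Fin.cons 0 (fun _ => -R) with ha
  set b : Fin (k + 1) → ℝ := fun _ => R with hb
  have ha0 : a 0 = 0 := rfl
  have has : ∀ i : Fin k, a i.succ = -R := fun i => rfl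
  have hab : a ≤ b := by
    intro i
    refine Fin.cases ?_ (fun i => ?_) i
    · rw [ha0]; exact hR0.le
    · rw [has]; simp only [hb]; linarith
  have hsub : ∀ x ∈ Icc a b, L x ∈ {y : EuclideanSpace ℝ (Fin (k + 1)) | 0 ≤ y 0} := by
    intro x hx
    exact hx.1 0
  have hpos : ∀ x ∈ Set.pi univ fun i => Ioo (a i) (b i), 0 < L x 0 := by
    intro x hx
    exact (hx 0 (mem_univ _)).1
  have hDI : ContinuousOn (fun x => D (L x)) (Icc a b) :=
    hDc.comp L.continuous.continuousOn hsub
  have hfd : ∀ x ∈ Set.pi univ fun i => Ioo (a i) (b i), ∀ i, HasFDerivAt (fun x => F i (L x))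
      ((fderiv ℝ (F i) (L x)).comp (L : (Fin (k + 1) → ℝ) →L[ℝ] EuclideanSpace ℝ (Fin (k + 1)))) x :=
    fun x hx i => (hFd i (L x) (hpos x hx)).hasFDerivAt.comp x L.hasFDerivAt
  have hsum : ∀ x ∈ Set.pi univ fun i => Ioo (a i) (b i),
      ∑ i, ((fderiv ℝ (F i) (L x)).comp
        (L : (Fin (k + 1) → ℝ) →L[ℝ] EuclideanSpace ℝ (Fin (k + 1)))) (Pi.single i 1) =
      D (L x) := by
    intro x hx
    rw [← hD _ (hpos x hx)]
    rfl
  -- The derivatives are controlled only in the open box. It differs from the closed one by a null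
  -- set, so integrability is inherited from the continuous function `D`.
  have hae : (Set.pi univ fun i => Ioo (a i) (b i)) =ᵐ[volume] Icc a b :=
    Measure.univ_pi_Ioo_ae_eq_Icc
  have hmeas : MeasurableSet (Set.pi univ fun i => Ioo (a i) (b i)) :=
    MeasurableSet.univ_pi fun i => measurableSet_Ioo
  have hint : IntegrableOn (fun x => ∑ i, ((fderiv ℝ (F i) (L x)).comp
        (L : (Fin (k + 1) → ℝ) →L[ℝ] EuclideanSpace ℝ (Fin (k + 1)))) (Pi.single i 1))
        (Icc a b) := by
    have h1 : IntegrableOn (fun x => D (L x)) (Set.pi univ fun i => Ioo (a i) (b i)) :=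
      (hDI.integrableOn_compact isCompact_Icc).congr_set_ae hae
    exact (h1.congr_fun (fun x hx => (hsum x hx).symm) hmeas).congr_set_ae hae.symm
  have key := integral_divergence_of_hasFDerivAt_off_countable' a b hab
    (fun i x => F i (L x)) (fun i x => (fderiv ℝ (F i) (L x)).comp
        (L : (Fin (k + 1) → ℝ) →L[ℝ] EuclideanSpace ℝ (Fin (k + 1)))) ∅ countable_empty
    (fun i => (hFc i).comp L.continuous.continuousOn hsub)
    (fun x hx i => hfd x hx.1 i) hint
  rw [← setIntegral_congr_set hae, setIntegral_congr_fun hmeas hsum, setIntegral_congr_set hae,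
    Fin.sum_univ_succ] at key
  have hfront : ∀ i : Fin (k + 1), ∀ x, F i (L (i.insertNth (b i) x)) = 0 := fun i x =>
    hF0 _ _ (hKR _ i (by simp [hb, abs_of_pos hR0]))
  have hback : ∀ i : Fin k, ∀ x, F i.succ (L (i.succ.insertNth (a i.succ) x)) = 0 := fun i x =>
    hF0 _ _ (hKR _ i.succ (by simp [has, abs_of_pos hR0]))
  simp only [hfront, hback, integral_zero, sub_zero, zero_sub, Finset.sum_const_zero,
    add_zero] at key
  have hleft : ∫ x in Icc a b, D (L x) = ∫ y in {y | 0 ≤ y 0}, D y := by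
    rw [← hmp.setIntegral_preimage_emb hme]
    refine (setIntegral_eq_of_subset_of_forall_sdiff_eq_zero ?_ hsub ?_).symm
    · exact (isClosed_halfSpace k).measurableSet.preimage hme.measurable
    · rintro x ⟨hx1, hx2⟩
      refine hD0 _ ?_
      have hx0 : 0 ≤ x 0 := hx1
      by_contra hmem
      refine hx2 ⟨fun i => ?_, fun i => ?_⟩
      · refine Fin.cases hx0 (fun i => ?_) i
        by_contra hlt
        rw [has, not_le] at hlt
        exact hKR x i.succ (by rw [abs_of_neg (by linarith)]; linarith) hmem
      · by_contra hlt
        rw [not_le] at hlt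
        exact hKR x i (le_trans hlt.le (le_abs_self _)) hmem
  rw [← hleft, key]
  congr 1
  have hL' : MeasurePreserving (@WithLp.toLp 2 (Fin k → ℝ)) := PiLp.volume_preserving_toLp (Fin k)
  have hme' : MeasurableEmbedding (@WithLp.toLp 2 (Fin k → ℝ)) :=
    (EuclideanSpace.equiv (Fin k) ℝ).symm.toHomeomorph.measurableEmbedding
  rw [← hL'.integral_comp hme']
  have hface : ∀ x : Fin k → ℝ, F 0 (L (Fin.insertNth 0 (a 0) x)) =
      F 0 (faceIncl k (WithLp.toLp 2 x)) := by
    intro x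
    congr 1
    ext i
    rw [hLi, ha0]
    refine Fin.cases (by simp) (fun i => by simp) i
  simp only [hface]
  refine setIntegral_eq_integral_of_forall_compl_eq_zero fun x hx => ?_
  refine hF0 _ _ fun hmem => hx ⟨fun i => ?_, fun i => ?_⟩
  · have h1 : ¬ R ≤ |x i| := fun h => hKR (Fin.cons 0 x) i.succ (by simpa using h) hmem
    rw [not_le, abs_lt] at h1
    exact h1.1.le
  · have h1 : ¬ R ≤ |x i| := fun h => hKR (Fin.cons 0 x) i.succ (by simpa using h) hmem
    rw [not_le, abs_lt] at h1
    exact h1.2.le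

end HalfSpace

/-! ### Coordinate frames of charts and the integral of a density under change of chart. -/

section ChartFrame

variable {r : ℕ} {H : Type*} [TopologicalSpace H]
  (I : ModelWithCorners ℝ (EuclideanSpace ℝ (Fin r)) H) {W : Type*} [TopologicalSpace W]
  [ChartedSpace H W]

/-- The differential at `q` of the chart at `a`. -/
def chartDeriv (a q : W) : TangentSpace I q →L[ℝ] EuclideanSpace ℝ (Fin r) :=
  mfderiv I 𝓘(ℝ, EuclideanSpace ℝ (Fin r)) (extChartAt I a) q

/-- The coordinate vectors at `q` of the chart at `a`. -/
def chartFrame (a q : W) (l : Fin r) : TangentSpace I q :=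
  (chartDeriv I a q).inverse (EuclideanSpace.single l (1 : ℝ))

/-- The coordinate covectors at `q` of the chart at `a`. -/
def chartCoframe (a q : W) (l : Fin r) : TangentSpace I q →ₗ[ℝ] ℝ :=
  (EuclideanSpace.proj l : EuclideanSpace ℝ (Fin r) →L[ℝ] ℝ).toLinearMap ∘ₗ
    (chartDeriv I a q).toLinearMap

variable {I}

/-- With boundary the target of a chart need not be open; it is the intersection of an open set with
the closed range of `I`. -/
theorem measurableSet_extChartAt_target_inter (a : W) {s : Set W} (hs : IsOpen s) :
    MeasurableSet ((extChartAt I a).target ∩ (extChartAt I a).symm ⁻¹' s) := by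
  have h1 : (extChartAt I a).target ∩ (extChartAt I a).symm ⁻¹' s =
      I.symm ⁻¹' ((chartAt H a).target ∩ (chartAt H a).symm ⁻¹' s) ∩ range I := by
    rw [extChartAt_target]
    ext y
    simp only [mem_inter_iff, mem_preimage, extChartAt_coe_symm, Function.comp_apply]
    tauto
  rw [h1]
  exact (((chartAt H a).isOpen_inter_preimage_symm hs).preimage I.continuous_symm).measurableSet.inter
    I.isClosed_range.measurableSet

theorem measurableSet_extChartAt_target (a : W) : MeasurableSet (extChartAt I a).target := by
  simpa using measurableSet_extChartAt_target_inter (I := I) a isOpen_univ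

variable [IsManifold I ∞ W]

theorem isInvertible_chartDeriv {a q : W} (hq : q ∈ (extChartAt I a).source) :
    (chartDeriv I a q).IsInvertible :=
  isInvertible_mfderiv_extChartAt hq

theorem chartDeriv_inverse_apply {a q : W} (hq : q ∈ (extChartAt I a).source)
    (v : EuclideanSpace ℝ (Fin r)) : chartDeriv I a q ((chartDeriv I a q).inverse v) = v := by
  obtain ⟨e, he⟩ := isInvertible_chartDeriv hq
  rw [← he, ContinuousLinearMap.inverse_equiv]
  exact e.apply_symm_apply v

theorem inverse_chartDeriv_apply {a q : W} (hq : q ∈ (extChartAt I a).source)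
    (v : TangentSpace I q) : (chartDeriv I a q).inverse (chartDeriv I a q v) = v := by
  obtain ⟨e, he⟩ := isInvertible_chartDeriv hq
  rw [← he, ContinuousLinearMap.inverse_equiv]
  exact e.symm_apply_apply v

theorem chartDeriv_chartFrame {a q : W} (hq : q ∈ (extChartAt I a).source) (l : Fin r) :
    chartDeriv I a q (chartFrame I a q l) = EuclideanSpace.single l (1 : ℝ) :=
  chartDeriv_inverse_apply hq _

theorem chartCoframe_chartFrame {a q : W} (hq : q ∈ (extChartAt I a).source) (i l : Fin r) :
    chartCoframe I a q i (chartFrame I a q l) = if i = l then 1 else 0 := by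
  change (chartDeriv I a q (chartFrame I a q l)) i = _
  rw [chartDeriv_chartFrame hq]
  simp

theorem eq_sum_chartFrame {a q : W} (hq : q ∈ (extChartAt I a).source) (v : TangentSpace I q) :
    v = ∑ l, chartCoframe I a q l v • chartFrame I a q l := by
  conv_lhs => rw [← inverse_chartDeriv_apply hq v,
    ← (EuclideanSpace.basisFun (Fin r) ℝ).sum_repr (chartDeriv I a q v)]
  rw [map_sum]
  refine Finset.sum_congr rfl fun l _ => ?_
  rw [map_smul, EuclideanSpace.basisFun_apply]
  rfl

theorem eq_sum_chartCoframe {a q : W} (hq : q ∈ (extChartAt I a).source)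
    (α : TangentSpace I q →ₗ[ℝ] ℝ) :
    α = ∑ l, α (chartFrame I a q l) • chartCoframe I a q l := by
  ext v
  conv_lhs => rw [eq_sum_chartFrame hq v]
  simp [mul_comm]

theorem mfderivWithin_symm_eq_inverse {a : W} {y : EuclideanSpace ℝ (Fin r)}
    (hy : y ∈ (extChartAt I a).target) :
    mfderivWithin 𝓘(ℝ, EuclideanSpace ℝ (Fin r)) I (extChartAt I a).symm (range I) y =
      (chartDeriv I a ((extChartAt I a).symm y)).inverse :=
  (ContinuousLinearMap.inverse_eq (mfderiv_extChartAt_comp_mfderivWithin_extChartAt_symm hy)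
    (mfderivWithin_extChartAt_symm_comp_mfderiv_extChartAt hy)).symm

/-- The derivative of a function read in a chart. -/
theorem hasFDerivWithinAt_comp_extChartAt_symm {F : Type*} [NormedAddCommGroup F] [NormedSpace ℝ F]
    {g : W → F} {a : W} {y : EuclideanSpace ℝ (Fin r)} (hy : y ∈ (extChartAt I a).target)
    {g' : TangentSpace I ((extChartAt I a).symm y) →L[ℝ] F}
    (hg : HasMFDerivAt I 𝓘(ℝ, F) g ((extChartAt I a).symm y) g') :
    HasFDerivWithinAt (g ∘ (extChartAt I a).symm)
      (g'.comp (chartDeriv I a ((extChartAt I a).symm y)).inverse) (range I) y := by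
  have h1 := (mdifferentiableWithinAt_extChartAt_symm hy).hasMFDerivWithinAt
  rw [mfderivWithin_symm_eq_inverse hy] at h1
  exact (hg.comp_hasMFDerivWithinAt y h1).hasFDerivWithinAt

theorem fderivWithin_comp_extChartAt_symm {F : Type*} [NormedAddCommGroup F] [NormedSpace ℝ F]
    {g : W → F} {a : W} {y : EuclideanSpace ℝ (Fin r)} (hy : y ∈ (extChartAt I a).target)
    {g' : TangentSpace I ((extChartAt I a).symm y) →L[ℝ] F}
    (hg : HasMFDerivAt I 𝓘(ℝ, F) g ((extChartAt I a).symm y) g') (l : Fin r) :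
    fderivWithin ℝ (g ∘ (extChartAt I a).symm) (range I) y (EuclideanSpace.single l (1 : ℝ)) =
      g' (chartFrame I a ((extChartAt I a).symm y) l) := by
  rw [(hasFDerivWithinAt_comp_extChartAt_symm hy hg).fderivWithin
    (I.uniqueDiffOn y (extChartAt_target_subset_range a hy))]
  rfl

/-- A density on tangent spaces. -/
def IsDensity {r : ℕ} {T : Type*} [AddCommGroup T] [Module ℝ T] (δ : (Fin r → T) → ℝ) : Prop :=
  ∀ (u : Fin r → T) (C : Matrix (Fin r) (Fin r) ℝ), δ (fun j => ∑ l, C l j • u l) = |C.det| * δ u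

theorem hasMFDerivAt_chartDeriv {a q : W} (hq : q ∈ (extChartAt I a).source) :
    HasMFDerivAt I 𝓘(ℝ, EuclideanSpace ℝ (Fin r)) (extChartAt I a) q (chartDeriv I a q) :=
  (mdifferentiableAt_extChartAt (by rwa [extChartAt_source] at hq)).hasMFDerivAt

theorem det_eq_det_matrix (D : EuclideanSpace ℝ (Fin r) →L[ℝ] EuclideanSpace ℝ (Fin r)) :
    D.det = (Matrix.of fun l j => D (EuclideanSpace.single j (1 : ℝ)) l :
      Matrix (Fin r) (Fin r) ℝ).det := by
  rw [ContinuousLinearMap.det, ← LinearMap.det_toMatrix (EuclideanSpace.basisFun (Fin r) ℝ).toBasis]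
  congr 1

/-- The integral of a density with support in the domains of two charts is the same in both. -/
theorem integral_density_chart_change {δ : ∀ q : W, (Fin r → TangentSpace I q) → ℝ}
    (hδ : ∀ q, IsDensity (δ q)) (φ : W → ℝ) {a a' : W}
    (ha : ∀ q, φ q ≠ 0 → q ∈ (extChartAt I a).source)
    (ha' : ∀ q, φ q ≠ 0 → q ∈ (extChartAt I a').source) :
    ∫ y in (extChartAt I a).target, φ ((extChartAt I a).symm y) *
        δ ((extChartAt I a).symm y) (chartFrame I a ((extChartAt I a).symm y)) =
      ∫ y in (extChartAt I a').target, φ ((extChartAt I a').symm y) *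
        δ ((extChartAt I a').symm y) (chartFrame I a' ((extChartAt I a').symm y)) := by
  set s : Set (EuclideanSpace ℝ (Fin r)) :=
    (extChartAt I a).target ∩ (extChartAt I a).symm ⁻¹' (extChartAt I a').source with hs
  set s' : Set (EuclideanSpace ℝ (Fin r)) :=
    (extChartAt I a').target ∩ (extChartAt I a').symm ⁻¹' (extChartAt I a).source with hs'
  set κ : EuclideanSpace ℝ (Fin r) → EuclideanSpace ℝ (Fin r) :=
    (extChartAt I a') ∘ (extChartAt I a).symm with hκ
  have hκs : κ '' s = s' := by
    ext z
    constructor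
    · rintro ⟨y, hy, rfl⟩
      have h1 : (extChartAt I a').symm (κ y) = (extChartAt I a).symm y :=
        (extChartAt I a').left_inv hy.2
      exact ⟨(extChartAt I a').map_source hy.2, by
        rw [mem_preimage, h1]; exact (extChartAt I a).map_target hy.1⟩
    · intro hz
      refine ⟨extChartAt I a ((extChartAt I a').symm z),
        ⟨(extChartAt I a).map_source hz.2, ?_⟩, ?_⟩
      · rw [mem_preimage, (extChartAt I a).left_inv hz.2]
        exact (extChartAt I a').map_target hz.1
      · rw [hκ, Function.comp_apply, (extChartAt I a).left_inv hz.2, (extChartAt I a').right_inv hz.1]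
  have hinj : InjOn κ s := by
    intro y hy z hz hyz
    have h1 := (extChartAt I a').injOn hy.2 hz.2 hyz
    rw [← (extChartAt I a).right_inv hy.1, h1, (extChartAt I a).right_inv hz.1]
  have hmeas : MeasurableSet s :=
    measurableSet_extChartAt_target_inter a (isOpen_extChartAt_source a')
  have hmeas' : MeasurableSet s' :=
    measurableSet_extChartAt_target_inter a' (isOpen_extChartAt_source a)
  set κ' : EuclideanSpace ℝ (Fin r) → EuclideanSpace ℝ (Fin r) →L[ℝ] EuclideanSpace ℝ (Fin r) :=
    fun y => (chartDeriv I a' ((extChartAt I a).symm y)).comp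
      (chartDeriv I a ((extChartAt I a).symm y)).inverse with hκ'
  have hderiv : ∀ y ∈ s, HasFDerivWithinAt κ (κ' y) s y := fun y hy =>
    (hasFDerivWithinAt_comp_extChartAt_symm hy.1 (hasMFDerivAt_chartDeriv hy.2)).mono
      (inter_subset_left.trans (extChartAt_target_subset_range a))
  have h1 : ∫ y in (extChartAt I a).target, φ ((extChartAt I a).symm y) *
        δ ((extChartAt I a).symm y) (chartFrame I a ((extChartAt I a).symm y)) =
      ∫ y in s, φ ((extChartAt I a).symm y) *
        δ ((extChartAt I a).symm y) (chartFrame I a ((extChartAt I a).symm y)) := by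
    -- Outside the overlap of the two charts `φ` vanishes, so only the part `s` where the transition
    -- map is defined matters.
    refine setIntegral_eq_of_subset_of_forall_sdiff_eq_zero (measurableSet_extChartAt_target a)
      inter_subset_left fun y hy => ?_
    have : φ ((extChartAt I a).symm y) = 0 := by
      by_contra h
      exact hy.2 ⟨hy.1, ha' _ h⟩
    rw [this, zero_mul]
  have h2 : ∫ y in (extChartAt I a').target, φ ((extChartAt I a').symm y) *
        δ ((extChartAt I a').symm y) (chartFrame I a' ((extChartAt I a').symm y)) =
      ∫ y in s', φ ((extChartAt I a').symm y) *
        δ ((extChartAt I a').symm y) (chartFrame I a' ((extChartAt I a').symm y)) := by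
    refine setIntegral_eq_of_subset_of_forall_sdiff_eq_zero (measurableSet_extChartAt_target a')
      inter_subset_left fun y hy => ?_
    have : φ ((extChartAt I a').symm y) = 0 := by
      by_contra h
      exact hy.2 ⟨hy.1, ha _ h⟩
    rw [this, zero_mul]
  rw [h1, h2, ← hκs, integral_image_eq_integral_abs_det_fderiv_smul volume hmeas hderiv hinj]
  refine setIntegral_congr_fun hmeas fun y hy => ?_
  have hκy : (extChartAt I a').symm (κ y) = (extChartAt I a).symm y :=
    (extChartAt I a').left_inv hy.2
  simp only [hκy, smul_eq_mul]
  -- The two coordinate frames differ by the Jacobian matrix of the transition map, so the density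
  -- produces the same factor as the change of variables.
  have hframe : chartFrame I a ((extChartAt I a).symm y) = fun j =>
      ∑ l, (Matrix.of fun l j => κ' y (EuclideanSpace.single j (1 : ℝ)) l :
        Matrix (Fin r) (Fin r) ℝ) l j • chartFrame I a' ((extChartAt I a).symm y) l := by
    funext j
    exact eq_sum_chartFrame hy.2 _
  have hcongr : ∀ q q' : W, q = q' →
      δ q (chartFrame I a' q) = δ q' (chartFrame I a' q') := by
    rintro q _ rfl; rfl
  rw [hcongr _ _ hκy]
  conv_lhs => rw [hframe, hδ, ← det_eq_det_matrix]
  ring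

end ChartFrame

/-! ### Linear algebra: adapted frames and their orientation. -/

section LinearAlgebra

variable {n m r p : ℕ} {V : Type*} [AddCommGroup V] [Module ℝ V]

/-- The quotient of the two frame determinants is the determinant of the class of `ν'` in the basis
`b`. Equal signs therefore give both independence modulo `B` and the same orientation. -/
theorem exists_basis_same_orientation [FiniteDimensional ℝ V] (hn : n = m + r)
    (ε : Module.Basis (Fin n) ℝ V) (B : Submodule ℝ V) (b : Module.Basis (Fin m) ℝ (V ⧸ B))
    (ν ν' : Fin m → V) (hν : ∀ i, b i = B.mkQ (ν i)) (u : Fin r → V) (hu : ∀ i, u i ∈ B)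
    (hpos : 0 < ε.det (fun i => Fin.append ν u (Fin.cast hn i)) *
      ε.det (fun i => Fin.append ν' u (Fin.cast hn i))) :
    ∃ b' : Module.Basis (Fin m) ℝ (V ⧸ B), (∀ i, b' i = B.mkQ (ν' i)) ∧
      b'.orientation = b.orientation := by
  obtain ⟨A, hdet, hAB, hAν⟩ := exists_linearMap_lift B b ν ν' hν
  have hframe := append_lift hn B ν ν' u hu A hAB hAν
  have h1 : ε.det (fun i => Fin.append ν' u (Fin.cast hn i)) =
      b.det (fun i => B.mkQ (ν' i)) * ε.det (fun i => Fin.append ν u (Fin.cast hn i)) := by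
    rw [hframe, ← hdet]
    exact ε.det_comp A _
  rw [h1] at hpos
  have hpos' : 0 < b.det (fun i => B.mkQ (ν' i)) := by
    have h2 : 0 ≤ ε.det (fun i => Fin.append ν u (Fin.cast hn i)) ^ 2 := sq_nonneg _
    by_contra hneg
    nlinarith
  obtain ⟨hli, hsp⟩ := (Module.Basis.is_basis_iff_det b).2 (Ne.isUnit hpos'.ne')
  refine ⟨Module.Basis.mk hli hsp.ge, fun i => by simp, ?_⟩
  rw [eq_comm, Module.Basis.orientation_eq_iff_det_pos, Module.Basis.coe_mk]
  exact hpos'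

open Classical in
/-- The fluxes through a submanifold in terms of components in an adapted frame. -/
theorem fluxForm_eq_frameComponent [FiniteDimensional ℝ V] (hn : n = p + r)
    (h : MultivectorDensity n (p + 1) V) (ε : Module.Basis (Fin n) ℝ V) (B : Submodule ℝ V)
    (o : Orientation ℝ (V ⧸ B) (Fin p)) (b : Module.Basis (Fin p) ℝ (V ⧸ B))
    (ν : Fin p → V) (hν : ∀ i, b i = B.mkQ (ν i)) (u : Fin r → V) (hu : ∀ i, u i ∈ B)
    (hB : ∀ x ∈ B, ∃ t : Fin r → ℝ, x = ∑ i, t i • u i) (A : Matrix (Fin n) (Fin n) ℝ)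
    (hAl : ∀ j a, A j (frameEquiv hn (Sum.inl a)) = ε.coord j (ν a))
    (hAr : ∀ j i, A j (frameEquiv hn (Sum.inr i)) = ε.coord j (u i)) (hA : A.det ≠ 0)
    (α : Module.Dual ℝ V) (i : Fin r) (hα : ∀ l, α (u l) = if i = l then 1 else 0) :
    fluxForm hn h B o u α = (if b.orientation = o then 1 else -1) *
      frameComponent A (fun I => h.toFun ε (fun s => ε.coord (I s)))
        (Fin.cons (frameEquiv hn (Sum.inr i)) (fun a => frameEquiv hn (Sum.inl a))) := by
  -- The rows of `A⁻¹` are the coframe dual to the adapted frame formed by the columns of `A`.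
  set η : Fin n → Module.Dual ℝ V := fun J => ∑ j, A⁻¹ J j • ε.coord j with hη
  have hηε : ∀ J j, η J (ε j) = A⁻¹ J j := by
    intro J j
    simp [hη, Finsupp.single_apply]
  have hinv : A⁻¹ * A = 1 := Matrix.nonsing_inv_mul _ (Ne.isUnit hA)
  have hην : ∀ J a, η J (ν a) = (1 : Matrix (Fin n) (Fin n) ℝ) J (frameEquiv hn (Sum.inl a)) := by
    intro J a
    rw [← hinv, Matrix.mul_apply]
    simp [hη, hAl]
  have hηu : ∀ J a, η J (u a) = (1 : Matrix (Fin n) (Fin n) ℝ) J (frameEquiv hn (Sum.inr a)) := by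
    intro J a
    rw [← hinv, Matrix.mul_apply]
    simp [hη, hAr]
  -- `α` and this member of the coframe have the same values on the tangential vectors, hence on
  -- `B`.
  have h1 : fluxForm hn h B o u α = fluxForm hn h B o u (η (frameEquiv hn (Sum.inr i))) := by
    refine fluxForm_congr _ _ _ _ _ _ _ fun x hx => ?_
    obtain ⟨t, rfl⟩ := hB x hx
    simp only [map_sum, map_smul, hα, hηu, Matrix.one_apply, (frameEquiv hn).injective.eq_iff,
      Sum.inr.injEq]
  have h2 : ∀ a, b.coord a ∘ₗ B.mkQ = η (frameEquiv hn (Sum.inl a)) := by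
    intro a
    rw [dual_eq_sum_coord B b ν hν (η (frameEquiv hn (Sum.inl a)))]
    · simp [hην, Matrix.one_apply, (frameEquiv hn).injective.eq_iff]
    · intro x hx
      obtain ⟨t, rfl⟩ := hB x hx
      simp [hηu, (frameEquiv hn).injective.eq_iff]
  have h3 : ε.det (fun i => Fin.append ν u (Fin.cast hn i)) = A.det := by
    rw [Module.Basis.det_apply]
    congr 1
    ext j l
    obtain ⟨l, rfl⟩ := (frameEquiv hn).surjective l
    rw [Module.Basis.toMatrix_apply]
    rcases l with l | l
    · rw [append_frameEquiv_inl, hAl]; rfl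
    · rw [append_frameEquiv_inr, hAr]; rfl
  rw [h1, fluxForm_apply, orientedPairing_eq hn _ B o b ν hν u hu]
  unfold basisPairing
  rw [MultivectorDensity.contract_apply, h.toFun_eq_sum ε, h3, frameComponent, multiSum]
  congr 2
  refine Finset.sum_congr rfl fun I _ => ?_
  congr 1
  refine Finset.prod_congr rfl fun s _ => ?_
  refine Fin.cases ?_ (fun s => ?_) s
  · simp only [Fin.cons_zero, hηε]
  · simp only [Fin.cons_succ, h2, hηε]

end LinearAlgebra

/-! ### Components of a multivector density in the charts of `M`. -/

section Coordinates

variable {n m : ℕ} {M : Type*} [TopologicalSpace M] [ChartedSpace (EuclideanSpace ℝ (Fin n)) M]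

instance finiteDimensional_tangentSpace (x : M) : FiniteDimensional ℝ (TangentSpace (𝓡 n) x) :=
  inferInstanceAs (FiniteDimensional ℝ (EuclideanSpace ℝ (Fin n)))

theorem isAntisymm_component (H : ∀ x : M, MultivectorDensity n m (TangentSpace (𝓡 n) x))
    (e : OpenPartialHomeomorph M (EuclideanSpace ℝ (Fin n))) (y : EuclideanSpace ℝ (Fin n)) :
    IsAntisymm (fun I => component H e I y) := by
  intro I i j hij
  exact ((H (e.symm y)).toFun (coordVector e y)).map_swap (fun a => coordCovector e y (I a)) hij

variable [IsManifold (𝓡 n) ∞ M]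

theorem exists_chartBasis {a x : M} (hx : x ∈ (extChartAt (𝓡 n) a).source) :
    ∃ ε : Module.Basis (Fin n) ℝ (TangentSpace (𝓡 n) x),
      (⇑ε = chartFrame (𝓡 n) a x) ∧ ∀ l, ε.coord l = chartCoframe (𝓡 n) a x l := by
  obtain ⟨e, he⟩ := isInvertible_chartDeriv hx
  set ε := (EuclideanSpace.basisFun (Fin n) ℝ).toBasis.map e.symm.toLinearEquiv with hε
  have h1 : ⇑ε = chartFrame (𝓡 n) a x := by
    funext l
    rw [chartFrame, ← he, ContinuousLinearMap.inverse_equiv]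
    simp only [hε, Module.Basis.map_apply, OrthonormalBasis.coe_toBasis,
      EuclideanSpace.basisFun_apply]
    rfl
  refine ⟨ε, h1, fun l => ?_⟩
  refine ε.ext fun j => ?_
  rw [h1, chartCoframe_chartFrame hx, ← h1]
  simp [Finsupp.single_apply, eq_comm]

theorem coordVector_eq_chartFrame {a : M} {y : EuclideanSpace ℝ (Fin n)}
    (hy : y ∈ (chartAt (EuclideanSpace ℝ (Fin n)) a).target) :
    coordVector (chartAt (EuclideanSpace ℝ (Fin n)) a) y =
      chartFrame (𝓡 n) a ((chartAt (EuclideanSpace ℝ (Fin n)) a).symm y) := by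
  have hy' : y ∈ (extChartAt (𝓡 n) a).target := by simpa [extChartAt_target] using hy
  have h1 := mfderivWithin_symm_eq_inverse hy'
  rw [ModelWithCorners.range_eq_univ, mfderivWithin_univ] at h1
  funext i
  exact congrArg (fun L => L (EuclideanSpace.single i (1 : ℝ))) h1

theorem component_eq (H : ∀ x : M, MultivectorDensity n m (TangentSpace (𝓡 n) x)) {a x : M}
    (hx : x ∈ (extChartAt (𝓡 n) a).source) (I : Fin m → Fin n) :
    component H (chartAt (EuclideanSpace ℝ (Fin n)) a) I (extChartAt (𝓡 n) a x) =
      (H x).toFun (chartFrame (𝓡 n) a x) (fun s => chartCoframe (𝓡 n) a x (I s)) := by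
  -- The tangent space depends on the point. With `y` as the variable, `x` is replaced by definition
  -- instead of transported along an equality.
  have key : ∀ y, y ∈ (chartAt (EuclideanSpace ℝ (Fin n)) a).target →
      ∀ x, (chartAt (EuclideanSpace ℝ (Fin n)) a).symm y = x →
      component H (chartAt (EuclideanSpace ℝ (Fin n)) a) I y =
      (H x).toFun (chartFrame (𝓡 n) a x) (fun s => chartCoframe (𝓡 n) a x (I s)) := by
    rintro y hy _ rfl
    rw [component, coordVector_eq_chartFrame hy]
    rfl
  rw [extChartAt_source] at hx
  exact key _ ((chartAt (EuclideanSpace ℝ (Fin n)) a).map_source hx) x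
    ((chartAt (EuclideanSpace ℝ (Fin n)) a).left_inv hx)

end Coordinates

/-! ### Linear algebra: nondegeneracy of adapted frames. -/

section LinearAlgebra

variable {n m r p : ℕ} {V : Type*} [AddCommGroup V] [Module ℝ V]

theorem det_append_ne_zero (hn : n = m + r)
    (ε : Module.Basis (Fin n) ℝ V) (B : Submodule ℝ V) (b : Module.Basis (Fin m) ℝ (V ⧸ B))
    (ν : Fin m → V) (hν : ∀ i, b i = B.mkQ (ν i)) (u : Fin r → V) (hu : ∀ i, u i ∈ B)
    (hli : LinearIndependent ℝ u) : ε.det (fun i => Fin.append ν u (Fin.cast hn i)) ≠ 0 := by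
  have h1 : LinearIndependent ℝ (fun i => Fin.append ν u (Fin.cast hn i)) := by
    rw [Fintype.linearIndependent_iff]
    intro g hg
    rw [← (frameEquiv hn).sum_comp, Fintype.sum_sum_type] at hg
    simp only [append_frameEquiv_inl, append_frameEquiv_inr] at hg
    have h2 := congrArg B.mkQ hg
    have h3 : B.mkQ (∑ x, g (frameEquiv hn (Sum.inr x)) • u x) = 0 :=
      (mkQ_apply_eq_zero B).2 (B.sum_mem fun i _ => B.smul_mem _ (hu i))
    rw [map_add, h3, add_zero, map_zero, map_sum] at h2
    simp only [map_smul, ← hν] at h2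
    have h4 := Fintype.linearIndependent_iff.1 b.linearIndependent _ h2
    simp only [h4, zero_smul, Finset.sum_const_zero, zero_add] at hg
    have h5 := Fintype.linearIndependent_iff.1 hli _ hg
    intro i
    obtain ⟨i, rfl⟩ := (frameEquiv hn).surjective i
    rcases i with i | i
    · exact h4 i
    · exact h5 i
  have hfd : FiniteDimensional ℝ V := ε.finiteDimensional_of_finite
  have hcard : Fintype.card (Fin n) = Module.finrank ℝ V := by
    rw [Module.finrank_eq_card_basis ε]
  have h2 := h1.span_eq_top_of_card_eq_finrank' hcard
  exact ((Module.Basis.is_basis_iff_det ε).1 ⟨h1, h2⟩).ne_zero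

end LinearAlgebra

/-! ### The vector density induced on a cooriented immersed manifold. -/

section Flux

variable {n r p : ℕ} {H' : Type*} [TopologicalSpace H']
  {I : ModelWithCorners ℝ (EuclideanSpace ℝ (Fin r)) H'} {W : Type*} [TopologicalSpace W]
  [ChartedSpace H' W]
  {M : Type*} [TopologicalSpace M] [ChartedSpace (EuclideanSpace ℝ (Fin n)) M]
  [IsManifold (𝓡 n) ∞ M]

/-- A left inverse of the differential extends covectors of `W` to covectors of `M`. The extension
is not canonical, but `flux_eq` shows that the flux does not see the choice. -/
theorem exists_leftInverse_mfderiv {m : ℕ} (Y : CoorientedImmersion I W n M m) (q : W) :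
    ∃ g : TangentSpace (𝓡 n) (Y.toFun q) →ₗ[ℝ] TangentSpace I q,
      g ∘ₗ (mfderiv I (𝓡 n) Y.toFun q).toLinearMap = LinearMap.id :=
  LinearMap.exists_leftInverse_of_injective (mfderiv I (𝓡 n) Y.toFun q).toLinearMap
    (LinearMap.ker_eq_bot.2 (Y.immersive q))

/-- The vector density induced by a multivector density on a cooriented immersed submanifold:
its value on `u₁ ∧ ⋯ ∧ uᵣ`, paired with a covector. -/
def flux (hn : n = p + r) (H : MultivectorDensityField n (p + 1) M)
    (Y : CoorientedImmersion I W n M p) (q : W) (u : Fin r → TangentSpace I q) :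
    (TangentSpace I q →ₗ[ℝ] ℝ) →ₗ[ℝ] ℝ :=
  (fluxForm hn (H.toFun (Y.toFun q)) (tangentImage I Y.toFun q) (Y.coor q)
    (fun i => mfderiv I (𝓡 n) Y.toFun q (u i))) ∘ₗ
    LinearMap.lcomp ℝ ℝ (exists_leftInverse_mfderiv Y q).choose

variable (hn : n = p + r) (H : MultivectorDensityField n (p + 1) M)
    (Y : CoorientedImmersion I W n M p)

theorem flux_eq (q : W) (u : Fin r → TangentSpace I q) (α : TangentSpace I q →ₗ[ℝ] ℝ)
    (β : Module.Dual ℝ (TangentSpace (𝓡 n) (Y.toFun q)))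
    (hβ : ∀ v, β (mfderiv I (𝓡 n) Y.toFun q v) = α v) :
    flux hn H Y q u α = fluxForm hn (H.toFun (Y.toFun q)) (tangentImage I Y.toFun q) (Y.coor q)
      (fun i => mfderiv I (𝓡 n) Y.toFun q (u i)) β := by
  refine fluxForm_congr _ _ _ _ _ _ _ ?_
  rintro _ ⟨v, rfl⟩
  have h1 := (exists_leftInverse_mfderiv Y q).choose_spec
  have h2 := congrArg (fun L => L v) h1
  exact (congrArg α h2).trans (hβ v).symm

theorem isDensity_flux (q : W) (α : TangentSpace I q →ₗ[ℝ] ℝ) :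
    IsDensity (fun u => flux hn H Y q u α) := by
  intro u C
  obtain ⟨ε, -, -⟩ := exists_chartBasis (mem_extChartAt_source (I := 𝓡 n) (Y.toFun q))
  have h1 := orientedPairing_mul hn ((H.toFun (Y.toFun q)).contract
    (α ∘ₗ (exists_leftInverse_mfderiv Y q).choose)) ε (tangentImage I Y.toFun q) (Y.coor q)
    (fun i => mfderiv I (𝓡 n) Y.toFun q (u i)) C
  refine Eq.trans ?_ h1
  change fluxForm _ _ _ _ _ _ = _
  rw [fluxForm_apply]
  congr 1
  funext j
  rw [map_sum]
  exact Finset.sum_congr rfl fun l _ => map_smul _ _ _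

/-- The components of the induced vector density in the chart at `a`. -/
def fluxComponent (a : W) (i : Fin r) (q : W) : ℝ :=
  flux hn H Y q (chartFrame I a q) (chartCoframe I a q i)

/-- The immersion read in the charts at `a` and at its image. -/
def chartExpr (a : W) : EuclideanSpace ℝ (Fin r) → EuclideanSpace ℝ (Fin n) :=
  (extChartAt (𝓡 n) (Y.toFun a) ∘ Y.toFun) ∘ (extChartAt I a).symm

/-- The matrix of an adapted frame, with constant normal vectors, in charts. -/
def frameMatrix (a : W) (ν : Fin p → EuclideanSpace ℝ (Fin n)) (y : EuclideanSpace ℝ (Fin r)) :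
    Matrix (Fin n) (Fin n) ℝ :=
  Matrix.of fun j l => Sum.elim (fun s => ν s j)
    (fun i => fderivWithin ℝ (chartExpr Y a) (range I) y (EuclideanSpace.single i (1 : ℝ)) j)
    ((frameEquiv hn).symm l)

variable [IsManifold I ∞ W]

variable {H Y}

theorem contDiffWithinAt_chartExpr {a : W} {y : EuclideanSpace ℝ (Fin r)}
    (hy : y ∈ (extChartAt I a).target)
    (hfy : Y.toFun ((extChartAt I a).symm y) ∈ (extChartAt (𝓡 n) (Y.toFun a)).source) :
    ContDiffWithinAt ℝ ∞ (chartExpr Y a) (range I) y := by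
  have h1 := (contMDiffAt_iff_of_mem_source (x := a) (y := Y.toFun a)
    (by simpa using (extChartAt I a).map_target hy) (by simpa using hfy)).1
    (Y.smooth ((extChartAt I a).symm y))
  have h2 := h1.2
  rwa [(extChartAt I a).right_inv hy] at h2

theorem contDiffWithinAt_frameMatrix {a : W} {y : EuclideanSpace ℝ (Fin r)}
    (hy : y ∈ (extChartAt I a).target)
    (hfy : Y.toFun ((extChartAt I a).symm y) ∈ (extChartAt (𝓡 n) (Y.toFun a)).source)
    (ν : Fin p → EuclideanSpace ℝ (Fin n)) (i j : Fin n) :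
    ContDiffWithinAt ℝ ((1 : ℕ∞) : ℕ∞ω) (fun y => frameMatrix hn Y a ν y i j) (range I) y := by
  obtain ⟨j, rfl⟩ := (frameEquiv hn).surjective j
  simp only [frameMatrix, Matrix.of_apply, Equiv.symm_apply_apply]
  rcases j with j | j
  · exact contDiffWithinAt_const
  · have h1 : ContDiffWithinAt ℝ ((1 : ℕ∞) : ℕ∞ω) (fderivWithin ℝ (chartExpr Y a) (range I))
        (range I) y :=
      (contDiffWithinAt_chartExpr hy hfy).fderivWithin_right I.uniqueDiffOn
        (by norm_cast) (extChartAt_target_subset_range a hy)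
    exact (EuclideanSpace.proj (𝕜 := ℝ) i).contDiff.comp_contDiffWithinAt
      (h1.clm_apply contDiffWithinAt_const)

theorem contDiffWithinAt_component {a : W} {y : EuclideanSpace ℝ (Fin r)}
    (hy : y ∈ (extChartAt I a).target)
    (hfy : Y.toFun ((extChartAt I a).symm y) ∈ (extChartAt (𝓡 n) (Y.toFun a)).source)
    (J : Fin (p + 1) → Fin n) :
    ContDiffWithinAt ℝ ((1 : ℕ∞) : ℕ∞ω) (fun y => component H.toFun
      (chartAt (EuclideanSpace ℝ (Fin n)) (Y.toFun a)) J (chartExpr Y a y)) (range I) y := by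
  have h1 : chartExpr Y a y ∈ (chartAt (EuclideanSpace ℝ (Fin n)) (Y.toFun a)).target := by
    have := (extChartAt (𝓡 n) (Y.toFun a)).map_source hfy
    simpa [extChartAt_target, chartExpr] using this
  have h2 := (H.smooth _ (chart_mem_atlas _ (Y.toFun a)) J).contDiffAt
    ((chartAt (EuclideanSpace ℝ (Fin n)) (Y.toFun a)).open_target.mem_nhds h1)
  exact (h2.comp_contDiffWithinAt y (contDiffWithinAt_chartExpr hy hfy)).of_le (by norm_cast)

theorem fderivWithin_chartExpr {a : W} {y : EuclideanSpace ℝ (Fin r)}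
    (hy : y ∈ (extChartAt I a).target)
    (hfy : Y.toFun ((extChartAt I a).symm y) ∈ (extChartAt (𝓡 n) (Y.toFun a)).source)
    (i : Fin r) :
    fderivWithin ℝ (chartExpr Y a) (range I) y (EuclideanSpace.single i (1 : ℝ)) =
      chartDeriv (𝓡 n) (Y.toFun a) (Y.toFun ((extChartAt I a).symm y))
        (mfderiv I (𝓡 n) Y.toFun ((extChartAt I a).symm y)
          (chartFrame I a ((extChartAt I a).symm y) i)) := by
  have h1 := (Y.smooth.mdifferentiable (by simp) ((extChartAt I a).symm y)).hasMFDerivAt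
  have h2 := (hasMFDerivAt_chartDeriv hfy).comp _ h1
  exact fderivWithin_comp_extChartAt_symm hy h2 i

end Flux

/-! ### Local expression of the induced vector density. -/

section Flux

variable {n r p : ℕ} {H' : Type*} [TopologicalSpace H']
  {I : ModelWithCorners ℝ (EuclideanSpace ℝ (Fin r)) H'} {W : Type*} [TopologicalSpace W]
  [ChartedSpace H' W] [IsManifold I ∞ W]
  {M : Type*} [TopologicalSpace M] [ChartedSpace (EuclideanSpace ℝ (Fin n)) M]
  [IsManifold (𝓡 n) ∞ M]

/-- Near `f a` the trivialization of the tangent bundle acts on fibres as the differential of the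
chart. It turns continuity in the total space into continuity of coordinate vectors. -/
theorem continuousAt_chartDeriv_of_continuousOn {f : W → M} (hf : Continuous f) {U : Set W} {a : W}
    (hU : U ∈ 𝓝 a) {ν : ∀ q, TangentSpace (𝓡 n) (f q)}
    (hν : ContinuousOn (fun q => (⟨f q, ν q⟩ : TangentBundle (𝓡 n) M)) U) :
    ContinuousAt (fun q => chartDeriv (𝓡 n) (f a) (f q) (ν q)) a := by
  set e := trivializationAt (EuclideanSpace ℝ (Fin n)) (TangentSpace (𝓡 n) : M → Type _) (f a)
    with he
  have h1 : ContinuousAt (fun q => (⟨f q, ν q⟩ : TangentBundle (𝓡 n) M)) a := hν.continuousAt hU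
  have hmem : (⟨f a, ν a⟩ : TangentBundle (𝓡 n) M) ∈ e.source := by
    rw [e.mem_source]
    exact mem_baseSet_trivializationAt _ _ _
  have h2 : ContinuousAt (fun q => (e (⟨f q, ν q⟩ : TangentBundle (𝓡 n) M)).2) a :=
    continuous_snd.continuousAt.comp
      (ContinuousAt.comp (f := fun q => (⟨f q, ν q⟩ : TangentBundle (𝓡 n) M))
        (e.continuousOn.continuousAt (e.open_source.mem_nhds hmem)) h1)
  refine h2.congr ?_
  filter_upwards [hf.continuousAt.preimage_mem_nhds
    ((chartAt (EuclideanSpace ℝ (Fin n)) (f a)).open_source.mem_nhds (mem_chart_source _ (f a)))]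
    with q hq
  have h3 := TangentBundle.continuousLinearMapAt_trivializationAt (I := 𝓡 n) hq
  have h4 : chartDeriv (𝓡 n) (f a) (f q) (ν q) = e.continuousLinearMapAt ℝ (f q) (ν q) := by
    rw [h3]; rfl
  rw [h4, Bundle.Trivialization.continuousLinearMapAt_apply,
    Bundle.Trivialization.coe_linearMapAt_of_mem]
  simpa [he] using hq

variable (hn : n = p + r) (H : MultivectorDensityField n (p + 1) M)
    (Y : CoorientedImmersion I W n M p)

theorem linearIndependent_mfderiv_chartFrame {a q : W} (hq : q ∈ (extChartAt I a).source) :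
    LinearIndependent ℝ (fun i => mfderiv I (𝓡 n) Y.toFun q (chartFrame I a q i)) := by
  rw [Fintype.linearIndependent_iff]
  intro g hg i
  have h1 : mfderiv I (𝓡 n) Y.toFun q (∑ i, g i • chartFrame I a q i) = 0 := by
    rw [map_sum]
    exact (Finset.sum_congr rfl fun i _ => map_smul _ _ _).trans hg
  have h2 : ∑ i, g i • chartFrame I a q i = 0 := Y.immersive q (h1.trans (map_zero _).symm)
  have h3 := congrArg (chartCoframe I a q i) h2
  simpa [chartCoframe_chartFrame hq] using h3

/-- Near any point the components of the induced vector density are, up to a constant sign, those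
of the multivector density in an adapted frame with constant normal vectors. -/
theorem exists_fluxComponent_eq (a : W) : ∃ N : Set W, IsOpen N ∧ a ∈ N ∧
    N ⊆ (extChartAt I a).source ∧ ∃ (c : ℝ) (ν : Fin p → EuclideanSpace ℝ (Fin n)),
      ∀ y ∈ (extChartAt I a).target, (extChartAt I a).symm y ∈ N →
        Y.toFun ((extChartAt I a).symm y) ∈ (extChartAt (𝓡 n) (Y.toFun a)).source ∧
        (frameMatrix hn Y a ν y).det ≠ 0 ∧
        ∀ i, fluxComponent hn H Y a i ((extChartAt I a).symm y) =
          c * frameComponent (frameMatrix hn Y a ν y) (fun J => component H.toFun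
            (chartAt (EuclideanSpace ℝ (Fin n)) (Y.toFun a)) J (chartExpr Y a y))
            (Fin.cons (frameEquiv hn (Sum.inr i)) (fun s => frameEquiv hn (Sum.inl s))) := by
  obtain ⟨U, hU, ν, b, hν, hb, hor⟩ := Y.continuous_coor a
  have haU : a ∈ U := mem_of_mem_nhds hU
  set x₀ := Y.toFun a with hx₀
  -- The given normal frame is only continuous, so it is frozen at `a`. The matrix `A` uses the
  -- frozen vectors, `A'` the original ones, and they coincide at `a`.
  set c₀ : Fin p → EuclideanSpace ℝ (Fin n) := fun s => chartDeriv (𝓡 n) x₀ x₀ (ν s a) with hc₀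
  set A : W → Matrix (Fin n) (Fin n) ℝ := fun q => frameMatrix hn Y a c₀ (extChartAt I a q) with hA
  set A' : W → Matrix (Fin n) (Fin n) ℝ := fun q => Matrix.of fun j l =>
    Sum.elim (fun s => chartDeriv (𝓡 n) x₀ (Y.toFun q) (ν s q) j)
      (fun i => A q j (frameEquiv hn (Sum.inr i))) ((frameEquiv hn).symm l) with hA'
  have hAl : ∀ q j s, A q j (frameEquiv hn (Sum.inl s)) = c₀ s j := by
    intro q j s
    simp [hA, frameMatrix]
  have hA'l : ∀ q j s, A' q j (frameEquiv hn (Sum.inl s)) =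
      chartDeriv (𝓡 n) x₀ (Y.toFun q) (ν s q) j := by
    intro q j s
    simp [hA']
  have hA'r : ∀ q j i, A' q j (frameEquiv hn (Sum.inr i)) = A q j (frameEquiv hn (Sum.inr i)) := by
    intro q j i
    simp [hA']
  have hAr : ∀ q, q ∈ (extChartAt I a).source → Y.toFun q ∈ (extChartAt (𝓡 n) x₀).source →
      ∀ j i, A q j (frameEquiv hn (Sum.inr i)) = chartDeriv (𝓡 n) x₀ (Y.toFun q)
        (mfderiv I (𝓡 n) Y.toFun q (chartFrame I a q i)) j := by
    intro q hq hfq j i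
    have h1 : ∀ q', q' = q → ∀ hq' : extChartAt I a q = extChartAt I a q',
        (extChartAt I a).symm (extChartAt I a q) = q' →
        A q j (frameEquiv hn (Sum.inr i)) = chartDeriv (𝓡 n) x₀ (Y.toFun q')
        (mfderiv I (𝓡 n) Y.toFun q' (chartFrame I a q' i)) j := by
      rintro _ hqq' - rfl
      have h2 := fderivWithin_chartExpr (Y := Y) ((extChartAt I a).map_source hq)
        (by rw [(extChartAt I a).left_inv hq]; exact hfq) i
      simp only [hA, frameMatrix, Matrix.of_apply, Equiv.symm_apply_apply, Sum.elim_inr]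
      rw [h2]
    exact h1 q rfl rfl ((extChartAt I a).left_inv hq)
  have haS : a ∈ (extChartAt I a).source := mem_extChartAt_source a
  have hfaS : Y.toFun a ∈ (extChartAt (𝓡 n) x₀).source := mem_extChartAt_source x₀
  have hfaS' : Y.toFun ((extChartAt I a).symm (extChartAt I a a)) ∈
      (extChartAt (𝓡 n) x₀).source := by
    rw [(extChartAt I a).left_inv haS]; exact hfaS
  have hAc : ∀ i j, ContinuousAt (fun q => A q i j) a := by
    intro i j
    have h1 := (contDiffWithinAt_frameMatrix hn (Y := Y) ((extChartAt I a).map_source haS) hfaS'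
      c₀ i j).continuousWithinAt
    have h2 : Filter.Tendsto (extChartAt I a) (𝓝 a) (𝓝[range I] (extChartAt I a a)) := by
      rw [nhdsWithin]
      refine Filter.tendsto_inf.2 ⟨continuousAt_extChartAt a, Filter.tendsto_principal.2 ?_⟩
      filter_upwards [extChartAt_source_mem_nhds (I := I) a] with q hq
      exact extChartAt_target_subset_range a ((extChartAt I a).map_source hq)
    exact h1.tendsto.comp h2
  have hA'c : ∀ i j, ContinuousAt (fun q => A' q i j) a := by
    intro i j
    obtain ⟨j, rfl⟩ := (frameEquiv hn).surjective j
    rcases j with j | j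
    · simp only [hA'l]
      exact ((EuclideanSpace.proj (𝕜 := ℝ) i).continuous.continuousAt).comp
        (continuousAt_chartDeriv_of_continuousOn Y.smooth.continuous hU (hν j))
    · simp only [hA'r]
      exact hAc _ _
  have hdet_cont : ∀ B : W → Matrix (Fin n) (Fin n) ℝ, (∀ i j, ContinuousAt (fun q => B q i j) a) →
      ContinuousAt (fun q => (B q).det) a := by
    intro B hB
    simp only [Matrix.det_apply']
    exact tendsto_finsetSum _ fun σ _ => tendsto_const_nhds.mul (tendsto_finsetProd _
      fun i _ => hB _ _)
  have hdet_eq : ∀ q, q ∈ (extChartAt I a).source → Y.toFun q ∈ (extChartAt (𝓡 n) x₀).source →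
      ∀ (ε : Module.Basis (Fin n) ℝ (TangentSpace (𝓡 n) (Y.toFun q))),
      (∀ l, ε.coord l = chartCoframe (𝓡 n) x₀ (Y.toFun q) l) →
      (∀ μ : Fin p → TangentSpace (𝓡 n) (Y.toFun q), ∀ B : Matrix (Fin n) (Fin n) ℝ,
        (∀ j s, B j (frameEquiv hn (Sum.inl s)) = chartDeriv (𝓡 n) x₀ (Y.toFun q) (μ s) j) →
        (∀ j i, B j (frameEquiv hn (Sum.inr i)) = A q j (frameEquiv hn (Sum.inr i))) →
        ε.det (fun i => Fin.append μ (fun i => mfderiv I (𝓡 n) Y.toFun q (chartFrame I a q i))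
          (Fin.cast hn i)) = B.det) := by
    intro q hq hfq ε hε μ B hBl hBr
    rw [Module.Basis.det_apply]
    congr 1
    ext j l
    obtain ⟨l, rfl⟩ := (frameEquiv hn).surjective l
    rw [Module.Basis.toMatrix_apply, ← Module.Basis.coord_apply, hε]
    rcases l with l | l
    · rw [append_frameEquiv_inl, hBl]; rfl
    · rw [append_frameEquiv_inr, hBr, hAr q hq hfq]; rfl
  have hmem : ∀ q i, mfderiv I (𝓡 n) Y.toFun q (chartFrame I a q i) ∈
      tangentImage I Y.toFun q := fun q i => ⟨_, rfl⟩
  have hA'a : A' a = A a := by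
    ext i j
    obtain ⟨j, rfl⟩ := (frameEquiv hn).surjective j
    rcases j with j | j
    · rw [hA'l, hAl]
    · rw [hA'r]
  have hdeta : (A' a).det ≠ 0 := by
    obtain ⟨ε, -, hε⟩ := exists_chartBasis hfaS
    rw [← hdet_eq a haS hfaS ε hε (fun s => ν s a) (A' a) (fun j s => hA'l a j s)
      (fun j i => hA'r a j i)]
    exact det_append_ne_zero hn ε (tangentImage I Y.toFun a) (b a haU) _ (hb a haU) _ (hmem a)
      (linearIndependent_mfderiv_chartFrame Y haS)
  -- The product is a nonzero square at `a`. Where it stays positive, the frozen and the original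
  -- frames induce the same orientation of the normal space.
  have hpos : ∀ᶠ q in 𝓝 a, 0 < (A' q).det * (A q).det := by
    refine ((hdet_cont A' hA'c).mul (hdet_cont A hAc)).eventually (lt_mem_nhds ?_)
    rw [hA'a] at hdeta
    change 0 < (A' a).det * (A a).det
    rw [hA'a]
    exact mul_self_pos.2 hdeta
  have hfsrc : ∀ᶠ q in 𝓝 a, Y.toFun q ∈ (extChartAt (𝓡 n) x₀).source :=
    Y.smooth.continuous.continuousAt.preimage_mem_nhds (extChartAt_source_mem_nhds x₀)
  have hevent : ∀ᶠ q in 𝓝 a, q ∈ U ∧ q ∈ (extChartAt I a).source ∧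
      Y.toFun q ∈ (extChartAt (𝓡 n) x₀).source ∧ 0 < (A' q).det * (A q).det :=
    Filter.Eventually.and hU (Filter.Eventually.and (extChartAt_source_mem_nhds (I := I) a)
      (hfsrc.and hpos))
  obtain ⟨N, hN, hNo, haN⟩ := eventually_nhds_iff.1 hevent
  -- Continuity of the coorientation makes the sign of the frame constant on `U`.
  have hsign : ∃ c : ℝ, ∀ q (hq : q ∈ U), ∀ b' : Module.Basis (Fin p) ℝ
      (NormalSpace (n := n) I Y.toFun q), b'.orientation = (b q hq).orientation →
      open Classical in (if b'.orientation = Y.coor q then (1 : ℝ) else -1) = c := by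
    rcases hor with h | h
    · refine ⟨1, fun q hq b' hb' => if_pos ?_⟩
      rw [hb', h q hq]
    · refine ⟨-1, fun q hq b' hb' => if_neg ?_⟩
      rw [hb', h q hq]
      exact (Module.Ray.ne_neg_self (Y.coor q)).symm
  obtain ⟨c, hc⟩ := hsign
  refine ⟨N, hNo, haN, fun q hq => (hN q hq).2.1, c, c₀, ?_⟩
  intro y hy hyN
  obtain ⟨hqU, hq, hfq, hdet⟩ := hN _ hyN
  have hAy : frameMatrix hn Y a c₀ y = A ((extChartAt I a).symm y) := by
    simp only [hA, (extChartAt I a).right_inv hy]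
  have hdetA : (A ((extChartAt I a).symm y)).det ≠ 0 := fun h => by
    rw [h, mul_zero] at hdet; exact lt_irrefl _ hdet
  refine ⟨hfq, hAy ▸ hdetA, fun i => ?_⟩
  have hcy : chartExpr Y a y = extChartAt (𝓡 n) x₀ (Y.toFun ((extChartAt I a).symm y)) := rfl
  rw [hAy, hcy]
  generalize (extChartAt I a).symm y = q at hyN hqU hq hfq hdet hdetA
  simp only [component_eq _ hfq]
  obtain ⟨ε, hε, hεc⟩ := exists_chartBasis hfq
  set ν' : Fin p → TangentSpace (𝓡 n) (Y.toFun q) := fun s =>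
    (chartDeriv (𝓡 n) x₀ (Y.toFun q)).inverse (c₀ s) with hν'
  have hν'c : ∀ s, chartDeriv (𝓡 n) x₀ (Y.toFun q) (ν' s) = c₀ s := fun s =>
    chartDeriv_inverse_apply hfq _
  obtain ⟨b', hb', hb'o⟩ := exists_basis_same_orientation hn ε (tangentImage I Y.toFun q) (b q hqU)
    (fun s => ν s q) ν' (hb q hqU) (fun i => mfderiv I (𝓡 n) Y.toFun q (chartFrame I a q i))
    (hmem q) (by
      rw [hdet_eq q hq hfq ε hεc (fun s => ν s q) (A' q) (fun j s => hA'l q j s)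
          (fun j i => hA'r q j i),
        hdet_eq q hq hfq ε hεc ν' (A q) (fun j s => by rw [hAl, hν'c]) (fun j i => rfl)]
      exact hdet)
  have hinv : ∀ l, ∃ β : Module.Dual ℝ (TangentSpace (𝓡 n) (Y.toFun q)),
      ∀ v, β (mfderiv I (𝓡 n) Y.toFun q v) = chartCoframe I a q l v := by
    intro l
    obtain ⟨g, hg⟩ := exists_leftInverse_mfderiv Y q
    exact ⟨chartCoframe I a q l ∘ₗ g, fun v =>
      congrArg (chartCoframe I a q l) (congrArg (fun L => L v) hg)⟩
  obtain ⟨β, hβ⟩ := hinv i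
  rw [fluxComponent, flux_eq hn H Y q _ _ β hβ,
    fluxForm_eq_frameComponent hn _ ε (tangentImage I Y.toFun q) (Y.coor q) b' ν' hb' _ (hmem q)
      ?_ (A q) ?_ ?_ hdetA β i ?_, hc q hqU b' hb'o]
  · congr 2
    funext J
    rw [hε]
    congr 1
    funext s
    exact hεc _
  · rintro _ ⟨v, rfl⟩
    refine ⟨fun l => chartCoframe I a q l v, ?_⟩
    have h1 := congrArg (mfderiv I (𝓡 n) Y.toFun q) (eq_sum_chartFrame hq v)
    rw [map_sum] at h1
    exact h1.trans (Finset.sum_congr rfl fun l _ => map_smul _ _ _)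
  · intro j s
    rw [hAl, hεc, ← hν'c]; rfl
  · intro j i
    rw [hAr q hq hfq, hεc]; rfl
  · intro l
    rw [hβ, chartCoframe_chartFrame hq]

end Flux

/-! ### Supports and integrability in a chart. -/

section Support

variable {r : ℕ} {H' : Type*} [TopologicalSpace H']
  {I : ModelWithCorners ℝ (EuclideanSpace ℝ (Fin r)) H'} {W : Type*} [TopologicalSpace W]
  [ChartedSpace H' W]

theorem mfderiv_eq_zero_of_notMem_tsupport {χ : W → ℝ} {q : W} (hq : q ∉ tsupport χ) :
    mfderiv I 𝓘(ℝ, ℝ) χ q = 0 := by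
  have h1 : χ =ᶠ[𝓝 q] fun _ => (0 : ℝ) := notMem_tsupport_iff_eventuallyEq.1 hq
  exact (hasMFDerivAt_const (0 : ℝ) q).congr_of_eventuallyEq h1 |>.mfderiv

theorem isCompact_chart_image {a : W} {K : Set W} (hK : IsCompact K)
    (hKs : K ⊆ (extChartAt I a).source) : IsCompact (extChartAt I a '' K) :=
  hK.image_of_continuousOn ((continuousOn_extChartAt a).mono hKs)

theorem chart_image_subset_target {a : W} {K : Set W}
    (hKs : K ⊆ (extChartAt I a).source) : extChartAt I a '' K ⊆ (extChartAt I a).target := by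
  rintro _ ⟨q, hq, rfl⟩
  exact (extChartAt I a).map_source (hKs hq)

theorem mem_chart_image_iff {a : W} {K : Set W} (hKs : K ⊆ (extChartAt I a).source)
    {y : EuclideanSpace ℝ (Fin r)} (hy : y ∈ (extChartAt I a).target) :
    y ∈ extChartAt I a '' K ↔ (extChartAt I a).symm y ∈ K := by
  constructor
  · rintro ⟨q, hq, rfl⟩
    rwa [(extChartAt I a).left_inv (hKs hq)]
  · intro h
    exact ⟨_, h, (extChartAt I a).right_inv hy⟩

theorem integrableOn_chart_target {f : EuclideanSpace ℝ (Fin r) → ℝ} {a : W} {K : Set W}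
    (hK : IsCompact K) (hKs : K ⊆ (extChartAt I a).source)
    (hf : ∀ y ∈ (extChartAt I a).target, (extChartAt I a).symm y ∈ K →
      ContinuousWithinAt f (range I) y)
    (hf0 : ∀ y ∈ (extChartAt I a).target, (extChartAt I a).symm y ∉ K → f y = 0) :
    IntegrableOn f (extChartAt I a).target := by
  have h1 : IntegrableOn f (extChartAt I a '' K) := by
    refine ContinuousOn.integrableOn_compact (isCompact_chart_image hK hKs) fun y hy => ?_
    have hyt := chart_image_subset_target hKs hy
    exact (hf y hyt ((mem_chart_image_iff hKs hyt).1 hy)).mono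
      ((chart_image_subset_target hKs).trans (extChartAt_target_subset_range a))
  refine h1.of_forall_sdiff_eq_zero (measurableSet_extChartAt_target a) fun y hy => ?_
  exact hf0 y hy.1 fun h => hy.2 ((mem_chart_image_iff hKs hy.1).2 h)

end Support

/-! ### Regularity and vanishing divergence of the induced vector density. -/

section Regularity

variable {n r p : ℕ} {H' : Type*} [TopologicalSpace H']
  {I : ModelWithCorners ℝ (EuclideanSpace ℝ (Fin r)) H'} {W : Type*} [TopologicalSpace W]
  [ChartedSpace H' W] [IsManifold I ∞ W]
  {M : Type*} [TopologicalSpace M] [ChartedSpace (EuclideanSpace ℝ (Fin n)) M]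
  [IsManifold (𝓡 n) ∞ M]
  (hn : n = p + r) (H : MultivectorDensityField n (p + 1) M) (Y : CoorientedImmersion I W n M p)

/-- The vector density induced on a cooriented immersed submanifold by a divergence-free multivector
density is continuous up to the boundary, and smooth and divergence-free in the interior. -/
theorem exists_fluxComponent_regular (hH : IsDivergenceFree H) (a : W) :
    ∃ N : Set W, IsOpen N ∧ a ∈ N ∧ N ⊆ (extChartAt I a).source ∧
      ∀ y ∈ (extChartAt I a).target, (extChartAt I a).symm y ∈ N →
        (∀ i, ContinuousWithinAt (fun y => fluxComponent hn H Y a i ((extChartAt I a).symm y))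
          (range I) y) ∧
        (range I ∈ 𝓝 y →
          (∀ i, DifferentiableAt ℝ (fun y => fluxComponent hn H Y a i ((extChartAt I a).symm y)) y) ∧
          ∑ i, fderiv ℝ (fun y => fluxComponent hn H Y a i ((extChartAt I a).symm y)) y
            (EuclideanSpace.single i (1 : ℝ)) = 0) := by
  obtain ⟨N, hNo, haN, hNs, c, ν, h⟩ := exists_fluxComponent_eq hn H Y a
  refine ⟨N, hNo, haN, hNs, fun y hy hyN => ?_⟩
  obtain ⟨hfy, hdet, hfc⟩ := h y hy hyN
  set Φ : Fin r → EuclideanSpace ℝ (Fin r) → ℝ := fun i y =>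
    frameComponent (frameMatrix hn Y a ν y) (fun J => component H.toFun
      (chartAt (EuclideanSpace ℝ (Fin n)) (Y.toFun a)) J (chartExpr Y a y))
      (Fin.cons (frameEquiv hn (Sum.inr i)) (fun s => frameEquiv hn (Sum.inl s))) with hΦ
  have hev : ∀ᶠ z in 𝓝[range I] y, z ∈ (extChartAt I a).target ∧ (extChartAt I a).symm z ∈ N := by
    refine Filter.Eventually.and (extChartAt_target_mem_nhdsWithin_of_mem hy) ?_
    exact ((continuousAt_extChartAt_symm'' hy).continuousWithinAt).preimage_mem_nhdsWithin
      (hNo.mem_nhds hyN)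
  have hevG : ∀ i, (fun y => fluxComponent hn H Y a i ((extChartAt I a).symm y))
      =ᶠ[𝓝[range I] y] fun y => c * Φ i y := fun i => by
    filter_upwards [hev] with z hz
    exact (h z hz.1 hz.2).2.2 i
  have hΦd : ∀ i, ContDiffWithinAt ℝ ((1 : ℕ∞) : ℕ∞ω) (Φ i) (range I) y := fun i =>
    contDiffWithinAt_frameComponent (contDiffWithinAt_frameMatrix hn hy hfy ν) hdet
      (contDiffWithinAt_component hy hfy) _
  refine ⟨fun i => ?_, fun hint => ?_⟩
  · refine ContinuousWithinAt.congr_of_eventuallyEq ?_ (hevG i) (hfc i)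
    exact continuousWithinAt_const.mul (hΦd i).continuousWithinAt
  -- At an interior point derivatives within the range of `I` are ordinary ones, so the frame
  -- computation applies with the standard basis as directions.
  · have hnhds : 𝓝[range I] y = 𝓝 y := nhdsWithin_eq_nhds.2 hint
    have hΦD : ∀ i, DifferentiableAt ℝ (Φ i) y := fun i =>
      ((hΦd i).contDiffAt hint).differentiableAt (by norm_num)
    rw [hnhds] at hevG
    refine ⟨fun i => ((hΦD i).const_mul c).congr_of_eventuallyEq (hevG i), ?_⟩
    have h1 : ∀ i, fderiv ℝ (fun y => fluxComponent hn H Y a i ((extChartAt I a).symm y)) y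
        (EuclideanSpace.single i (1 : ℝ)) =
        c * fderiv ℝ (Φ i) y (EuclideanSpace.single i (1 : ℝ)) := by
      intro i
      rw [(hevG i).fderiv_eq, fderiv_const_mul (hΦD i)]
      rfl
    simp only [h1]
    rw [← Finset.mul_sum]
    have hgy : chartExpr Y a y ∈ (chartAt (EuclideanSpace ℝ (Fin n)) (Y.toFun a)).target := by
      have := (extChartAt (𝓡 n) (Y.toFun a)).map_source hfy
      simpa [extChartAt_target, chartExpr] using this
    rw [sum_fderiv_frameComponent_eq_zero (frameEquiv hn)
      (w := fun i => EuclideanSpace.single i (1 : ℝ)) (g := chartExpr Y a) (ν := ν)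
      (A := frameMatrix hn Y a ν) (c := fun x J => component H.toFun
      (chartAt (EuclideanSpace ℝ (Fin n)) (Y.toFun a)) J x)
      (((contDiffWithinAt_chartExpr hy hfy).contDiffAt hint).of_le (by norm_cast))
      (fun y j s => by simp [frameMatrix]) ?_ hdet ?_
      (fun x => isAntisymm_component _ _ x) (fun J => hH _ (chart_mem_atlas _ _) J _ hgy)
      (fun i => Filter.EventuallyEq.rfl) hΦD, mul_zero]
    · filter_upwards [eventually_eventually_nhds.2 hint] with z hz j i
      have hz' : range I ∈ 𝓝 z := hz
      simp only [frameMatrix, Matrix.of_apply, Equiv.symm_apply_apply, Sum.elim_inr]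
      rw [fderivWithin_of_mem_nhds hz']
    · intro J
      exact ((H.smooth _ (chart_mem_atlas _ (Y.toFun a)) J).contDiffAt
        ((chartAt (EuclideanSpace ℝ (Fin n)) (Y.toFun a)).open_target.mem_nhds
          hgy)).differentiableAt (by simp)

theorem contDiffWithinAt_comp_extChartAt_symm {χ : W → ℝ} (hχ : ContMDiff I 𝓘(ℝ, ℝ) ∞ χ) {a : W}
    {y : EuclideanSpace ℝ (Fin r)} (hy : y ∈ (extChartAt I a).target) :
    ContDiffWithinAt ℝ ∞ (χ ∘ (extChartAt I a).symm) (range I) y := by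
  have h1 := (contMDiffAt_iff_of_mem_source (x := a) (y := (0 : ℝ))
    (by simpa using (extChartAt I a).map_target hy) (by simp [chartAt_self_eq])).1
    (hχ ((extChartAt I a).symm y))
  have h2 := h1.2
  rw [(extChartAt I a).right_inv hy] at h2
  exact h2

theorem flux_mfderiv_eq_sum {χ : W → ℝ} (hχ : ContMDiff I 𝓘(ℝ, ℝ) ∞ χ) {a : W}
    {y : EuclideanSpace ℝ (Fin r)} (hy : y ∈ (extChartAt I a).target) :
    flux hn H Y ((extChartAt I a).symm y) (chartFrame I a ((extChartAt I a).symm y))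
        (mfderiv I 𝓘(ℝ, ℝ) χ ((extChartAt I a).symm y)).toLinearMap =
      ∑ i, fderivWithin ℝ (χ ∘ (extChartAt I a).symm) (range I) y
        (EuclideanSpace.single i (1 : ℝ)) *
          fluxComponent hn H Y a i ((extChartAt I a).symm y) := by
  have h1 := ((hχ.mdifferentiable (by simp)) ((extChartAt I a).symm y)).hasMFDerivAt
  have h2 := eq_sum_chartCoframe ((extChartAt I a).map_target hy)
    (mfderiv I 𝓘(ℝ, ℝ) χ ((extChartAt I a).symm y)).toLinearMap
  conv_lhs => rw [h2, map_sum]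
  refine Finset.sum_congr rfl fun i _ => ?_
  rw [map_smul, fderivWithin_comp_extChartAt_symm hy h1]
  rfl

theorem continuousWithinAt_flux_mfderiv {χ : W → ℝ} (hχ : ContMDiff I 𝓘(ℝ, ℝ) ∞ χ) {a : W}
    {y : EuclideanSpace ℝ (Fin r)} (hy : y ∈ (extChartAt I a).target)
    (hG : ∀ i, ContinuousWithinAt (fun y => fluxComponent hn H Y a i ((extChartAt I a).symm y))
      (range I) y) :
    ContinuousWithinAt (fun y => flux hn H Y ((extChartAt I a).symm y)
      (chartFrame I a ((extChartAt I a).symm y))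
        (mfderiv I 𝓘(ℝ, ℝ) χ ((extChartAt I a).symm y)).toLinearMap) (range I) y := by
  have h1 : ContinuousWithinAt (fderivWithin ℝ (χ ∘ (extChartAt I a).symm) (range I))
      (range I) y :=
    ((contDiffWithinAt_comp_extChartAt_symm hχ hy).fderivWithin_right (m := 0) I.uniqueDiffOn
      (by norm_cast) (extChartAt_target_subset_range a hy)).continuousWithinAt
  have h2 : ContinuousWithinAt (fun y => ∑ i, fderivWithin ℝ (χ ∘ (extChartAt I a).symm)
      (range I) y (EuclideanSpace.single i (1 : ℝ)) *
        fluxComponent hn H Y a i ((extChartAt I a).symm y)) (range I) y :=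
    tendsto_finsetSum _ fun i _ => Filter.Tendsto.mul
      (h1.clm_apply continuousWithinAt_const) (hG i)
  refine h2.congr_of_eventuallyEq ?_ (flux_mfderiv_eq_sum hn H Y hχ hy)
  filter_upwards [extChartAt_target_mem_nhdsWithin_of_mem hy] with z hz
  exact flux_mfderiv_eq_sum hn H Y hχ hz

end Regularity

/-! ### The divergence theorem in one chart. -/

section LocalStokes

variable {n k p : ℕ} {H' : Type*} [TopologicalSpace H']
  {I : ModelWithCorners ℝ (EuclideanSpace ℝ (Fin (k + 1))) H'} {W : Type*} [TopologicalSpace W]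
  [ChartedSpace H' W]
  {M : Type*} [TopologicalSpace M] [ChartedSpace (EuclideanSpace ℝ (Fin n)) M]
  [IsManifold (𝓡 n) ∞ M]
  (hn : n = p + (k + 1)) (H : MultivectorDensityField n (p + 1) M)
  (Y : CoorientedImmersion I W n M p)

open Classical in
/-- The flux through the boundary of the vector density induced by `H`, weighted by `χ`, in the
chart at `a`. -/
def faceDensity (a : W) (χ : W → ℝ) (y : EuclideanSpace ℝ (Fin k)) : ℝ :=
  if faceIncl k y ∈ (extChartAt I a).target then
    χ ((extChartAt I a).symm (faceIncl k y)) *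
      fluxComponent hn H Y a 0 ((extChartAt I a).symm (faceIncl k y))
  else 0

/-- With G the induced vector density, div(χG) = G(dχ) because div G = 0. The divergence theorem for
χG then gives the claim; the minus sign appears because the outward normal of the half-space is the
negative of the coordinate direction `0`. -/
theorem integral_flux_eq_neg_integral_faceDensity [IsManifold I ∞ W] [CompactSpace W]
    (hrange : range I = {y | 0 ≤ y 0}) {a : W} {N : Set W}
    (hNs : N ⊆ (extChartAt I a).source)
    (hN : ∀ y ∈ (extChartAt I a).target, (extChartAt I a).symm y ∈ N →
        (∀ i, ContinuousWithinAt (fun y => fluxComponent hn H Y a i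
          ((extChartAt I a).symm y)) (range I) y) ∧
        (range I ∈ 𝓝 y →
          (∀ i, DifferentiableAt ℝ (fun y => fluxComponent hn H Y a i
            ((extChartAt I a).symm y)) y) ∧
          ∑ i, fderiv ℝ (fun y => fluxComponent hn H Y a i ((extChartAt I a).symm y)) y
            (EuclideanSpace.single i (1 : ℝ)) = 0))
    {χ : W → ℝ} (hχ : ContMDiff I 𝓘(ℝ, ℝ) ∞ χ) (hχN : tsupport χ ⊆ N) :
    ∫ y in (extChartAt I a).target, flux hn H Y ((extChartAt I a).symm y)
      (chartFrame I a ((extChartAt I a).symm y))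
        (mfderiv I 𝓘(ℝ, ℝ) χ ((extChartAt I a).symm y)).toLinearMap =
      -∫ y, faceDensity hn H Y a χ y := by
  classical
  set c := extChartAt I a with hc
  have hKs : tsupport χ ⊆ c.source := hχN.trans hNs
  have hKc : IsCompact (tsupport χ) := (isClosed_tsupport χ).isCompact
  set K := c '' tsupport χ with hK
  have hKcomp : IsCompact K := isCompact_chart_image hKc hKs
  have hKt : K ⊆ c.target := chart_image_subset_target hKs
  -- The field χG and the function G(dχ) are extended by zero outside the target; both vanish off
  -- the compact set `K`, so continuity survives.
  set F : Fin (k + 1) → EuclideanSpace ℝ (Fin (k + 1)) → ℝ := fun i y =>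
    if y ∈ c.target then χ (c.symm y) * fluxComponent hn H Y a i (c.symm y) else 0 with hF
  set D : EuclideanSpace ℝ (Fin (k + 1)) → ℝ := fun y =>
    if y ∈ c.target then flux hn H Y (c.symm y) (chartFrame I a (c.symm y))
        (mfderiv I 𝓘(ℝ, ℝ) χ (c.symm y)).toLinearMap else 0 with hD
  have hF0 : ∀ i y, y ∉ K → F i y = 0 := by
    intro i y hy
    simp only [hF]
    split_ifs with hyt
    · rw [image_eq_zero_of_notMem_tsupport (mt (mem_chart_image_iff hKs hyt).2 hy), zero_mul]
    · rfl
  have hD0 : ∀ y, y ∉ K → D y = 0 := by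
    intro y hy
    simp only [hD]
    split_ifs with hyt
    · rw [mfderiv_eq_zero_of_notMem_tsupport (mt (mem_chart_image_iff hKs hyt).2 hy)]
      exact map_zero _
    · rfl
  have hKN : ∀ y ∈ K, c.symm y ∈ N := fun y hy => hχN ((mem_chart_image_iff hKs (hKt hy)).1 hy)
  have hχc : ∀ y ∈ K, ContDiffWithinAt ℝ ∞ (χ ∘ c.symm) (range I) y := fun y hy =>
    contDiffWithinAt_comp_extChartAt_symm hχ (hKt hy)
  have hFe : ∀ i, ∀ y ∈ K, F i =ᶠ[𝓝[range I] y] fun y =>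
      (χ ∘ c.symm) y * fluxComponent hn H Y a i (c.symm y) := by
    intro i y hy
    filter_upwards [extChartAt_target_mem_nhdsWithin_of_mem (hKt hy)] with z hz
    simp only [hF]
    rw [if_pos hz]; rfl
  have hFc : ∀ i, ContinuousOn (F i) {y | 0 ≤ y 0} := by
    intro i y hy
    rw [← hrange] at hy ⊢
    by_cases hyK : y ∈ K
    · refine ContinuousWithinAt.congr_of_eventuallyEq ?_ (hFe i y hyK)
        ((hFe i y hyK).self_of_nhdsWithin hy)
      exact (hχc y hyK).continuousWithinAt.mul ((hN y (hKt hyK) (hKN y hyK)).1 i)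
    · have h1 : F i =ᶠ[𝓝 y] fun _ => 0 := by
        filter_upwards [hKcomp.isClosed.isOpen_compl.mem_nhds hyK] with z hz
        exact hF0 i z hz
      exact (continuousAt_const.congr h1.symm).continuousWithinAt
  have hDc : ContinuousOn D {y | 0 ≤ y 0} := by
    intro y hy
    rw [← hrange] at hy ⊢
    by_cases hyK : y ∈ K
    · have h1 : D =ᶠ[𝓝[range I] y] fun y => flux hn H Y (c.symm y) (chartFrame I a (c.symm y))
          (mfderiv I 𝓘(ℝ, ℝ) χ (c.symm y)).toLinearMap := by
        filter_upwards [extChartAt_target_mem_nhdsWithin_of_mem (hKt hyK)] with z hz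
        simp only [hD]
        rw [if_pos hz]
      refine ContinuousWithinAt.congr_of_eventuallyEq ?_ h1 (h1.self_of_nhdsWithin hy)
      exact continuousWithinAt_flux_mfderiv hn H Y hχ (hKt hyK) (hN y (hKt hyK) (hKN y hyK)).1
    · have h1 : D =ᶠ[𝓝 y] fun _ => 0 := by
        filter_upwards [hKcomp.isClosed.isOpen_compl.mem_nhds hyK] with z hz
        exact hD0 z hz
      exact (continuousAt_const.congr h1.symm).continuousWithinAt
  have hint : ∀ y : EuclideanSpace ℝ (Fin (k + 1)), 0 < y 0 → range I ∈ 𝓝 y := by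
    intro y hy
    rw [hrange]
    have hcont : Continuous fun y : EuclideanSpace ℝ (Fin (k + 1)) => y 0 :=
      (EuclideanSpace.proj (𝕜 := ℝ) (0 : Fin (k + 1))).continuous
    filter_upwards [hcont.continuousAt.eventually (lt_mem_nhds hy)] with z hz
    exact hz.le
  have hzero : ∀ i y, y ∉ K → HasFDerivAt (F i)
      (0 : EuclideanSpace ℝ (Fin (k + 1)) →L[ℝ] ℝ) y := by
    intro i y hyK
    refine (hasFDerivAt_const (0 : ℝ) y).congr_of_eventuallyEq ?_
    filter_upwards [hKcomp.isClosed.isOpen_compl.mem_nhds hyK] with z hz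
    exact hF0 i z hz
  have hprod : ∀ i, ∀ y ∈ K, 0 < y 0 → HasFDerivAt (F i)
      ((χ ∘ c.symm) y • fderiv ℝ (fun y => fluxComponent hn H Y a i (c.symm y)) y +
        fluxComponent hn H Y a i (c.symm y) • fderiv ℝ (χ ∘ c.symm) y) y := by
    intro i y hyK hy0
    have h1 := hFe i y hyK
    rw [nhdsWithin_eq_nhds.2 (hint y hy0)] at h1
    refine HasFDerivAt.congr_of_eventuallyEq ?_ h1
    exact HasFDerivAt.mul (((hχc y hyK).contDiffAt (hint y hy0)).differentiableAt
      (by simp)).hasFDerivAt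
      (((hN y (hKt hyK) (hKN y hyK)).2 (hint y hy0)).1 i).hasFDerivAt
  have key := integral_halfSpace_divergence F D hKcomp hF0 hD0 hFc hDc ?_ ?_
  · have h1 : ∫ y in c.target, flux hn H Y (c.symm y) (chartFrame I a (c.symm y))
        (mfderiv I 𝓘(ℝ, ℝ) χ (c.symm y)).toLinearMap = ∫ y in c.target, D y := by
      refine setIntegral_congr_fun (measurableSet_extChartAt_target a) fun y hy => ?_
      exact (if_pos hy).symm
    rw [h1, ← setIntegral_eq_of_subset_of_forall_sdiff_eq_zero (t := range I)
      I.isClosed_range.measurableSet (extChartAt_target_subset_range a)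
      (fun y hy => if_neg hy.2), hrange, key]
    rfl
  · intro i y hy0
    by_cases hyK : y ∈ K
    · exact (hprod i y hyK hy0).differentiableAt
    · exact (hzero i y hyK).differentiableAt
  · intro y hy0
    by_cases hyK : y ∈ K
    · have h1 := ((hN y (hKt hyK) (hKN y hyK)).2 (hint y hy0)).2
      have h2 : D y = _ := (if_pos (hKt hyK)).trans (flux_mfderiv_eq_sum hn H Y hχ (hKt hyK))
      rw [h2]
      simp only [(hprod _ y hyK hy0).fderiv, add_apply,
        smul_apply, smul_eq_mul, fderivWithin_of_mem_nhds (hint y hy0)]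
      rw [Finset.sum_add_distrib, ← Finset.mul_sum, h1, mul_zero, zero_add]
      exact Finset.sum_congr rfl fun i _ => mul_comm _ _
    · rw [hD0 y hyK]
      exact Finset.sum_eq_zero fun i _ => by rw [(hzero i y hyK).fderiv]; rfl

end LocalStokes

/-! ### The total flux through the boundary vanishes. -/

section Stokes

variable {n k p : ℕ} {H' : Type*} [TopologicalSpace H']
  {I : ModelWithCorners ℝ (EuclideanSpace ℝ (Fin (k + 1))) H'} {W : Type*} [TopologicalSpace W]
  [ChartedSpace H' W]

theorem hasMFDerivAt_sum {ι : Type*} (T : Finset ι) {ψ : ι → W → ℝ} {q : W}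
    {D : ι → TangentSpace I q →L[ℝ] ℝ} (hψ : ∀ a, HasMFDerivAt I 𝓘(ℝ, ℝ) (ψ a) q (D a)) :
    HasMFDerivAt I 𝓘(ℝ, ℝ) (∑ a ∈ T, ψ a) q (∑ a ∈ T, D a : TangentSpace I q →L[ℝ] ℝ) := by
  classical
  induction T using Finset.induction_on with
  | empty =>
    rw [Finset.sum_empty, Finset.sum_empty]
    exact hasMFDerivAt_const (0 : ℝ) q
  | insert a T ha ih =>
    rw [Finset.sum_insert ha, Finset.sum_insert ha]
    exact (hψ a).add ih

theorem sum_mfderiv_eq_zero {T : Finset W} {ψ : W → W → ℝ}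
    (hψ : ∀ a, ContMDiff I 𝓘(ℝ, ℝ) ∞ (ψ a)) (hsum : ∀ q, ∑ a ∈ T, ψ a q = 1) (q : W)
    {D : W → TangentSpace I q →L[ℝ] ℝ} (hD : ∀ a, D a = mfderiv I 𝓘(ℝ, ℝ) (ψ a) q) :
    ∑ a ∈ T, D a = 0 := by
  have h1 := hasMFDerivAt_sum T (D := D) fun a => by
    rw [hD]
    exact ((hψ a).mdifferentiable (by simp) q).hasMFDerivAt
  have h2 : (∑ a ∈ T, ψ a) = fun _ => (1 : ℝ) := by
    funext q
    rw [Finset.sum_apply, hsum]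
  rw [h2] at h1
  exact hasMFDerivAt_unique h1 (hasMFDerivAt_const (1 : ℝ) q)

variable {M : Type*} [TopologicalSpace M] [ChartedSpace (EuclideanSpace ℝ (Fin n)) M]
  [IsManifold (𝓡 n) ∞ M]
  (hn : n = p + (k + 1)) (H : MultivectorDensityField n (p + 1) M)
  (Y : CoorientedImmersion I W n M p) [IsManifold I ∞ W] [CompactSpace W] [T2Space W]

/-- The total flux of a divergence-free multivector density through the boundary vanishes. -/
theorem exists_partition_sum_integral_faceDensity_eq_zero (hH : IsDivergenceFree H)
    (hrange : range I = {y | 0 ≤ y 0}) :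
    ∃ (T : Finset W) (ψ : W → W → ℝ), (∀ a, Continuous (ψ a)) ∧
      (∀ a, tsupport (ψ a) ⊆ (extChartAt I a).source) ∧ (∀ q, ∑ a ∈ T, ψ a q = 1) ∧
      (∀ a, ∀ y ∈ (extChartAt I a).target, (extChartAt I a).symm y ∈ tsupport (ψ a) →
        ContinuousWithinAt (fun y => fluxComponent hn H Y a 0 ((extChartAt I a).symm y))
          (range I) y) ∧
      ∑ a ∈ T, ∫ y, faceDensity hn H Y a (ψ a) y = 0 := by
  classical
  -- The partition is subordinate to the neighbourhoods `N a`, not to whole chart domains, because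
  -- regularity of the flux components is known only there.
  choose N hNo haN hNs hN using exists_fluxComponent_regular hn H Y hH
  obtain ⟨f, hf⟩ := SmoothPartitionOfUnity.exists_isSubordinate I (isClosed_univ (X := W)) N hNo
    (fun q _ => mem_iUnion.2 ⟨q, haN q⟩)
  have hfin : {a | (Function.support (f a)).Nonempty}.Finite :=
    f.locallyFinite.finite_nonempty_of_compact
  have hψ : ∀ a, ContMDiff I 𝓘(ℝ, ℝ) ∞ (f a) := fun a => (f a).contMDiff
  have hsum : ∀ q, ∑ a ∈ hfin.toFinset, f a q = 1 := by
    intro q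
    rw [← f.sum_eq_one (mem_univ q)]
    refine (finsum_eq_sum_of_support_subset _ fun a ha => ?_).symm
    rw [Finite.coe_toFinset]
    exact ⟨q, ha⟩
  refine ⟨hfin.toFinset, fun a => f a, fun a => (hψ a).continuous, fun a => (hf a).trans (hNs a),
    hsum, fun a y hy hyK => (hN a y hy (hf a hyK)).1 0, ?_⟩
  set T := hfin.toFinset
  set g : W → W → EuclideanSpace ℝ (Fin (k + 1)) → ℝ := fun a b y =>
    flux hn H Y ((extChartAt I b).symm y) (chartFrame I b ((extChartAt I b).symm y))
      (mfderiv I 𝓘(ℝ, ℝ) (f a) ((extChartAt I b).symm y)).toLinearMap with hg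
  have hstokes : ∀ a, ∫ y, faceDensity hn H Y a (f a) y =
      -∫ y in (extChartAt I a).target, g a a y := fun a => by
    rw [hg, integral_flux_eq_neg_integral_faceDensity hn H Y hrange (hNs a) (hN a) (hψ a) (hf a),
      neg_neg]
  have hcompact : ∀ a, IsCompact (tsupport (f a)) := fun a => (isClosed_tsupport _).isCompact
  have hmulcont : ∀ a b c, ∀ y ∈ (extChartAt I c).target,
      (extChartAt I c).symm y ∈ tsupport (f c) → ContinuousWithinAt
        (fun y => f b ((extChartAt I c).symm y) * g a c y) (range I) y := by
    intro a b c y hy hyK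
    exact (contDiffWithinAt_comp_extChartAt_symm (hψ b) hy).continuousWithinAt.mul
      (continuousWithinAt_flux_mfderiv hn H Y (hψ a) hy (hN c y hy (hf c hyK)).1)
  have hg0 : ∀ a b y, (extChartAt I b).symm y ∉ tsupport (f a) → g a b y = 0 := by
    intro a b y hy
    simp only [hg]
    rw [mfderiv_eq_zero_of_notMem_tsupport hy]
    exact map_zero _
  have hint1 : ∀ a b, IntegrableOn (fun y => f b ((extChartAt I a).symm y) * g a a y)
      (extChartAt I a).target := fun a b =>
    integrableOn_chart_target (hcompact a) ((hf a).trans (hNs a)) (hmulcont a b a)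
      fun y _ hyK => by rw [hg0 a a y hyK, mul_zero]
  have hint2 : ∀ a b, IntegrableOn (fun y => f b ((extChartAt I b).symm y) * g a b y)
      (extChartAt I b).target := fun a b =>
    integrableOn_chart_target (hcompact b) ((hf b).trans (hNs b)) (hmulcont a b b)
      fun y _ hyK => by rw [image_eq_zero_of_notMem_tsupport hyK, zero_mul]
  have hchange : ∀ a b, ∫ y in (extChartAt I a).target, f b ((extChartAt I a).symm y) * g a a y =
      ∫ y in (extChartAt I b).target, f b ((extChartAt I b).symm y) * g a b y := by
    intro a b
    -- `f b` may be cut off to the support of `f a`, where alone `g a` lives. The resulting weight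
    -- is supported in both charts, as the change of chart requires.
    have h1 : ∀ c y, f b ((extChartAt I c).symm y) * g a c y =
        (tsupport (f a)).indicator (f b) ((extChartAt I c).symm y) * g a c y := by
      intro c y
      by_cases hy : (extChartAt I c).symm y ∈ tsupport (f a)
      · rw [indicator_of_mem hy]
      · rw [hg0 a c y hy, mul_zero, mul_zero]
    simp only [h1]
    refine integral_density_chart_change (δ := fun q u => flux hn H Y q u
      (mfderiv I 𝓘(ℝ, ℝ) (f a) q).toLinearMap) (fun q => isDensity_flux hn H Y q _) _ ?_ ?_
    · intro q hq
      by_contra hqs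
      exact hq (indicator_of_notMem (fun h => hqs (hNs a (hf a h))) _)
    · intro q hq
      by_contra hqs
      refine hq ((indicator_apply_eq_zero).2 fun _ => ?_)
      exact image_eq_zero_of_notMem_tsupport fun h => hqs (hNs b (hf b h))
  -- Inserting `∑ b, f b = 1` moves every integral to a chart `b` independent of `a`; there the sum
  -- over `a` is taken pointwise and contains `∑ a, d(f a) = 0`.
  have h1 : ∀ a, ∫ y in (extChartAt I a).target, g a a y =
      ∑ b ∈ T, ∫ y in (extChartAt I b).target, f b ((extChartAt I b).symm y) * g a b y := by
    intro a
    simp only [← hchange a]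
    rw [← integral_finsetSum _ fun b _ => hint1 a b]
    refine integral_congr_ae (Filter.Eventually.of_forall fun y => ?_)
    simp only
    rw [← Finset.sum_mul, hsum, one_mul]
  simp only [hstokes, Finset.sum_neg_distrib, h1]
  rw [Finset.sum_comm, neg_eq_zero]
  refine Finset.sum_eq_zero fun b _ => ?_
  rw [← integral_finsetSum _ fun a _ => hint2 a b]
  refine integral_eq_zero_of_ae (Filter.Eventually.of_forall fun y => ?_)
  simp only [Pi.zero_apply]
  rw [← Finset.mul_sum]
  set D : W → TangentSpace I ((extChartAt I b).symm y) →L[ℝ] ℝ := fun a =>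
    mfderiv I 𝓘(ℝ, ℝ) (f a) ((extChartAt I b).symm y) with hD
  have h2 : ∑ a ∈ T, (D a).toLinearMap = 0 := by
    have := sum_mfderiv_eq_zero (ψ := fun a => f a) hψ hsum _ (D := D) fun _ => rfl
    rw [← ContinuousLinearMap.toLinearMap_sum, this]
    rfl
  have h3 := map_sum (flux hn H Y ((extChartAt I b).symm y)
    (chartFrame I b ((extChartAt I b).symm y))) (fun a => (D a).toLinearMap) T
  rw [h2, map_zero] at h3
  exact mul_eq_zero_of_right _ h3.symm

end Stokes

/-! ### The boundary in charts: tangent hyperplane and inward vector. -/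

section BoundaryChart

variable {k : ℕ} {H' : Type*} [TopologicalSpace H']
  {I : ModelWithCorners ℝ (EuclideanSpace ℝ (Fin (k + 1))) H'} {W : Type*} [TopologicalSpace W]
  [ChartedSpace H' W] [IsManifold I ∞ W]

/-- Boundary points are defined by the preferred chart at the point; being interior does not depend
on the chart, so any chart around the point can be used. -/
theorem mem_boundary_iff_extChartAt_zero (hrange : range I = {y | 0 ≤ y 0}) {a q : W}
    (hq : q ∈ (extChartAt I a).source) : q ∈ I.boundary W ↔ extChartAt I a q 0 = 0 := by
  have hqs : q ∈ (chartAt H' a).source := by rwa [extChartAt_source] at hq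
  have h1 : extChartAt I a q ∈ interior ((chartAt H' a).extend I).target ↔
      extChartAt I a q ∈ interior (range I) :=
    ⟨fun h => OpenPartialHomeomorph.interior_extend_target_subset_interior_range _ h,
      fun h => (chartAt H' a).mem_interior_extend_target ((chartAt H' a).map_source hqs) h⟩
  have h2 : interior (range I) = {y | 0 < y 0} := by
    have h3 := frontier_range_modelWithCornersEuclideanHalfSpace (k + 1)
    rw [range_modelWithCornersEuclideanHalfSpace, ← hrange] at h3
    rw [← closure_sdiff_frontier, I.isClosed_range.closure_eq, h3, hrange]
    ext y
    simp only [mem_sdiff, mem_ofPred_eq]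
    exact ⟨fun h => lt_of_le_of_ne h.1 h.2, fun h => ⟨h.le, h.ne⟩⟩
  have h4 : (0 : ℝ) ≤ extChartAt I a q 0 := by
    have : extChartAt I a q ∈ range I := mem_range_self _
    rwa [hrange] at this
  rw [← I.compl_interior, mem_compl_iff]
  change ¬ I.IsInteriorPoint q ↔ _
  rw [I.isInteriorPoint_iff_of_mem_atlas (n := ∞) (by simp) (chart_mem_atlas H' a) hqs]
  change ¬ (extChartAt I a q ∈ interior ((chartAt H' a).extend I).target) ↔ _
  rw [h1, h2]
  exact not_lt.trans ⟨fun h => le_antisymm h h4, fun h => h.le⟩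

variable {S : Type*} [TopologicalSpace S] [ChartedSpace (EuclideanSpace ℝ (Fin k)) S]
  {j : S → W}

/-- Coordinate `0` is identically zero along `j`, so its differential kills the image of the
differential of `j`. -/
theorem chartCoframe_zero_mfderiv (hrange : range I = {y | 0 ≤ y 0})
    (hj : ContMDiff (𝓡 k) I ∞ j) (hb : ∀ q, j q ∈ I.boundary W) {q : S} {a : W}
    (hq : j q ∈ (extChartAt I a).source) (v : TangentSpace (𝓡 k) q) :
    chartCoframe I a (j q) 0 (mfderiv (𝓡 k) I j q v) = 0 := by
  have h1 := (hasMFDerivAt_chartDeriv hq).comp q ((hj.mdifferentiable (by simp) q).hasMFDerivAt)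
  have h2 := ((EuclideanSpace.proj 0 : EuclideanSpace ℝ (Fin (k + 1)) →L[ℝ] ℝ).hasMFDerivAt
    (x := extChartAt I a (j q))).comp q h1
  have h3 : (fun _ => (0 : ℝ)) =ᶠ[𝓝 q] (EuclideanSpace.proj 0 :
      EuclideanSpace ℝ (Fin (k + 1)) →L[ℝ] ℝ) ∘ (extChartAt I a ∘ j) := by
    filter_upwards [hj.continuous.continuousAt.preimage_mem_nhds
      ((isOpen_extChartAt_source a).mem_nhds hq)] with z hz
    exact ((mem_boundary_iff_extChartAt_zero hrange hz).1 (hb z)).symm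
  have h4 := hasMFDerivAt_unique (h2.congr_of_eventuallyEq h3) (hasMFDerivAt_const (0 : ℝ) q)
  exact congrArg (fun L : TangentSpace (𝓡 k) q →L[ℝ] ℝ => L v) h4

/-- The differential of `j` is injective into a hyperplane of the same dimension `k`, so it fills
that hyperplane. -/
theorem exists_mfderiv_eq (hrange : range I = {y | 0 ≤ y 0})
    (hj : ContMDiff (𝓡 k) I ∞ j) (hinj : ∀ q, Function.Injective (mfderiv (𝓡 k) I j q))
    (hb : ∀ q, j q ∈ I.boundary W) {q : S} {a : W}
    (hq : j q ∈ (extChartAt I a).source) {u : TangentSpace I (j q)}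
    (hu : chartCoframe I a (j q) 0 u = 0) : ∃ v, mfderiv (𝓡 k) I j q v = u := by
  have hc : Function.Injective (chartDeriv I a (j q)) :=
    Function.LeftInverse.injective (inverse_chartDeriv_apply hq)
  have hface : ∀ x y : EuclideanSpace ℝ (Fin (k + 1)), x 0 = 0 → y 0 = 0 →
      faceProj k x = faceProj k y → x = y := fun x y hx hy h => by
    rw [← faceIncl_faceProj hx, h, faceIncl_faceProj hy]
  set L : TangentSpace (𝓡 k) q →ₗ[ℝ] EuclideanSpace ℝ (Fin k) :=
    (faceProj k).toLinearMap ∘ₗ (chartDeriv I a (j q)).toLinearMap ∘ₗ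
      (mfderiv (𝓡 k) I j q).toLinearMap with hL
  have hLinj : Function.Injective L := fun v v' h =>
    hinj q (hc (hface _ _ (chartCoframe_zero_mfderiv hrange hj hb hq v)
      (chartCoframe_zero_mfderiv hrange hj hb hq v') h))
  have hLsurj : Function.Surjective L :=
    (LinearMap.injective_iff_surjective_of_finrank_eq_finrank rfl).1 hLinj
  obtain ⟨v, hv⟩ := hLsurj (faceProj k (chartDeriv I a (j q) u))
  exact ⟨v, hc (hface _ _ (chartCoframe_zero_mfderiv hrange hj hb hq v) hu hv)⟩

/-- The normal coordinate vector of a chart at a boundary point points inward. -/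
theorem chartCoframe_chartFrame_zero_pos (hrange : range I = {y | 0 ≤ y 0})
    (hj : ContMDiff (𝓡 k) I ∞ j) (hinj : ∀ q, Function.Injective (mfderiv (𝓡 k) I j q))
    (hb : ∀ q, j q ∈ I.boundary W) {q : S} {a : W} (hq : j q ∈ (extChartAt I a).source) :
    0 < chartCoframe I (j q) (j q) 0 (chartFrame I a (j q) 0) := by
  set x := j q with hx
  have hxs : x ∈ (extChartAt I x).source := mem_extChartAt_source x
  set y₀ := extChartAt I a x with hy₀
  have hy : y₀ ∈ (extChartAt I a).target := (extChartAt I a).map_source hq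
  have hxy : (extChartAt I a).symm y₀ = x := (extChartAt I a).left_inv hq
  have h1 : HasMFDerivAt I 𝓘(ℝ, ℝ) ((EuclideanSpace.proj 0 :
      EuclideanSpace ℝ (Fin (k + 1)) →L[ℝ] ℝ) ∘ extChartAt I x) x
      (((EuclideanSpace.proj 0 : EuclideanSpace ℝ (Fin (k + 1)) →L[ℝ] ℝ).comp
        (chartDeriv I x x)) : TangentSpace I x →L[ℝ] ℝ) :=
    ((EuclideanSpace.proj 0 : EuclideanSpace ℝ (Fin (k + 1)) →L[ℝ] ℝ).hasMFDerivAt).comp x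
      (hasMFDerivAt_chartDeriv hxs)
  have hnonneg : 0 ≤ chartCoframe I x x 0 (chartFrame I a x 0) := by
    have h2 : HasFDerivWithinAt (((EuclideanSpace.proj 0 :
        EuclideanSpace ℝ (Fin (k + 1)) →L[ℝ] ℝ) ∘ extChartAt I x) ∘ (extChartAt I a).symm)
        (((EuclideanSpace.proj 0 : EuclideanSpace ℝ (Fin (k + 1)) →L[ℝ] ℝ).comp
        (chartDeriv I x x)).comp (chartDeriv I a x).inverse) (range I) y₀ := by
      have h3 := (mdifferentiableWithinAt_extChartAt_symm hy).hasMFDerivWithinAt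
      rw [mfderivWithin_symm_eq_inverse hy, hxy] at h3
      rw [← hxy] at h1
      have h4 := (h1.comp_hasMFDerivWithinAt y₀ h3).hasFDerivWithinAt
      rw [hxy] at h4
      exact h4
    -- Coordinate `0` of the chart at `x` takes its minimum `0` at the boundary point, so its
    -- derivative along the inward direction of the other chart is nonnegative.
    have hmin : IsLocalMinOn (((EuclideanSpace.proj 0 :
        EuclideanSpace ℝ (Fin (k + 1)) →L[ℝ] ℝ) ∘ extChartAt I x) ∘ (extChartAt I a).symm)
        (range I) y₀ := by
      refine Filter.Eventually.of_forall fun z => ?_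
      have h5 : extChartAt I x ((extChartAt I a).symm z) ∈ range I := mem_range_self _
      rw [hrange] at h5
      have h6 : extChartAt I x ((extChartAt I a).symm y₀) 0 = 0 := by
        rw [hxy]
        exact (mem_boundary_iff_extChartAt_zero hrange hxs).1 (hb q)
      exact h6.le.trans h5
    refine hmin.hasFDerivWithinAt_nonneg h2 (y := EuclideanSpace.single 0 1)
      (mem_posTangentConeAt_of_segment_subset ?_)
    have hyr : y₀ ∈ range I := extChartAt_target_subset_range a hy
    refine I.convex_range.segment_subset hyr ?_
    rw [hrange] at hyr ⊢
    have h7 : (0 : ℝ) ≤ y₀ 0 := hyr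
    change (0 : ℝ) ≤ (y₀ + EuclideanSpace.single 0 1 : EuclideanSpace ℝ (Fin (k + 1))) 0
    rw [PiLp.add_apply, PiLp.single_apply, if_pos rfl]
    linarith
  refine lt_of_le_of_ne hnonneg fun h0 => ?_
  -- If the derivative were zero, this covector would vanish on the inward vector and on the
  -- boundary hyperplane, hence everywhere.
  have hall : ∀ u : TangentSpace I x, chartCoframe I x x 0 u = 0 := by
    intro u
    obtain ⟨v, hv⟩ := exists_mfderiv_eq hrange hj hinj hb hq
      (u := u - chartCoframe I a x 0 u • chartFrame I a x 0)
      (by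
        rw [map_sub, map_smul, chartCoframe_chartFrame hq, if_pos rfl, smul_eq_mul, mul_one]
        exact sub_self _)
    have h8 := chartCoframe_zero_mfderiv hrange hj hb hxs v
    rw [hv, map_sub, map_smul, ← h0, smul_zero, sub_zero] at h8
    exact h8
  have h9 := hall (chartFrame I x x 0)
  rw [chartCoframe_chartFrame hxs] at h9
  simp at h9

end BoundaryChart

/-! ### The boundary density as normal component of the flux. -/

section BoundaryPairing

variable {n k p : ℕ} {S : Type*} [TopologicalSpace S] [ChartedSpace (EuclideanSpace ℝ (Fin k)) S]
  {W : Type*} [TopologicalSpace W] [ChartedSpace (EuclideanHalfSpace (k + 1)) W]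
  [IsManifold (𝓡∂ (k + 1)) ∞ W]
  {M : Type*} [TopologicalSpace M] [ChartedSpace (EuclideanSpace ℝ (Fin n)) M]
  [IsManifold (𝓡 n) ∞ M]

/-- The coordinate matrix of the frame has first row `(-1, 0, …, 0)`, so up to sign its determinant
is the remaining minor. The density discards that sign; the minus sign in the result comes from the
covector. -/
theorem flux_cons_neg_chartFrame (hB : n = p + (k + 1)) (H : MultivectorDensityField n (p + 1) M)
    (Y : CoorientedImmersion (𝓡∂ (k + 1)) W n M p) {a x : W}
    (hx : x ∈ (extChartAt (𝓡∂ (k + 1)) a).source) (u : Fin k → TangentSpace (𝓡∂ (k + 1)) x)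
    (hu : ∀ i, chartCoframe (𝓡∂ (k + 1)) a x 0 (u i) = 0) :
    flux hB H Y x (Fin.cons (-chartFrame (𝓡∂ (k + 1)) a x 0) u)
        (-chartCoframe (𝓡∂ (k + 1)) a x 0) =
      -(|(Matrix.of fun l i => chartCoframe (𝓡∂ (k + 1)) a x (Fin.succ l) (u i)).det| *
        fluxComponent hB H Y a 0 x) := by
  set U : Fin (k + 1) → TangentSpace (𝓡∂ (k + 1)) x :=
    Fin.cons (-chartFrame (𝓡∂ (k + 1)) a x 0) u with hU
  set C : Matrix (Fin (k + 1)) (Fin (k + 1)) ℝ :=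
    Matrix.of fun l i => chartCoframe (𝓡∂ (k + 1)) a x l (U i) with hC
  have h1 : U = fun i => ∑ l, C l i • chartFrame (𝓡∂ (k + 1)) a x l := by
    funext i
    exact eq_sum_chartFrame hx (U i)
  have h2 : C.det =
      -(Matrix.of fun l i => chartCoframe (𝓡∂ (k + 1)) a x (Fin.succ l) (u i)).det := by
    rw [Matrix.det_succ_row_zero, Fin.sum_univ_succ, Finset.sum_eq_zero]
    · have h3 : C 0 0 = -1 := by
        simp only [hC, hU, Matrix.of_apply, Fin.cons_zero, map_neg]
        rw [chartCoframe_chartFrame hx, if_pos rfl]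
      rw [h3]
      simp only [Fin.val_zero, pow_zero, one_mul, Fin.succAbove_zero, add_zero, neg_mul]
      rfl
    · intro i _
      have h3 : C 0 i.succ = 0 := by
        simp only [hC, hU, Matrix.of_apply, Fin.cons_succ]
        exact hu i
      rw [h3, mul_zero, zero_mul]
  rw [map_neg, h1]
  have h4 := isDensity_flux hB H Y x (chartCoframe (𝓡∂ (k + 1)) a x 0)
    (chartFrame (𝓡∂ (k + 1)) a x) C
  rw [h2, abs_neg] at h4
  exact congrArg Neg.neg h4

/-- The density induced on a part of the boundary, in terms of the normal component of the flux. -/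
theorem IsBoundaryPart.pairing_eq (hA : n = (p + 1) + k) (hB : n = p + (k + 1))
    (H : MultivectorDensityField n (p + 1) M) {Y : CoorientedImmersion (𝓡∂ (k + 1)) W n M p}
    {X : CoorientedImmersion (𝓡 k) S n M (p + 1)} {j : S → W} (hX : IsBoundaryPart Y X j) {q : S}
    {a : W} (hq : j q ∈ (extChartAt (𝓡∂ (k + 1)) a).source) (v : Fin k → TangentSpace (𝓡 k) q) :
    pairing hA H X q v =
      -(|(Matrix.of fun l i => chartCoframe (𝓡∂ (k + 1)) a (j q) (Fin.succ l)
        (mfderiv (𝓡 k) (𝓡∂ (k + 1)) j q (v i))).det| * fluxComponent hB H Y a 0 (j q)) := by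
  obtain ⟨hj, hinj, -, hb, hind⟩ := hX
  -- With the structure taken apart, the equality of immersions can be substituted, and the
  -- transport of the coorientation along it becomes trivial.
  obtain ⟨f, fsmooth, fimm, fcoor, fcont⟩ := X
  obtain ⟨h, hind⟩ := hind
  change f = Y.toFun ∘ j at h
  subst h
  have hrange := range_modelWithCornersEuclideanHalfSpace (k + 1)
  have htan := chartCoframe_zero_mfderiv hrange hj hb hq
  rw [← flux_cons_neg_chartFrame hB H Y hq _ fun i => htan (v i)]
  have hcomp : mfderiv (𝓡 k) (𝓡 n) (Y.toFun ∘ j) q =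
      (mfderiv (𝓡∂ (k + 1)) (𝓡 n) Y.toFun (j q)).comp (mfderiv (𝓡 k) (𝓡∂ (k + 1)) j q) :=
    mfderiv_comp q (Y.smooth.mdifferentiable (by simp) (j q)) (hj.mdifferentiable (by simp) q)
  set w : TangentSpace (𝓡∂ (k + 1)) (j q) := -chartFrame (𝓡∂ (k + 1)) a (j q) 0 with hw
  have hout : IsOutward (j q) w := by
    have h1 := chartCoframe_chartFrame_zero_pos hrange hj hinj hb hq
    change chartCoframe (𝓡∂ (k + 1)) (j q) (j q) 0 w < 0
    rw [hw, map_neg]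
    exact neg_lt_zero.2 h1
  obtain ⟨g, hg⟩ := exists_leftInverse_mfderiv Y (j q)
  -- An extension to `M` of the negative of the covector number `0`: it has value `1` on the image
  -- of the outward vector `w` and vanishes on the image of the boundary.
  set β : Module.Dual ℝ (TangentSpace (𝓡 n) (Y.toFun (j q))) :=
    (-chartCoframe (𝓡∂ (k + 1)) a (j q) 0) ∘ₗ g with hβ
  have hβv : ∀ v, β (mfderiv (𝓡∂ (k + 1)) (𝓡 n) Y.toFun (j q) v) =
      (-chartCoframe (𝓡∂ (k + 1)) a (j q) 0) v := fun v =>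
    congrArg (-chartCoframe (𝓡∂ (k + 1)) a (j q) 0) (congrArg (fun L => L v) hg)
  rw [flux_eq hB H Y (j q) _ _ β hβv]
  obtain ⟨ε, -, -⟩ := exists_chartBasis (mem_extChartAt_source (I := 𝓡 n) (Y.toFun (j q)))
  obtain ⟨U, hU, -, b, -⟩ := Y.continuous_coor (j q)
  have hmem : ∀ v, mfderiv (𝓡∂ (k + 1)) (𝓡 n) Y.toFun (j q) v ∈
      tangentImage (𝓡∂ (k + 1)) Y.toFun (j q) := fun v => ⟨v, rfl⟩
  have hAB : tangentImage (n := n) (𝓡 k) (Y.toFun ∘ j) q ≤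
      tangentImage (𝓡∂ (k + 1)) Y.toFun (j q) := by
    rintro _ ⟨v, rfl⟩
    exact ⟨mfderiv (𝓡 k) (𝓡∂ (k + 1)) j q v, (congrArg (fun L => L v) hcomp).symm⟩
  have key := orientedPairing_eq_fluxForm hA hB (H.toFun (Y.toFun (j q))) ε _ _ hAB _ (hmem w) _ _
    (hind q w hout) (b _ (mem_of_mem_nhds hU)) β
    (by
      rw [hβv, hw]
      simp [chartCoframe_chartFrame hq])
    (by
      rintro _ ⟨v, rfl⟩
      have h1 := congrArg (fun L => L v) hcomp
      refine (congrArg β h1).trans ((hβv _).trans ?_)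
      exact neg_eq_zero.2 (htan v))
    (by
      rintro _ ⟨u, rfl⟩
      refine ⟨-chartCoframe (𝓡∂ (k + 1)) a (j q) 0 u, ?_⟩
      obtain ⟨v, hv⟩ := exists_mfderiv_eq hrange hj hinj hb hq
        (u := u - (-chartCoframe (𝓡∂ (k + 1)) a (j q) 0 u) • w)
        (by rw [map_sub, map_smul, hw, map_neg, chartCoframe_chartFrame hq]; simp)
      refine ⟨v, ?_⟩
      refine (congrArg (fun L => L v) hcomp).trans ?_
      refine (congrArg (mfderiv (𝓡∂ (k + 1)) (𝓡 n) Y.toFun (j q)) hv).trans ?_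
      rw [map_sub, map_smul]
      rfl)
    (fun i => mfderiv (𝓡 k) (𝓡 n) (Y.toFun ∘ j) q (v i)) (fun i => ⟨v i, rfl⟩)
  refine Eq.trans (Eq.trans ?_ key) ?_
  · rfl
  · refine congrArg (fun u => fluxForm hB (H.toFun (Y.toFun (j q)))
      (tangentImage (𝓡∂ (k + 1)) Y.toFun (j q)) (Y.coor (j q)) u β) ?_
    funext i
    refine Fin.cases rfl (fun i => ?_) i
    exact congrArg (fun L => L (v i)) hcomp

end BoundaryPairing

/-! ### Change of variables from charts of the boundary part to faces of charts of `W`. -/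

section FaceTransition

variable {k : ℕ} {H' : Type*} [TopologicalSpace H']
  {I : ModelWithCorners ℝ (EuclideanSpace ℝ (Fin (k + 1))) H'} {W : Type*} [TopologicalSpace W]
  [ChartedSpace H' W] {S : Type*} [TopologicalSpace S] [ChartedSpace (EuclideanSpace ℝ (Fin k)) S]

variable (I) in
/-- The map `j` to the boundary, in the chart at `b` and the face of the chart at `a`. -/
def faceTransition (j : S → W) (b : S) (a : W) :
    EuclideanSpace ℝ (Fin k) → EuclideanSpace ℝ (Fin k) :=
  (faceProj k ∘ extChartAt I a ∘ j) ∘ (extChartAt (𝓡 k) b).symm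

/-- The function on the face of the chart at `a` given by the function `F` on `W` and the function
`ρ` on the part `S` of the boundary. -/
def faceFun (I : ModelWithCorners ℝ (EuclideanSpace ℝ (Fin (k + 1))) H') (j : S → W) (ρ : S → ℝ)
    (F : W → ℝ) (a : W) (y : EuclideanSpace ℝ (Fin k)) : ℝ :=
  Function.extend j ρ 0 ((extChartAt I a).symm (faceIncl k y)) *
    (faceIncl k ⁻¹' (extChartAt I a).target).indicator
      (fun y => F ((extChartAt I a).symm (faceIncl k y))) y

variable [IsManifold I ∞ W] {j : S → W}

theorem faceIncl_faceTransition (hrange : range I = {y | 0 ≤ y 0})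
    (hb : ∀ q, j q ∈ I.boundary W) {b : S} {a : W} {y : EuclideanSpace ℝ (Fin k)}
    (hq : j ((extChartAt (𝓡 k) b).symm y) ∈ (extChartAt I a).source) :
    faceIncl k (faceTransition I j b a y) = extChartAt I a (j ((extChartAt (𝓡 k) b).symm y)) :=
  faceIncl_faceProj ((mem_boundary_iff_extChartAt_zero hrange hq).1 (hb _))

variable [IsManifold (𝓡 k) ∞ S]

theorem contDiffAt_faceTransition (hj : ContMDiff (𝓡 k) I ∞ j) {b : S} {a : W}
    {y : EuclideanSpace ℝ (Fin k)} (hy : y ∈ (extChartAt (𝓡 k) b).target)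
    (hq : j ((extChartAt (𝓡 k) b).symm y) ∈ (extChartAt I a).source) :
    ContDiffAt ℝ ∞ (faceTransition I j b a) y := by
  have h1 := ((contMDiffAt_iff_of_mem_source (x := b) (y := a)
    (by simpa using (extChartAt (𝓡 k) b).map_target hy) (by simpa using hq)).1
    (hj ((extChartAt (𝓡 k) b).symm y))).2
  rw [(extChartAt (𝓡 k) b).right_inv hy, ModelWithCorners.range_eq_univ] at h1
  exact (faceProj k).contDiff.contDiffAt.comp y (contDiffWithinAt_univ.1 h1)

theorem det_fderiv_faceTransition (hj : ContMDiff (𝓡 k) I ∞ j) {b : S} {a : W}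
    {y : EuclideanSpace ℝ (Fin k)} (hy : y ∈ (extChartAt (𝓡 k) b).target)
    (hq : j ((extChartAt (𝓡 k) b).symm y) ∈ (extChartAt I a).source) :
    (fderiv ℝ (faceTransition I j b a) y).det = (Matrix.of fun l i =>
      chartCoframe I a (j ((extChartAt (𝓡 k) b).symm y)) (Fin.succ l)
        (mfderiv (𝓡 k) I j ((extChartAt (𝓡 k) b).symm y)
          (chartFrame (𝓡 k) b ((extChartAt (𝓡 k) b).symm y) i))).det := by
  set q := (extChartAt (𝓡 k) b).symm y with hqdef
  have h1 := (hasMFDerivAt_chartDeriv hq).comp q ((hj.mdifferentiable (by simp) q).hasMFDerivAt)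
  have h2 := ((faceProj k).hasMFDerivAt (x := extChartAt I a (j q))).comp q h1
  have h3 := hasFDerivWithinAt_comp_extChartAt_symm hy h2
  rw [ModelWithCorners.range_eq_univ] at h3
  have h4 := (hasFDerivWithinAt_univ.1 h3).fderiv
  rw [det_eq_det_matrix]
  congr 1
  funext l
  funext i
  exact congrArg (fun L : EuclideanSpace ℝ (Fin k) →L[ℝ] EuclideanSpace ℝ (Fin k) =>
    L (EuclideanSpace.single i (1 : ℝ)) l) h4

variable {ρ : S → ℝ} {F : W → ℝ} {b : S} {a : W} {K : Set W}

theorem integrableOn_faceTransition [CompactSpace S] (hrange : range I = {y | 0 ≤ y 0})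
    (hj : ContMDiff (𝓡 k) I ∞ j) (hb : ∀ q, j q ∈ I.boundary W)
    (hρ : Continuous ρ) (hρs : tsupport ρ ⊆ (extChartAt (𝓡 k) b).source) (hK : IsClosed K)
    (hKs : K ⊆ (extChartAt I a).source) (hF0 : ∀ q ∉ K, F q = 0)
    (hF : ∀ y ∈ (extChartAt I a).target, (extChartAt I a).symm y ∈ K →
      ContinuousWithinAt (F ∘ (extChartAt I a).symm) (range I) y) :
    IntegrableOn (fun y => ρ ((extChartAt (𝓡 k) b).symm y) *
      (|(fderiv ℝ (faceTransition I j b a) y).det| * F (j ((extChartAt (𝓡 k) b).symm y))))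
      (extChartAt (𝓡 k) b).target := by
  have hKc : IsCompact (tsupport ρ ∩ j ⁻¹' K) :=
    ((isClosed_tsupport ρ).inter (hK.preimage hj.continuous)).isCompact
  refine integrableOn_chart_target hKc (inter_subset_left.trans hρs) ?_ ?_
  · intro y hy hyK
    have hq := hKs hyK.2
    have hτ := contDiffAt_faceTransition hj hy hq
    have hsymm : ContinuousAt (extChartAt (𝓡 k) b).symm y := continuousAt_extChartAt_symm'' hy
    have hopen : ∀ᶠ z in 𝓝 y, j ((extChartAt (𝓡 k) b).symm z) ∈ (extChartAt I a).source :=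
      (hj.continuous.continuousAt.comp hsymm).preimage_mem_nhds
        ((isOpen_extChartAt_source a).mem_nhds hq)
    have h1 : ContinuousAt (fun z => F (j ((extChartAt (𝓡 k) b).symm z))) y := by
      -- Continuity of `F` is known only within the half-space of the chart; since `j` maps to the
      -- boundary, the map factors through the face, which lies in it.
      have h2 : (fun z => F (j ((extChartAt (𝓡 k) b).symm z))) =ᶠ[𝓝 y]
          (F ∘ (extChartAt I a).symm) ∘ fun z => faceIncl k (faceTransition I j b a z) := by
        filter_upwards [hopen] with z hz
        simp only [Function.comp_apply]
        rw [faceIncl_faceTransition hrange hb hz, (extChartAt I a).left_inv hz]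
      refine ContinuousAt.congr ?_ h2.symm
      have h3 := faceIncl_faceTransition hrange hb hq
      have h4 : ContinuousWithinAt (F ∘ (extChartAt I a).symm) (range I)
          (faceIncl k (faceTransition I j b a y)) := by
        rw [h3]
        refine hF _ ((extChartAt I a).map_source hq) ?_
        rw [(extChartAt I a).left_inv hq]
        exact hyK.2
      have h5 : ContinuousAt (fun z => faceIncl k (faceTransition I j b a z)) y :=
        (faceIncl k).continuous.continuousAt.comp hτ.continuousAt
      refine (continuousWithinAt_univ _ _).1 (ContinuousWithinAt.comp (x := y)
        (f := fun z => faceIncl k (faceTransition I j b a z)) h4 h5.continuousWithinAt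
        fun z _ => ?_)
      rw [hrange]
      exact (faceIncl_zero _).ge
    have h6 : ContinuousAt (fun z => |(fderiv ℝ (faceTransition I j b a) z).det|) y :=
      (ContinuousLinearMap.continuous_det.continuousAt.comp
        (hτ.fderiv_right (m := 0) (by norm_cast)).continuousAt).abs
    exact ((hρ.continuousAt.comp hsymm).mul (h6.mul h1)).continuousWithinAt
  · intro y hy hyK
    by_cases h1 : (extChartAt (𝓡 k) b).symm y ∈ tsupport ρ
    · rw [hF0 _ fun h => hyK ⟨h1, h⟩, mul_zero, mul_zero]
    · rw [image_eq_zero_of_notMem_tsupport h1, zero_mul]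

/-- The transition map is differentiable, and injective because `j` is, which suffices for the
change of variables onto its image. Outside the image `faceFun` vanishes: a nonzero value forces the
point to come from the support of `ρ`. -/
theorem integral_faceTransition [CompactSpace S] (hrange : range I = {y | 0 ≤ y 0})
    (hj : ContMDiff (𝓡 k) I ∞ j) (hb : ∀ q, j q ∈ I.boundary W) (hji : Function.Injective j)
    (hρ : Continuous ρ) (hρs : tsupport ρ ⊆ (extChartAt (𝓡 k) b).source) (hK : IsClosed K)
    (hKs : K ⊆ (extChartAt I a).source) (hF0 : ∀ q ∉ K, F q = 0)
    (hF : ∀ y ∈ (extChartAt I a).target, (extChartAt I a).symm y ∈ K →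
      ContinuousWithinAt (F ∘ (extChartAt I a).symm) (range I) y) :
    Integrable (faceFun I j ρ F a) ∧
    ∫ y in (extChartAt (𝓡 k) b).target, ρ ((extChartAt (𝓡 k) b).symm y) *
      (|(fderiv ℝ (faceTransition I j b a) y).det| * F (j ((extChartAt (𝓡 k) b).symm y))) =
      ∫ y, faceFun I j ρ F a y := by
  have hint := integrableOn_faceTransition hrange hj hb hρ hρs hK hKs hF0 hF
  set m : EuclideanSpace ℝ (Fin k) → ℝ := fun y => ρ ((extChartAt (𝓡 k) b).symm y) *
      (|(fderiv ℝ (faceTransition I j b a) y).det| * F (j ((extChartAt (𝓡 k) b).symm y))) with hm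
  set s : Set (EuclideanSpace ℝ (Fin k)) := (extChartAt (𝓡 k) b).target ∩
    (extChartAt (𝓡 k) b).symm ⁻¹' (j ⁻¹' (extChartAt I a).source) with hs
  have hsm : MeasurableSet s := measurableSet_extChartAt_target_inter b
    ((isOpen_extChartAt_source a).preimage hj.continuous)
  have hτ : ∀ y ∈ s, HasFDerivWithinAt (faceTransition I j b a)
      (fderiv ℝ (faceTransition I j b a) y) s y := fun y hy =>
    ((contDiffAt_faceTransition hj hy.1 hy.2).differentiableAt
      (by simp)).hasFDerivAt.hasFDerivWithinAt
  have hinj : InjOn (faceTransition I j b a) s := by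
    intro y hy z hz hyz
    have h1 := congrArg (faceIncl k) hyz
    rw [faceIncl_faceTransition hrange hb hy.2, faceIncl_faceTransition hrange hb hz.2] at h1
    exact (extChartAt (𝓡 k) b).symm.injOn hy.1 hz.1
      (hji ((extChartAt I a).injOn hy.2 hz.2 h1))
  have hms : ∀ y ∈ s, |(fderiv ℝ (faceTransition I j b a) y).det| •
      faceFun I j ρ F a (faceTransition I j b a y) = m y := by
    intro y hy
    have hq : j ((extChartAt (𝓡 k) b).symm y) ∈ (extChartAt I a).source := hy.2
    have h1 : faceTransition I j b a y ∈ faceIncl k ⁻¹' (extChartAt I a).target := by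
      rw [mem_preimage, faceIncl_faceTransition hrange hb hq]
      exact (extChartAt I a).map_source hq
    simp only [faceFun, hm]
    rw [indicator_of_mem h1, faceIncl_faceTransition hrange hb hq,
      (extChartAt I a).left_inv hq, hji.extend_apply, smul_eq_mul]
    ring
  have hsupp : ∀ y, y ∉ faceTransition I j b a '' s → faceFun I j ρ F a y = 0 := by
    intro y hy
    by_contra hne
    have h1 := left_ne_zero_of_mul hne
    have h2 : faceIncl k y ∈ (extChartAt I a).target := by
      by_contra h
      exact right_ne_zero_of_mul hne (indicator_of_notMem (mt mem_preimage.1 h) _)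
    have h3 : ∃ q, j q = (extChartAt I a).symm (faceIncl k y) := by
      by_contra h
      exact h1 (Function.extend_apply' _ _ _ h)
    obtain ⟨q, hq⟩ := h3
    rw [← hq, hji.extend_apply] at h1
    have hqb : q ∈ (extChartAt (𝓡 k) b).source := hρs (subset_tsupport ρ h1)
    have hqa : j q ∈ (extChartAt I a).source := hq ▸ (extChartAt I a).map_target h2
    refine hy ⟨extChartAt (𝓡 k) b q, ⟨(extChartAt (𝓡 k) b).map_source hqb, ?_⟩, ?_⟩
    · rw [mem_preimage, (extChartAt (𝓡 k) b).left_inv hqb]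
      exact hqa
    · simp only [faceTransition, Function.comp_apply]
      rw [(extChartAt (𝓡 k) b).left_inv hqb, hq, (extChartAt I a).right_inv h2,
        faceProj_faceIncl]
  have hm0 : ∀ y ∈ (extChartAt (𝓡 k) b).target \ s, m y = 0 := by
    intro y hy
    have h1 : j ((extChartAt (𝓡 k) b).symm y) ∉ K := fun h => hy.2 ⟨hy.1, hKs h⟩
    simp only [hm]
    rw [hF0 _ h1, mul_zero, mul_zero]
  constructor
  · rw [← integrableOn_iff_integrable_of_support_subset
      (s := faceTransition I j b a '' s) fun y hy => by
        by_contra h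
        exact hy (hsupp y h)]
    rw [integrableOn_image_iff_integrableOn_abs_det_fderiv_smul volume hsm hτ hinj]
    exact (hint.mono_set inter_subset_left).congr_fun (fun y hy => (hms y hy).symm) hsm
  · rw [← setIntegral_eq_integral_of_forall_compl_eq_zero hsupp,
      integral_image_eq_integral_abs_det_fderiv_smul volume hsm hτ hinj,
      setIntegral_eq_of_subset_of_forall_sdiff_eq_zero (measurableSet_extChartAt_target b)
        inter_subset_left hm0]
    exact setIntegral_congr_fun hsm fun y hy => (hms y hy).symm

end FaceTransition

/-! ### The integral over a boundary part as a sum over faces. -/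

section Charge

variable {n k p : ℕ} {S : Type*} [TopologicalSpace S] [ChartedSpace (EuclideanSpace ℝ (Fin k)) S]
  [IsManifold (𝓡 k) ∞ S] [CompactSpace S] [T2Space S]
  {W : Type*} [TopologicalSpace W] [ChartedSpace (EuclideanHalfSpace (k + 1)) W]
  [IsManifold (𝓡∂ (k + 1)) ∞ W]
  {M : Type*} [TopologicalSpace M] [ChartedSpace (EuclideanSpace ℝ (Fin n)) M]
  [IsManifold (𝓡 n) ∞ M]

theorem tsupport_chartPartition_subset (c : (univ : Set S)) :
    tsupport (chartPartition k S c) ⊆ (extChartAt (𝓡 k) (c : S)).source := by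
  rw [extChartAt_source]
  exact (SmoothPartitionOfUnity.exists_isSubordinate_chartAt_source_of_isClosed
    (𝓡 k) (isClosed_univ : IsClosed (univ : Set S))).choose_spec c

variable (k S) in
theorem exists_finset_chartPartition : ∃ B : Finset (univ : Set S),
    (∀ c ∉ B, ∀ q, chartPartition k S c q = 0) ∧ ∀ q, ∑ c ∈ B, chartPartition k S c q = 1 := by
  have hfin : {c | (Function.support (chartPartition k S c)).Nonempty}.Finite :=
    (chartPartition k S).locallyFinite.finite_nonempty_of_compact
  have h0 : ∀ c ∉ hfin.toFinset, ∀ q, chartPartition k S c q = 0 := by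
    intro c hc q
    by_contra h
    exact hc (hfin.mem_toFinset.2 ⟨q, h⟩)
  refine ⟨hfin.toFinset, h0, fun q => ?_⟩
  rw [← (chartPartition k S).sum_eq_one (mem_univ q)]
  refine (finsum_eq_sum_of_support_subset _ fun c hc => ?_).symm
  by_contra h
  exact hc (h0 c h q)

/-- The integral over a part of the boundary is the flux through the corresponding part of the
faces of charts. -/
theorem IsBoundaryPart.integralDensity_pairing_eq (hA : n = (p + 1) + k) (hB : n = p + (k + 1))
    (H : MultivectorDensityField n (p + 1) M) {Y : CoorientedImmersion (𝓡∂ (k + 1)) W n M p}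
    {X : CoorientedImmersion (𝓡 k) S n M (p + 1)} {j : S → W} (hX : IsBoundaryPart Y X j)
    {T : Finset W} {ψ : W → W → ℝ} (hψ : ∀ a, Continuous (ψ a))
    (hψs : ∀ a, tsupport (ψ a) ⊆ (extChartAt (𝓡∂ (k + 1)) a).source)
    (hsum : ∀ q, ∑ a ∈ T, ψ a q = 1)
    (hG : ∀ a, ∀ y ∈ (extChartAt (𝓡∂ (k + 1)) a).target,
      (extChartAt (𝓡∂ (k + 1)) a).symm y ∈ tsupport (ψ a) →
        ContinuousWithinAt (fun y => fluxComponent hB H Y a 0 ((extChartAt (𝓡∂ (k + 1)) a).symm y))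
          (range (𝓡∂ (k + 1))) y) :
    (∀ a, Integrable fun y => (range j).indicator (fun _ => (1 : ℝ))
      ((extChartAt (𝓡∂ (k + 1)) a).symm (faceIncl k y)) * faceDensity hB H Y a (ψ a) y) ∧
    integralDensity (pairing hA H X) = -∑ a ∈ T, ∫ y, (range j).indicator (fun _ => (1 : ℝ))
      ((extChartAt (𝓡∂ (k + 1)) a).symm (faceIncl k y)) * faceDensity hB H Y a (ψ a) y := by
  classical
  obtain ⟨B, hB0, hB1⟩ := exists_finset_chartPartition k S
  have hrange := range_modelWithCornersEuclideanHalfSpace (k + 1)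
  set F : W → W → ℝ := fun a q => ψ a q * fluxComponent hB H Y a 0 q with hF
  have hF0 : ∀ a, ∀ q ∉ tsupport (ψ a), F a q = 0 := fun a q hq => by
    simp only [hF]
    rw [image_eq_zero_of_notMem_tsupport hq, zero_mul]
  have hFc : ∀ a, ∀ y ∈ (extChartAt (𝓡∂ (k + 1)) a).target,
      (extChartAt (𝓡∂ (k + 1)) a).symm y ∈ tsupport (ψ a) →
        ContinuousWithinAt (F a ∘ (extChartAt (𝓡∂ (k + 1)) a).symm) (range (𝓡∂ (k + 1))) y :=
    fun a y hy hyK => ((hψ a).continuousAt.comp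
      (continuousAt_extChartAt_symm'' hy)).continuousWithinAt.mul (hG a y hy hyK)
  have hmain := fun (a : W) (c : (univ : Set S)) => integral_faceTransition hrange hX.smooth
    hX.mem_boundary hX.injective (chartPartition k S c).contMDiff.continuous
    (tsupport_chartPartition_subset c) (isClosed_tsupport (ψ a)) (hψs a) (hF0 a) (hFc a)
  have hint := fun (a : W) (c : (univ : Set S)) => integrableOn_faceTransition hrange hX.smooth
    hX.mem_boundary (chartPartition k S c).contMDiff.continuous
    (tsupport_chartPartition_subset c) (isClosed_tsupport (ψ a)) (hψs a) (hF0 a) (hFc a)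
  -- The partition of unity on `S`, extended by zero off the image of `j`, adds up to the indicator
  -- function of that image.
  have hface : ∀ a y, ∑ c ∈ B, faceFun (𝓡∂ (k + 1)) j (chartPartition k S c) (F a) a y =
      (range j).indicator (fun _ => (1 : ℝ)) ((extChartAt (𝓡∂ (k + 1)) a).symm (faceIncl k y)) *
        faceDensity hB H Y a (ψ a) y := by
    intro a y
    simp only [faceFun]
    rw [← Finset.sum_mul]
    congr 1
    by_cases hx : (extChartAt (𝓡∂ (k + 1)) a).symm (faceIncl k y) ∈ range j
    · rw [indicator_of_mem hx]
      obtain ⟨q, hq⟩ := hx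
      simp only [← hq, hX.injective.extend_apply]
      exact hB1 q
    · rw [indicator_of_notMem hx]
      exact Finset.sum_eq_zero fun c _ => Function.extend_apply' _ _ _ hx
  constructor
  · intro a
    simp only [← hface]
    exact integrable_finsetSum _ fun c _ => (hmain a c).1
  have hchart : ∀ c : (univ : Set S),
      ∫ y in (chartAt (EuclideanSpace ℝ (Fin k)) (c : S)).target,
        chartPartition k S c ((chartAt (EuclideanSpace ℝ (Fin k)) (c : S)).symm y) *
          pairing hA H X ((chartAt (EuclideanSpace ℝ (Fin k)) (c : S)).symm y)
          (coordVector (chartAt (EuclideanSpace ℝ (Fin k)) (c : S)) y) =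
        -∑ a ∈ T, ∫ y, faceFun (𝓡∂ (k + 1)) j (chartPartition k S c) (F a) a y := by
    intro c
    have ht : (extChartAt (𝓡 k) (c : S)).target =
        (chartAt (EuclideanSpace ℝ (Fin k)) (c : S)).target := by simp
    rw [Finset.sum_congr rfl fun a _ => (hmain a c).2.symm, ← integral_finsetSum _ fun a _ => hint a c, ← integral_neg, ht]
    refine setIntegral_congr_fun
      (chartAt (EuclideanSpace ℝ (Fin k)) (c : S)).open_target.measurableSet fun y hy => ?_
    have hy' : y ∈ (extChartAt (𝓡 k) (c : S)).target := ht ▸ hy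
    -- The partition on `W` is inserted as a factor `1`, so that each term can be treated in a
    -- single chart of `W`.
    rw [coordVector_eq_chartFrame hy, ← mul_one (chartPartition k S c _),
      ← hsum (j ((chartAt (EuclideanSpace ℝ (Fin k)) (c : S)).symm y)), Finset.mul_sum,
      Finset.sum_mul, ← Finset.sum_neg_distrib]
    refine Finset.sum_congr rfl fun a _ => ?_
    change _ = -(chartPartition k S c ((chartAt (EuclideanSpace ℝ (Fin k)) (c : S)).symm y) *
      (_ * (ψ a (j ((chartAt (EuclideanSpace ℝ (Fin k)) (c : S)).symm y)) *
        fluxComponent hB H Y a 0 (j ((chartAt (EuclideanSpace ℝ (Fin k)) (c : S)).symm y)))))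
    by_cases hq : j ((chartAt (EuclideanSpace ℝ (Fin k)) (c : S)).symm y) ∈
        (extChartAt (𝓡∂ (k + 1)) a).source
    · have h1 : ∀ r s d g : ℝ, r * s * -(d * g) = -(r * (d * (s * g))) := fun _ _ _ _ => by ring
      rw [hX.pairing_eq hA hB H hq]
      refine (h1 _ _ _ _).trans ?_
      rw [det_fderiv_faceTransition hX.smooth hy' hq]
      rfl
    · rw [image_eq_zero_of_notMem_tsupport fun h => hq (hψs a h)]
      simp
  rw [integralDensity, finsum_eq_sum_of_support_subset (s := B)]
  · simp only [hchart]
    rw [Finset.sum_neg_distrib, Finset.sum_comm]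
    congr 1
    refine Finset.sum_congr rfl fun a _ => ?_
    rw [← integral_finsetSum _ fun c _ => (hmain a c).1]
    simp only [hface]
  · intro c hc
    by_contra h
    refine hc ?_
    simp only [hB0 c h, zero_mul, integral_zero]

end Charge

/-! ### Reversal of the coorientation. -/

section Neg

variable {n k p : ℕ} {M : Type*} [TopologicalSpace M] [ChartedSpace (EuclideanSpace ℝ (Fin n)) M]
  [IsManifold (𝓡 n) ∞ M]

open Classical in
theorem ite_orientation_neg {V ι : Type*} [AddCommGroup V] [Module ℝ V] [Fintype ι] [DecidableEq ι]
    (b : Module.Basis ι ℝ V) (o : Orientation ℝ V ι) :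
    (if b.orientation = -o then (1 : ℝ) else -1) = -(if b.orientation = o then 1 else -1) := by
  have hne : b.orientation ≠ -b.orientation := Module.Ray.ne_neg_self b.orientation
  rcases b.orientation_eq_or_eq_neg o with h | h
  · rw [h, if_neg hne, if_pos rfl]
  · have h1 : - -b.orientation = b.orientation := neg_neg (G := Module.Ray ℝ _) b.orientation
    rw [h, h1, if_pos rfl, if_neg hne, neg_neg]

theorem pairing_neg {S : Type*} [TopologicalSpace S] [ChartedSpace (EuclideanSpace ℝ (Fin k)) S]
    (hn : n = p + k) (H : MultivectorDensityField n p M)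
    (X : CoorientedImmersion (𝓡 k) S n M p) (q : S) (v : Fin k → TangentSpace (𝓡 k) q) :
    pairing hn H X.neg q v = -pairing hn H X q v := by
  unfold pairing
  by_cases h : Nonempty (Module.Basis (Fin p) ℝ (NormalSpace (n := n) (𝓡 k) X.toFun q))
  · have h' : Nonempty (Module.Basis (Fin p) ℝ (NormalSpace (n := n) (𝓡 k) X.neg.toFun q)) := h
    rw [dif_pos h, dif_pos h', ← neg_mul]
    refine congrArg₂ _ ?_ rfl
    exact ite_orientation_neg h.some (X.coor q)
  · rw [dif_neg h, neg_zero]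
    exact dif_neg h

theorem charge_neg (hn : n = p + k) (H : MultivectorDensityField n p M)
    (X : CoorientedImmersion (𝓡 k) (StdSphere k) n M p) :
    charge hn H X.neg = -charge hn H X := by
  unfold charge integralDensity
  rw [← finsum_neg_distrib]
  refine finsum_congr fun c => ?_
  rw [← integral_neg]
  simp only [pairing_neg, mul_neg]

end Neg

end ElectricCharge

end

/-! ### The theorem on electric charges. -/

open ElectricCharge in
theorem mainTheorem1 (n k p : ℕ) (hn : n = (p + 1) + k)
    (M : Type*) [TopologicalSpace M] [ChartedSpace (EuclideanSpace ℝ (Fin n)) M]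
    [IsManifold (𝓡 n) ∞ M]
    (H : MultivectorDensityField n (p + 1) M) (hH : IsDivergenceFree H)
    (W : Type*) [TopologicalSpace W] [ChartedSpace (EuclideanHalfSpace (k + 1)) W]
    [IsManifold (𝓡∂ (k + 1)) ∞ W] [CompactSpace W] [T2Space W]
    (Y : CoorientedImmersion (𝓡∂ (k + 1)) W n M p) :
    (∀ X : CoorientedImmersion (𝓡 k) (StdSphere k) n M (p + 1),
      IsBoundary Y X → charge hn H X = 0) ∧
    (∀ X X' : CoorientedImmersion (𝓡 k) (StdSphere k) n M (p + 1),
      IsBoundaryPair Y X X'.neg → charge hn H X = charge hn H X') := by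
  have hB : n = p + (k + 1) := by omega
  have hrange := range_modelWithCornersEuclideanHalfSpace (k + 1)
  obtain ⟨T, ψ, hψ, hψs, hsum, hG, hzero⟩ :=
    exists_partition_sum_integral_faceDensity_eq_zero hB H Y hH hrange
  -- The face densities live on boundary points only, so the indicator function of the whole
  -- boundary can be dropped from the integrals.
  have hface : ∀ (a : W) (y : EuclideanSpace ℝ (Fin k)), faceDensity hB H Y a (ψ a) y ≠ 0 →
      (extChartAt (𝓡∂ (k + 1)) a).symm (faceIncl k y) ∈ (𝓡∂ (k + 1)).boundary W := by
    intro a y hy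
    have ht : faceIncl k y ∈ (extChartAt (𝓡∂ (k + 1)) a).target := by
      by_contra h
      exact hy (if_neg h)
    rw [mem_boundary_iff_extChartAt_zero hrange ((extChartAt (𝓡∂ (k + 1)) a).map_target ht),
      (extChartAt (𝓡∂ (k + 1)) a).right_inv ht, faceIncl_zero]
  refine ⟨fun X => ?_, fun X X' => ?_⟩
  · rintro ⟨j, hX, hj⟩
    rw [charge, (hX.integralDensity_pairing_eq hn hB H hψ hψs hsum hG).2, hj, neg_eq_zero]
    refine Eq.trans (Finset.sum_congr rfl fun a _ => ?_) hzero
    refine integral_congr_ae (Filter.Eventually.of_forall fun y => ?_)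
    by_cases hy : faceDensity hB H Y a (ψ a) y = 0
    · simp only [hy, mul_zero]
    · simp only [indicator_of_mem (hface a y hy), one_mul]
  · rintro ⟨j, j', hX, hX', hdisj, hj⟩
    have h1 := hX.integralDensity_pairing_eq hn hB H hψ hψs hsum hG
    have h2 := hX'.integralDensity_pairing_eq hn hB H hψ hψs hsum hG
    have h3 : charge hn H X + charge hn H X'.neg = 0 := by
      rw [charge, charge, h1.2, h2.2, ← neg_add, neg_eq_zero, ← Finset.sum_add_distrib]
      refine Eq.trans (Finset.sum_congr rfl fun a _ => ?_) hzero
      rw [← integral_add (h1.1 a) (h2.1 a)]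
      refine integral_congr_ae (Filter.Eventually.of_forall fun y => ?_)
      by_cases hy : faceDensity hB H Y a (ψ a) y = 0
      · simp only [hy, mul_zero, add_zero]
      -- The two spheres have disjoint images that fill the boundary, so their indicator functions
      -- add up to `1` wherever the face density is nonzero.
      · have h4 := congrFun (indicator_union_of_disjoint hdisj fun _ => (1 : ℝ))
          ((extChartAt (𝓡∂ (k + 1)) a).symm (faceIncl k y))
        rw [hj, indicator_of_mem (hface a y hy)] at h4
        simp only [← add_mul]
        rw [← h4, one_mul]
    rw [charge_neg] at h3
    linarith
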